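/- **Setup.** Let $q\in\mathbb R$ and let $\Xi=(\xi_j)_{j\ge 0}$, $\mathsf S=(s_j)_{j\ge 0}$ be real sequences such that $0<q<1$; the $\xi_j$ are positive and uniformly bounded away from $0$ and $+\infty$; the $s_j$ belong to $(-1,0)$ and are uniformly bounded away from $-1$ and $0$. Assume moreover $$\inf_j \xi_j^{-1}|s_j| > q\,\sup_j \xi_j^{-1}|s_j|,\qquad \inf_j \xi_j^{-1}|s_j|^{-1} > \sup_j \xi_j^{-1}|s_j| .$$ Write $\overline\Xi=(\xi_j^{-1})_{j\ge0}$, $P_1=\{\xi_j^{-1}s_j\}_{j\ge 0}$, $P_2=\{\xi_j^{-1}s_j^{-1}\}_{j\ge 0}$, $(z;q)_n=\prod_{i=0}^{n-1}(1-zq^i)$. Let $k\ge1$ and let $\mathsf{Sign}^+_k$ be the set of integer sequences $\lambda_1\ge\dots\ge\lambda_k\ge0$. *Functions.* For $s,u$ and $g\in\mathbb Z_{\ge0}$ define vertex weights $w_{u,s}(i_1,j_1;i_2,j_2)$ ($i_1,j_1$ paths entering from below and from the left, $i_2,j_2$ paths leaving upwards and to the right) by $$w_{u,s}(g,0;g,0)=\tfrac{1-sq^gu}{1-su},\quad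 w_{u,s}(g+1,0;g,1)=\tfrac{(1-s^2q^g)u}{1-su},\quad w_{u,s}(g,1;g,1)=\tfrac{u-sq^g}{1-su},\quad w_{u,s}(g,1;g+1,0)=\tfrac{1-q^{g+1}}{1-su},$$ all other weights being zero. For $\lambda\in\mathsf{Sign}_k^+$, $\mathsf F_\lambda(u_1,\dots,u_k\,|\,\Xi,\mathsf S)$ is the sum, over all collections of $k$ up-right paths which start with the horizontal edges $(-1,y)\to(0,y)$, $y=1,\dots,k$, and end with the vertical edges $(\lambda_i,k)\to(\lambda_i,k+1)$, $i=1,\dots,k$, of the product over the vertices $(x,y)$, $x\ge0$, $1\le y\le k$, of the weights $w_{\xi_xu_y,s_x}$. Collections are identified with their numbers of paths along the edges. Set $$\mathsf c_{\mathsf S}(\lambda)=\prod_{x\ge0}\frac{(s_x^2;q)_{n_x}}{(q;q)_{n_x}},\quad n_x=\#\{i:\lambda_i=x\},\qquad \mathsf F^{\mathsf c}_\lambda=\mathsf c_{\mathsf S}(\lambda)\,\mathsf F_\lambda,$$ $$\varphi_m(u\,|\,\Xi,\mathsf S)=\frac{1-q}{1-s_m\xi_mu}\prod_{j=0}^{m-1}\frac{\xi_ju-s_j}{1-s_j\xi_ju}.$$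 *Contours.* All contours are piecewise $C^1$, simple, closed and positively oriented. A system $\gamma_1,\dots,\gamma_k$ of contours is called *$q$-nested* if each $\gamma_\alpha$ has all points of $P_1$ in its interior and all points of $P_2$ in its exterior; for all $\beta>\alpha$ the interior of $\gamma_\alpha$ contains $q\gamma_\beta$; and $\gamma_k$ does not intersect $q\gamma_k$. A contour $\gamma$ is called *large* if its interior contains $P_1\cup qP_1\cup\dots\cup q^{k-1}P_1$ and $q\gamma$, and its exterior contains $P_2$. **Theorem.** Under these assumptions $q$-nested systems $\gamma_1,\dots,\gamma_k$ and large contours $\gamma$ exist, and for all $\lambda,\mu\in\mathsf{Sign}^+_k$ the following holds. 1. For every $q$-nested system $\gamma_1,\dots,\gamma_k$, $$(1-q)^{-k}\oint_{\gamma_1}\frac{du_1}{2\pi \mathrm i}\cdots\oint_{\gamma_k}\frac{du_k}{2\pi \mathrm i}\prod_{1\le\alpha<\beta\le k}\frac{u_\alpha-u_\beta}{u_\alpha-qu_\beta}\;\mathsf F^{\mathsf c}_\lambda(u_1,\dots,u_k\,|\,\Xi,\mathsf S)\prod_{i=1}^k u_i^{-1}\varphi_{\mu_i}(u_i^{-1}\,|\,\overline\Xi,\mathsf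 S)=\mathbf 1_{\lambda=\mu}.$$ 2. For every large contour $\gamma$, $$\frac{\mathsf c_{\mathsf S}(\lambda)}{(1-q)^kk!}\oint_{\gamma}\frac{du_1}{2\pi \mathrm i u_1}\cdots\oint_{\gamma}\frac{du_k}{2\pi \mathrm i u_k}\prod_{\alpha\ne\beta}\frac{u_\alpha-u_\beta}{u_\alpha-qu_\beta}\;\mathsf F_\lambda(u_1,\dots,u_k\,|\,\Xi,\mathsf S)\,\mathsf F_\mu(u_1^{-1},\dots,u_k^{-1}\,|\,\overline\Xi,\mathsf S)=\mathbf 1_{\lambda=\mu}.$$ -/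

import Mathlib

open scoped BigOperators

noncomputable section

/-- Nonnegative signatures `lam 0 ≥ lam 1 ≥ ... ≥ lam (k-1) ≥ 0` of length `k`. -/
abbrev NonnegSignature (k : ℕ) : Type := {lam : Fin k → ℕ // Antitone lam}

/-- The multiplicity of `x` in a signature: the number of parts equal to `x`. -/
def NonnegSignature.mult {k : ℕ} (lam : NonnegSignature k) (x : ℕ) : ℕ :=
  (Finset.univ.filter fun i : Fin k => lam.1 i = x).card

/-- The `q`-Pochhammer symbol `(z; q)_n`, for `n ≥ 0`. -/
def qPoch (z q : ℂ) (n : ℕ) : ℂ := ∏ i ∈ Finset.range n, (1 - z * q ^ i)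

/-- The higher spin six vertex weights `w_{u,s}(i₁, j₁; i₂, j₂)`: `i₁`, `j₁` are the numbers of
arrows entering the vertex from below and from the left, `i₂`, `j₂` the numbers of arrows leaving
it upwards and to the right. -/
def vertexWeight (q s u : ℂ) (i₁ j₁ i₂ j₂ : ℕ) : ℂ :=
  if j₁ = 0 ∧ j₂ = 0 ∧ i₂ = i₁ then (1 - s * q ^ i₁ * u) / (1 - s * u)
  else if j₁ = 0 ∧ j₂ = 1 ∧ i₁ = i₂ + 1 then (1 - s ^ 2 * q ^ i₂) * u / (1 - s * u)
  else if j₁ = 1 ∧ j₂ = 1 ∧ i₂ = i₁ then (u - s * q ^ i₁) / (1 - s * u)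
  else if j₁ = 1 ∧ j₂ = 0 ∧ i₂ = i₁ + 1 then (1 - q ^ (i₁ + 1)) / (1 - s * u)
  else 0

/-- Collections of `k` up-right paths in the strip of columns `x = 0, 1, 2, ...` and of `k` rows,
recorded by the number of paths along each edge. The row with index `y : Fin k` is the
`(y+1)`-st row from below. Each row is entered by exactly one path through its leftmost horizontal
edge, no path enters from below, and at the top the paths leave through the vertical edges
prescribed by the parts of `lam`. -/
@[ext]
structure PathCollection {k : ℕ} (lam : NonnegSignature k) where
  /-- `vert x y` is the number of paths along the vertical edge in column `x` which is below
  the row `y` (for `y = k`: above the last row). -/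
  vert : ℕ → Fin (k + 1) → ℕ
  /-- `horiz x y` is the number of paths along the horizontal edge entering the vertex `(x, y)`
  from the left. -/
  horiz : ℕ → Fin k → ℕ
  bottom : ∀ x, vert x 0 = 0
  left : ∀ y, horiz 0 y = 1
  top : ∀ x, vert x (Fin.last k) = lam.mult x
  conserve : ∀ x y, vert x y.castSucc + horiz x y = vert x y.succ + horiz (x + 1) y

theorem PathCollection.flow {k : ℕ} {lam : NonnegSignature k} (P : PathCollection lam) (x : ℕ) :
    lam.mult x + ∑ y, P.horiz (x + 1) y = ∑ y, P.horiz x y := by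
  have h := Finset.sum_congr rfl fun (y : Fin k) (_ : y ∈ Finset.univ) => P.conserve x y
  rw [Finset.sum_add_distrib, Finset.sum_add_distrib] at h
  have h1 := Fin.sum_univ_succ (fun y => P.vert x y)
  have h2 := Fin.sum_univ_castSucc (fun y => P.vert x y)
  have h3 := P.bottom x
  have h4 := P.top x
  omega

theorem NonnegSignature.sum_mult {k : ℕ} (lam : NonnegSignature k) (n : ℕ) (hn : ∀ i, lam.1 i < n) :
    ∑ x ∈ Finset.range n, lam.mult x = k := by
  have := Finset.card_eq_sum_card_fiberwise (f := lam.1) (s := Finset.univ) (t := Finset.range n)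
    (by intro i _; simpa using hn i)
  simpa [NonnegSignature.mult] using this.symm

theorem PathCollection.sum_horiz {k : ℕ} {lam : NonnegSignature k} (P : PathCollection lam)
    (x : ℕ) : (∑ x' ∈ Finset.range x, lam.mult x') + ∑ y, P.horiz x y = k := by
  induction x with
  | zero => simp [P.left]
  | succ x ih => rw [Finset.sum_range_succ]; have := P.flow x; omega

theorem PathCollection.horiz_le {k : ℕ} {lam : NonnegSignature k} (P : PathCollection lam)
    (x : ℕ) (y : Fin k) : P.horiz x y ≤ k := by
  have h1 := P.sum_horiz x
  have h2 := Finset.single_le_sum (f := fun y => P.horiz x y) (fun _ _ => Nat.zero_le _)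
    (Finset.mem_univ y)
  omega

theorem PathCollection.horiz_eq_zero {k : ℕ} {lam : NonnegSignature k} (P : PathCollection lam)
    (x : ℕ) (hx : ∀ i, lam.1 i < x) (y : Fin k) : P.horiz x y = 0 := by
  have h1 := P.sum_horiz x
  have h2 := Finset.single_le_sum (f := fun y => P.horiz x y) (fun _ _ => Nat.zero_le _)
    (Finset.mem_univ y)
  rw [lam.sum_mult x hx] at h1
  omega

theorem PathCollection.vert_le {k : ℕ} {lam : NonnegSignature k} (P : PathCollection lam)
    (x : ℕ) (y : Fin (k + 1)) : P.vert x y ≤ ∑ y, P.horiz x y := by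
  have key : ∀ n : ℕ, ∀ hn : n < k + 1,
      P.vert x ⟨n, hn⟩ ≤ ∑ y ∈ Finset.univ.filter (fun y : Fin k => (y : ℕ) < n), P.horiz x y := by
    intro n
    induction n with
    | zero => intro hn; have := P.bottom x; simp_all
    | succ n ih =>
      intro hn
      have h1 := P.conserve x ⟨n, by omega⟩
      have h2 := ih (by omega)
      have h3 : (Finset.univ.filter (fun y : Fin k => (y : ℕ) < n + 1))
          = insert (⟨n, by omega⟩ : Fin k) (Finset.univ.filter (fun y : Fin k => (y : ℕ) < n)) := by
        ext y; simp [Fin.ext_iff]; omega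
      rw [h3, Finset.sum_insert (by simp)]
      simp only [Fin.castSucc_mk, Fin.succ_mk] at h1
      omega
  refine (key y.1 y.2).trans ?_
  exact Finset.sum_le_sum_of_subset (Finset.filter_subset _ _)

/-- There are only finitely many path collections with given endpoints. -/
instance PathCollection.finite {k : ℕ} (lam : NonnegSignature k) : Finite (PathCollection lam) := by
  obtain ⟨n, hn⟩ : ∃ n, ∀ i, lam.1 i < n :=
    ⟨∑ i, lam.1 i + 1, fun i => Nat.lt_succ_of_le
      (Finset.single_le_sum (f := fun i => lam.1 i) (fun _ _ => Nat.zero_le _) (Finset.mem_univ i))⟩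
  have hv : ∀ (P : PathCollection lam) x y, P.vert x y ≤ k := fun P x y => by
    have h1 := P.vert_le x y
    have h2 := P.sum_horiz x
    omega
  let f : PathCollection lam →
      (Fin n → Fin (k + 1) → Fin (k + 1)) × (Fin n → Fin k → Fin (k + 1)) := fun P =>
    (fun x y => ⟨P.vert x y, Nat.lt_succ_of_le (hv P x y)⟩,
      fun x y => ⟨P.horiz x y, Nat.lt_succ_of_le (P.horiz_le x y)⟩)
  refine Finite.of_injective f fun P Q h => ?_
  have h1 := congrArg Prod.fst h
  have h2 := congrArg Prod.snd h
  have hz : ∀ (R : PathCollection lam) x, n ≤ x → ∀ y, R.horiz x y = 0 := fun R x hx y =>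
    R.horiz_eq_zero x (fun i => (hn i).trans_le hx) y
  ext x y
  · by_cases hx : x < n
    · simpa [f] using congrFun (congrFun h1 ⟨x, hx⟩) y
    · have a := P.vert_le x y
      have b := Q.vert_le x y
      simp only [hz _ x (not_lt.1 hx), Finset.sum_const_zero] at a b
      omega
  · by_cases hx : x < n
    · simpa [f] using congrFun (congrFun h2 ⟨x, hx⟩) y
    · rw [hz P x (not_lt.1 hx), hz Q x (not_lt.1 hx)]

/-- The weight of a path collection: the product of all vertex weights, with spectral parameter
`ξ x * u y` and parameter `s x` at the vertex `(x, y)`. Only finitely many vertices are nonempty,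
and the empty vertex has weight one. -/
def PathCollection.weight {k : ℕ} {lam : NonnegSignature k} (P : PathCollection lam)
    (q : ℂ) (ξ s : ℕ → ℂ) (u : Fin k → ℂ) : ℂ :=
  ∏ᶠ x : ℕ, ∏ y : Fin k,
    vertexWeight q (s x) (ξ x * u y)
      (P.vert x y.castSucc) (P.horiz x y) (P.vert x y.succ) (P.horiz (x + 1) y)

/-- The symmetric rational function `F_lam(u_1, ..., u_k | ξ, s)`: the partition function of path
collections. There are finitely many of them, so that the sum is a genuine finite sum. -/
def symF {k : ℕ} (q : ℂ) (ξ s : ℕ → ℂ) (lam : NonnegSignature k) (u : Fin k → ℂ) : ℂ :=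
  ∑ᶠ P : PathCollection lam, P.weight q ξ s u

/-- The conjugation factor `c_s(lam) = ∏_x (s_x²; q)_{n_x} / (q; q)_{n_x}`, with `n_x` the
multiplicity of `x` in `lam`. -/
def conjFactor {k : ℕ} (q : ℂ) (s : ℕ → ℂ) (lam : NonnegSignature k) : ℂ :=
  ∏ᶠ x : ℕ, qPoch (s x ^ 2) q (lam.mult x) / qPoch q q (lam.mult x)

/-- The conjugated function `F^c_lam = c_s(lam) F_lam`. -/
def symFc {k : ℕ} (q : ℂ) (ξ s : ℕ → ℂ) (lam : NonnegSignature k) (u : Fin k → ℂ) : ℂ :=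
  conjFactor q s lam * symF q ξ s lam u

/-- The functions `φ_m(u | ξ, s)`. -/
def phi (q : ℂ) (ξ s : ℕ → ℂ) (m : ℕ) (u : ℂ) : ℂ :=
  (1 - q) / (1 - s m * ξ m * u) *
    ∏ j ∈ Finset.range m, (ξ j * u - s j) / (1 - s j * ξ j * u)

/-- The image of the parametrized curve `γ : [0,1] → ℂ`. -/
def curveTrace (γ : ℝ → ℂ) : Set ℂ := γ '' Set.Icc 0 1

/-- Points off the curve lying in a bounded connected component of its complement. -/
def curveInterior (γ : ℝ → ℂ) : Set ℂ :=
  {z | z ∉ curveTrace γ ∧ Bornology.IsBounded (connectedComponentIn (curveTrace γ)ᶜ z)}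

/-- Points off the curve lying in an unbounded connected component of its complement. -/
def curveExterior (γ : ℝ → ℂ) : Set ℂ :=
  {z | z ∉ curveTrace γ ∧ ¬ Bornology.IsBounded (connectedComponentIn (curveTrace γ)ᶜ z)}

/-- The normalized contour integral `∮_γ f(u) du / (2πi)`. -/
def contourIntegral (γ : ℝ → ℂ) (f : ℂ → ℂ) : ℂ :=
  (2 * (Real.pi : ℂ) * Complex.I)⁻¹ * ∫ t in (0 : ℝ)..1, f (γ t) * deriv γ t

/-- `γ : [0,1] → ℂ` is a piecewise continuously differentiable, simple closed, positively
oriented contour (it has winding number one around each point of its interior). -/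
structure IsContour (γ : ℝ → ℂ) : Prop where
  continuousOn : ContinuousOn γ (Set.Icc 0 1)
  piecewise_contDiff : ∃ S : Finset ℝ, ∀ a b : ℝ, 0 ≤ a → a < b → b ≤ 1 →
    Disjoint (Set.Ioo a b) (S : Set ℝ) → ContDiffOn ℝ 1 γ (Set.Icc a b)
  closed : γ 0 = γ 1
  simple : Set.InjOn γ (Set.Ico 0 1)
  positive : ∀ z ∈ curveInterior γ, contourIntegral γ (fun w => (w - z)⁻¹) = 1

/-- The iterated integral `∮_{γ_0} du_0/(2πi) ... ∮_{γ_{k-1}} du_{k-1}/(2πi) f(u)`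
(the outermost integral is over `u_0`). -/
def nestedIntegral : (k : ℕ) → (Fin k → ℝ → ℂ) → ((Fin k → ℂ) → ℂ) → ℂ
  | 0, _, f => f Fin.elim0
  | k + 1, γ, f =>
      contourIntegral (γ 0) fun z =>
        nestedIntegral k (fun i => γ i.succ) fun u => f (Fin.cons z u)

/-- The stochasticity assumptions: `0 < q < 1`; the `ξ_j` are positive, uniformly bounded away from
`0` and `∞`; the `s_j` are in `(-1, 0)`, uniformly bounded away from `-1` and `0`. -/
structure StochasticParams (q : ℝ) (ξ s : ℕ → ℝ) : Prop where
  q_pos : 0 < q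
  q_lt_one : q < 1
  ξ_bounds : ∃ a b : ℝ, 0 < a ∧ ∀ j, a ≤ ξ j ∧ ξ j ≤ b
  s_bounds : ∃ ε : ℝ, 0 < ε ∧ ∀ j, -1 + ε ≤ s j ∧ s j ≤ -ε

/-- The `q`-nested contours `γ_1, ..., γ_k`. -/
structure IsQNested (q : ℝ) (ξ s : ℕ → ℝ) {k : ℕ} (γ : Fin k → ℝ → ℂ) : Prop where
  contour : ∀ α, IsContour (γ α)
  inside : ∀ α j, (((ξ j)⁻¹ * s j : ℝ) : ℂ) ∈ curveInterior (γ α)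
  outside : ∀ α j, (((ξ j)⁻¹ * (s j)⁻¹ : ℝ) : ℂ) ∈ curveExterior (γ α)
  nested : ∀ α β, α < β → ∀ z ∈ curveTrace (γ β), (q : ℂ) * z ∈ curveInterior (γ α)
  /-- The last contour does not intersect its image under multiplication by `q`. -/
  small : ∀ α : Fin k, (α : ℕ) + 1 = k →
    ∀ z ∈ curveTrace (γ α), (q : ℂ) * z ∉ curveTrace (γ α)

/-- The large contour used for all `k` variables simultaneously. -/
structure IsLargeContour (q : ℝ) (ξ s : ℕ → ℝ) (k : ℕ) (γ : ℝ → ℂ) : Prop where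
  contour : IsContour γ
  inside : ∀ i < k, ∀ j, ((q ^ i * ((ξ j)⁻¹ * s j) : ℝ) : ℂ) ∈ curveInterior γ
  outside : ∀ j, (((ξ j)⁻¹ * (s j)⁻¹ : ℝ) : ℂ) ∈ curveExterior γ
  nested : ∀ z ∈ curveTrace γ, (q : ℂ) * z ∈ curveInterior γ

end

/-!
The functions `F_lam` are components of Bethe vectors of a higher spin six vertex model: adding a row
is the action of an operator `opB`, and the row operators `opA`, `opB` satisfy exchange relations
(`op_relations`, an induction on the number of columns which replaces the Yang–Baxter equation).
These give the algebraic Bethe ansatz formula `opA_betheVector`, from which the first column can be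
peeled off (`slice_betheVector`). Iterating over the columns expresses `F_lam(u)`, for distinct
variables, as a sum over all rearrangements ("words") `c` of the parts of `lam`, in which each
variable `u i` of colour `c i` contributes a product `pathFactor`, and each pair of variables whose
colours increase a factor `(u j - q u i) / (u j - u i)` (`symF_eq_sum_words`).

Multiplied by the kernel of the nested integral, each word yields a function without poles on the
contours (`kernel_mul_wordWeight`), in which the factor of two variables has no pole if their colours
decrease strictly. The coincidences of variables, at which the expansion is not available, do not
matter for the integral (`nestedIntegral_congr_of_injective`). For a word `c` different from `mu`
there is a variable such that, as a function of this variable, the integrand either has only exterior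
poles, or has only interior poles and decays quadratically at infinity; so its integral vanishes
(`NestedSystem.integral_word_eq_zero`). The word `mu` occurs only if `lam = mu`. Its integral is the
product of the residues at the poles `q ^ a * (ξ⁻¹ s)`, taken one after the other starting from the
last variable (`NestedSystem.integral_self`), and it is inverse to the conjugation factor.

All integrands are rational, and Cauchy's theorem is only needed for rational functions. It is
deduced from partial fractions and the winding numbers around the poles: these are one in the
interior by definition, and vanish in the exterior because the winding number is locally constant.
No Jordan curve theorem is needed; in its place,
`IsContour.exists_unbounded_avoiding` shows how interiors of nested contours are related.

For a single large contour, all the nested contours may be taken equal to it. The symmetrization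
formula for `F_mu` as a sum over permutations (`symF_eq_sum_perm`) exhibits the integrand as the
symmetrization of the nested one (`NestedSystem.symmetrization`), and the `k!` permutations
contribute equally. Contours exist because a circle around the origin separates the points `ξ⁻¹ s` from the
points `ξ⁻¹ s⁻¹`.
-/

/-! ### Row operators and the algebraic Bethe ansatz -/

noncomputable section

/-- The restriction of a vector to the states whose first column is occupied by `b` paths. -/
def slice (b : ℕ) : (List ℕ → ℂ) →ₗ[ℂ] (List ℕ → ℂ) := LinearMap.funLeft ℂ ℂ (List.cons b)

/-- One row of vertices with spectral parameter `u`, as a linear form on the vectors indexed by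
the states below the row. A state lists the occupation numbers of the columns `x`, `x + 1`, ...;
the list argument is the state above the row. No path leaves the row through its right end, and
the Boolean tells whether a path enters through its left end. -/
def rowForm (q : ℂ) (ξ s : ℕ → ℂ) (u : ℂ) : List ℕ → ℕ → Bool → ((List ℕ → ℂ) →ₗ[ℂ] ℂ)
  | [], _, false => LinearMap.proj []
  | [], _, true => 0
  | b :: bs, x, false =>
      ((1 - s x * q ^ b * (ξ x * u)) / (1 - s x * (ξ x * u))) •
        (rowForm q ξ s u bs (x + 1) false ∘ₗ slice b) +
      ((1 - s x ^ 2 * q ^ b) * (ξ x * u) / (1 - s x * (ξ x * u))) •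
        (rowForm q ξ s u bs (x + 1) true ∘ₗ slice (b + 1))
  | b :: bs, x, true =>
      ((1 - q ^ b) / (1 - s x * (ξ x * u))) •
        (rowForm q ξ s u bs (x + 1) false ∘ₗ slice (b - 1)) +
      ((ξ x * u - s x * q ^ b) / (1 - s x * (ξ x * u))) •
        (rowForm q ξ s u bs (x + 1) true ∘ₗ slice b)

/-- The row operator, on the columns from `x` on, with no path entering from the left. -/
def opA (q : ℂ) (ξ s : ℕ → ℂ) (x : ℕ) (u : ℂ) : Module.End ℂ (List ℕ → ℂ) :=
  LinearMap.pi fun l => rowForm q ξ s u l x false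

/-- The row operator, on the columns from `x` on, with one path entering from the left. -/
def opB (q : ℂ) (ξ s : ℕ → ℂ) (x : ℕ) (u : ℂ) : Module.End ℂ (List ℕ → ℂ) :=
  LinearMap.pi fun l => rowForm q ξ s u l x true

variable (q : ℂ) (ξ s : ℕ → ℂ)

@[simp] theorem slice_apply (b : ℕ) (ψ : List ℕ → ℂ) (l : List ℕ) : slice b ψ l = ψ (b :: l) := rfl

theorem opA_nil (x : ℕ) (u : ℂ) (ψ : List ℕ → ℂ) : opA q ξ s x u ψ [] = ψ [] := rfl

theorem opB_nil (x : ℕ) (u : ℂ) (ψ : List ℕ → ℂ) : opB q ξ s x u ψ [] = 0 := rfl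

theorem slice_opA (x : ℕ) (u : ℂ) (b : ℕ) (ψ : List ℕ → ℂ) :
    slice b (opA q ξ s x u ψ) =
      ((1 - s x * q ^ b * (ξ x * u)) * (1 - s x * (ξ x * u))⁻¹) •
        opA q ξ s (x + 1) u (slice b ψ) +
      ((1 - s x ^ 2 * q ^ b) * (ξ x * u) * (1 - s x * (ξ x * u))⁻¹) •
        opB q ξ s (x + 1) u (slice (b + 1) ψ) := rfl

theorem slice_opB (x : ℕ) (u : ℂ) (b : ℕ) (ψ : List ℕ → ℂ) :
    slice b (opB q ξ s x u ψ) =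
      ((1 - q ^ b) * (1 - s x * (ξ x * u))⁻¹) • opA q ξ s (x + 1) u (slice (b - 1) ψ) +
      ((ξ x * u - s x * q ^ b) * (1 - s x * (ξ x * u))⁻¹) •
        opB q ξ s (x + 1) u (slice b ψ) := rfl

/-- The exchange relations of the row operators, consequences of the Yang–Baxter equation. They
hold simultaneously, by induction on the number of columns. -/
theorem op_relations (u v : ℂ) (l : List ℕ) : ∀ (x : ℕ) (ψ : List ℕ → ℂ),
    opA q ξ s x v (opA q ξ s x u ψ) l = opA q ξ s x u (opA q ξ s x v ψ) l ∧
    opB q ξ s x v (opB q ξ s x u ψ) l = opB q ξ s x u (opB q ξ s x v ψ) l ∧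
    (u - v) * opA q ξ s x v (opB q ξ s x u ψ) l = (u - q * v) * opB q ξ s x u (opA q ξ s x v ψ) l -
      (1 - q) * v * opB q ξ s x v (opA q ξ s x u ψ) l ∧
    (v - u) * opA q ξ s x u (opB q ξ s x v ψ) l = (v - q * u) * opB q ξ s x v (opA q ξ s x u ψ) l -
      (1 - q) * u * opB q ξ s x u (opA q ξ s x v ψ) l := by
  rcases eq_or_ne u v with rfl | huv
  · intro x ψ
    exact ⟨rfl, rfl, by ring, by ring⟩
  have huv' : u - v ≠ 0 := sub_ne_zero.2 huv
  induction l with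
  | nil => intro x ψ; simp [opA_nil, opB_nil]
  | cons b bs ih =>
    intro x ψ
    have eA : ∀ (w : ℂ) (φ : List ℕ → ℂ), opA q ξ s x w φ (b :: bs) =
      ((1 - s x * q ^ b * (ξ x * w)) * (1 - s x * (ξ x * w))⁻¹) *
        opA q ξ s (x + 1) w (slice b φ) bs +
      ((1 - s x ^ 2 * q ^ b) * (ξ x * w) * (1 - s x * (ξ x * w))⁻¹) *
        opB q ξ s (x + 1) w (slice (b + 1) φ) bs := fun w φ => rfl
    have eB : ∀ (w : ℂ) (φ : List ℕ → ℂ), opB q ξ s x w φ (b :: bs) =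
      ((1 - q ^ b) * (1 - s x * (ξ x * w))⁻¹) * opA q ξ s (x + 1) w (slice (b - 1) φ) bs +
      ((ξ x * w - s x * q ^ b) * (1 - s x * (ξ x * w))⁻¹) *
        opB q ξ s (x + 1) w (slice b φ) bs := fun w φ => rfl
    simp only [eA, eB, slice_opA, slice_opB, map_add, map_smul, Pi.add_apply, Pi.smul_apply,
      smul_eq_mul]
    generalize (1 - s x * (ξ x * u))⁻¹ = Du
    generalize (1 - s x * (ξ x * v))⁻¹ = Dv
    obtain ⟨AA, BB, AB, AB'⟩ := ih (x + 1) (slice b ψ)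
    obtain ⟨-, BB1, AB1, AB1'⟩ := ih (x + 1) (slice (b + 1) ψ)
    obtain ⟨-, BB2, -, -⟩ := ih (x + 1) (slice (b + 2) ψ)
    obtain ⟨AA0, -, AB0, AB0'⟩ := ih (x + 1) (slice (b - 1) ψ)
    obtain ⟨AA00, -, -, -⟩ := ih (x + 1) (slice (b - 1 - 1) ψ)
    -- The shorter rows satisfy the relations; these express `A B` through `B A`, and rational
    -- identities for the vertex weights remain.
    have solve : ∀ {c c' p w : ℂ}, (u - v) * c = (u - q * v) * p - (1 - q) * v * w →
        (v - u) * c' = (v - q * u) * w - (1 - q) * u * p →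
        c = ((u - q * v) * p - (1 - q) * v * w) / (u - v) ∧
        c' = ((1 - q) * u * p - (v - q * u) * w) / (u - v) := by
      intro c c' p w h h'
      constructor
      · rw [eq_div_iff huv']; linear_combination h
      · rw [eq_div_iff huv']; linear_combination -h'
    obtain ⟨hc, hc'⟩ := solve AB AB'
    obtain ⟨hc1, hc1'⟩ := solve AB1 AB1'
    obtain ⟨hc0, hc0'⟩ := solve AB0 AB0'
    clear AB AB' AB1 AB1' AB0 AB0' ih solve eA eB
    -- For `b = 0` the truncated `b - 1` comes with the coefficient `1 - q ^ 0 = 0`.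
    rcases b with _ | n
    · simp only [pow_zero, pow_succ, sub_self, zero_mul, zero_add, one_mul, mul_one,
        show 1 + 1 = 2 from rfl] at *
      rw [AA, BB, BB1, BB2, hc, hc', hc1, hc1']
      refine ⟨?_, ?_, ?_, ?_⟩ <;> field_simp <;> ring
    · simp only [Nat.add_sub_cancel, show n + 1 + 1 = n + 2 from rfl,
        show n + 1 + 2 = n + 3 from rfl,
        show n + 2 - 1 = n + 1 from rfl] at *
      rw [AA, BB, BB1, BB2, AA0, AA00, hc, hc', hc1, hc1', hc0, hc0']
      simp only [pow_succ]
      refine ⟨?_, ?_, ?_, ?_⟩ <;> field_simp <;> ring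

theorem opB_commute (x : ℕ) (u v : ℂ) : Commute (opB q ξ s x u) (opB q ξ s x v) :=
  LinearMap.ext fun ψ => funext fun l => (op_relations q ξ s v u l x ψ).2.1

theorem opA_opB {u v : ℂ} (huv : u ≠ v) (x : ℕ) (ψ : List ℕ → ℂ) :
    opA q ξ s x v (opB q ξ s x u ψ) =
      ((u - q * v) / (u - v)) • opB q ξ s x u (opA q ξ s x v ψ) +
      ((1 - q) * v / (v - u)) • opB q ξ s x v (opA q ξ s x u ψ) := by
  funext l
  have h := (op_relations q ξ s u v l x ψ).2.2.1
  have h1 : u - v ≠ 0 := sub_ne_zero.2 huv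
  have h2 : v - u ≠ 0 := sub_ne_zero.2 huv.symm
  simp only [Pi.add_apply, Pi.smul_apply, smul_eq_mul]
  apply mul_left_cancel₀ h1
  rw [h]
  field_simp
  ring

/-- The vacuum: the state without paths. -/
def vacuum : List ℕ → ℂ := fun l => if ∀ n ∈ l, n = 0 then 1 else 0

theorem slice_vacuum (b : ℕ) : slice b vacuum = if b = 0 then vacuum else 0 := by
  funext l
  by_cases hb : b = 0 <;> simp [vacuum, hb]

/-- `Regular ξ s u`: no vertex weight with spectral parameter `u` has a vanishing denominator. -/
def Regular (ξ s : ℕ → ℂ) (u : ℂ) : Prop := ∀ x, 1 - s x * (ξ x * u) ≠ 0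

variable {q ξ s}

theorem opA_vacuum {u : ℂ} (hu : Regular ξ s u) (x : ℕ) : opA q ξ s x u vacuum = vacuum := by
  funext l
  induction l generalizing x with
  | nil => rfl
  | cons b bs ih =>
    have := congrFun (slice_opA q ξ s x u b vacuum) bs
    rw [slice_apply] at this
    rw [this, slice_vacuum, slice_vacuum]
    rcases eq_or_ne b 0 with rfl | hb
    · simp only [pow_zero, mul_one, mul_inv_cancel₀ (hu x), if_true, Nat.add_eq_zero_iff,
        one_ne_zero, and_false, if_false, map_zero, smul_zero, one_smul, add_zero]
      rw [ih]
      simp [vacuum]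
    · simp [hb, vacuum]

variable {ι : Type*} [DecidableEq ι]

/-- The factor `h(a, b) = (b - q a) / (b - a)` of the symmetrization formulas. -/
def pairFactor (q a b : ℂ) : ℂ := (b - q * a) / (b - a)

theorem opB_pairwise {κ : Type*} (u : κ → ℂ) (x : ℕ) (S : Finset κ) :
    (S : Set κ).Pairwise (Function.onFun Commute fun i => opB q ξ s x (u i)) :=
  fun _ _ _ _ _ => opB_commute q ξ s x _ _

variable (q ξ s) in
/-- The Bethe vector: one row with a path entering from the left for each index in `S`, applied
to the vacuum. The order of the rows does not matter. -/
def betheVector (u : ι → ℂ) (x : ℕ) (S : Finset ι) : List ℕ → ℂ :=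
  S.noncommProd (fun i => opB q ξ s x (u i)) (opB_pairwise u x S) vacuum

theorem betheVector_empty {ι : Type*} (u : ι → ℂ) (x : ℕ) : betheVector q ξ s u x ∅ = vacuum := by
  simp [betheVector]

theorem betheVector_insert (u : ι → ℂ) (x : ℕ) {S : Finset ι} {i : ι} (hi : i ∉ S) :
    betheVector q ξ s u x (insert i S) = opB q ξ s x (u i) (betheVector q ξ s u x S) := by
  rw [betheVector, Finset.noncommProd_insert_of_notMem _ _ _ _ hi]
  rfl

/-- The action of the row operator without incoming path on a Bethe vector: the familiar sum of
one wanted and several unwanted terms of the algebraic Bethe ansatz. -/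
theorem opA_betheVector {u : ι → ℂ} (hu : Function.Injective u) (hreg : ∀ i, Regular ξ s (u i))
    (x : ℕ) (S : Finset ι) : ∀ v ∉ S, opA q ξ s x (u v) (betheVector q ξ s u x S) =
      (∏ w ∈ S, pairFactor q (u v) (u w)) • betheVector q ξ s u x S +
      ∑ w ∈ S, ((1 - q) * u v / (u v - u w) *
        ∏ w' ∈ S.erase w, pairFactor q (u w) (u w')) •
          betheVector q ξ s u x (insert v (S.erase w)) := by
  induction S using Finset.induction_on with
  | empty => intro v _; simp [betheVector_empty, opA_vacuum (hreg v)]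
  | insert i S hi ih =>
    intro v hv
    rw [Finset.mem_insert, not_or] at hv
    obtain ⟨hvi, hvS⟩ := hv
    have huv : u i ≠ u v := fun h => hvi (hu h).symm
    rw [betheVector_insert u x hi, opA_opB q ξ s huv, ih v hvS, ih i hi]
    simp only [map_add, map_smul, map_sum]
    rw [← betheVector_insert u x hi, ← betheVector_insert u x hvS]
    rw [Finset.prod_insert hi, Finset.sum_insert hi, Finset.erase_insert hi]
    have key : ∀ w ∈ S, ((1 - q) * u v / (u v - u w) *
        ∏ w' ∈ (insert i S).erase w, pairFactor q (u w) (u w')) •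
          betheVector q ξ s u x (insert v ((insert i S).erase w)) =
        ((u i - q * u v) / (u i - u v)) • (((1 - q) * u v / (u v - u w) *
          ∏ w' ∈ S.erase w, pairFactor q (u w) (u w')) •
            opB q ξ s x (u i) (betheVector q ξ s u x (insert v (S.erase w)))) +
        ((1 - q) * u v / (u v - u i)) • (((1 - q) * u i / (u i - u w) *
          ∏ w' ∈ S.erase w, pairFactor q (u w) (u w')) •
            opB q ξ s x (u v) (betheVector q ξ s u x (insert i (S.erase w)))) := by
      intro w hw
      have hiw : i ≠ w := fun h => hi (h ▸ hw)
      have hvw : v ≠ w := fun h => hvS (h ▸ hw)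
      have h1 : i ∉ insert v (S.erase w) := by
        simp [hi, Ne.symm hvi]
      have h2 : v ∉ insert i (S.erase w) := by
        simp [hvS, hvi]
      rw [← betheVector_insert u x h1, ← betheVector_insert u x h2,
        Finset.erase_insert_of_ne hiw, Finset.insert_comm i v,
        Finset.prod_insert (by simp [hi]), smul_smul, smul_smul, ← add_smul]
      congr 1
      have e1 : u i - u v ≠ 0 := sub_ne_zero.2 huv
      have e1' : u v - u i ≠ 0 := sub_ne_zero.2 huv.symm
      have e2 : u v - u w ≠ 0 := sub_ne_zero.2 fun h => hvw (hu h)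
      have e3 : u i - u w ≠ 0 := sub_ne_zero.2 fun h => hiw (hu h)
      rw [pairFactor]
      field_simp
      ring
    rw [Finset.sum_congr rfl key, Finset.sum_add_distrib, Finset.smul_sum.symm,
      Finset.smul_sum.symm]
    simp only [pairFactor]
    module

end

/-! ### The column recursion of the Bethe vectors -/

noncomputable section

variable {q : ℂ} {ξ s : ℕ → ℂ} {ι : Type*} [DecidableEq ι]

/-- The partial fraction expansion of `∏ i ∈ K, pairFactor q (u i) v` in `v`. -/
theorem prod_pairFactor_expansion {u : ι → ℂ} (hu : Function.Injective u) (K : Finset ι) :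
    ∀ v : ℂ, (∀ i ∈ K, v ≠ u i) → ∏ i ∈ K, pairFactor q (u i) v =
      1 + ∑ j ∈ K, (1 - q) * u j / (v - u j) * ∏ i ∈ K.erase j, pairFactor q (u i) (u j) := by
  induction K using Finset.induction_on with
  | empty => simp
  | insert a K ha ih =>
    intro v hv
    have hva : v - u a ≠ 0 := sub_ne_zero.2 (hv a (Finset.mem_insert_self _ _))
    have ha' : ∀ i ∈ K, u a ≠ u i := fun i hi h => ha (hu h ▸ hi)
    have key : ∀ j ∈ K, (1 - q) * u j / (v - u j) *
        ∏ i ∈ (insert a K).erase j, pairFactor q (u i) (u j) =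
        pairFactor q (u a) v *
          ((1 - q) * u j / (v - u j) * ∏ i ∈ K.erase j, pairFactor q (u i) (u j)) -
        (1 - q) * u a / (v - u a) *
          ((1 - q) * u j / (u a - u j) * ∏ i ∈ K.erase j, pairFactor q (u i) (u j)) := by
      intro j hj
      have haj : a ≠ j := fun h => ha (h ▸ hj)
      rw [Finset.erase_insert_of_ne haj, Finset.prod_insert (by simp [ha])]
      have e1 : v - u j ≠ 0 := sub_ne_zero.2 (hv j (Finset.mem_insert_of_mem hj))
      have e2 : u a - u j ≠ 0 := sub_ne_zero.2 (ha' j hj)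
      have e3 : u j - u a ≠ 0 := sub_ne_zero.2 (ha' j hj).symm
      simp only [pairFactor]
      field_simp
      ring
    rw [Finset.prod_insert ha, Finset.sum_insert ha, Finset.erase_insert ha,
      Finset.sum_congr rfl key, Finset.sum_sub_distrib, ← Finset.mul_sum, ← Finset.mul_sum,
      ih v fun i hi => hv i (Finset.mem_insert_of_mem hi), ih (u a) ha']
    simp only [pairFactor]
    field_simp
    ring

/-- The value at `v = 0` of the expansion of `∏ i ∈ K, pairFactor q (u i) v`. It also
gives the normalization of the Hall–Littlewood type symmetrization. -/
theorem sum_prod_pairFactor {u : ι → ℂ} (hu : Function.Injective u) (K : Finset ι) :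
    (1 - q) * ∑ j ∈ K, ∏ i ∈ K.erase j, pairFactor q (u i) (u j) = 1 - q ^ K.card := by
  induction K using Finset.induction_on with
  | empty => simp
  | insert a K ha ih =>
    have ha' : ∀ i ∈ K, u a ≠ u i := fun i hi h => ha (hu h ▸ hi)
    have key : ∀ j ∈ K, ∏ i ∈ (insert a K).erase j, pairFactor q (u i) (u j) =
        q * ∏ i ∈ K.erase j, pairFactor q (u i) (u j) -
          (1 - q) * u j / (u a - u j) * ∏ i ∈ K.erase j, pairFactor q (u i) (u j) := by
      intro j hj
      have haj : a ≠ j := fun h => ha (h ▸ hj)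
      rw [Finset.erase_insert_of_ne haj, Finset.prod_insert (by simp [ha])]
      have e2 : u a - u j ≠ 0 := sub_ne_zero.2 (ha' j hj)
      have e3 : u j - u a ≠ 0 := sub_ne_zero.2 (ha' j hj).symm
      simp only [pairFactor]
      field_simp
      ring
    rw [Finset.sum_insert ha, Finset.erase_insert ha, Finset.sum_congr rfl key,
      Finset.sum_sub_distrib, ← Finset.mul_sum, prod_pairFactor_expansion hu K (u a) ha',
      Finset.card_insert_of_notMem ha]
    linear_combination q * ih

/-- The Lagrange interpolation identity behind the column recursion of the Bethe vectors. -/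
theorem prod_pairFactor_linear {u : ι → ℂ} (hu : Function.Injective u) (K : Finset ι) (v : ℂ)
    (hv : ∀ i ∈ K, v ≠ u i) (a b : ℂ) :
    (a * v - b) * ∏ i ∈ K, pairFactor q (u i) v = (a * v - b * q ^ K.card) +
      ∑ j ∈ K, (a * u j - b) * ((1 - q) * v / (v - u j) *
        ∏ i ∈ K.erase j, pairFactor q (u i) (u j)) := by
  have h1 := prod_pairFactor_expansion (q := q) hu K v hv
  have h2 := sum_prod_pairFactor (q := q) hu K
  have key : ∀ j ∈ K, (a * u j - b) * ((1 - q) * v / (v - u j) *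
        ∏ i ∈ K.erase j, pairFactor q (u i) (u j)) =
      (a * v - b) * ((1 - q) * u j / (v - u j) * ∏ i ∈ K.erase j, pairFactor q (u i) (u j)) -
        b * (1 - q) * ∏ i ∈ K.erase j, pairFactor q (u i) (u j) := by
    intro j hj
    have e1 : v - u j ≠ 0 := sub_ne_zero.2 (hv j hj)
    field_simp
    ring
  rw [Finset.sum_congr rfl key, Finset.sum_sub_distrib, ← Finset.mul_sum, ← Finset.mul_sum]
  linear_combination (a * v - b) * h1 + b * h2

theorem qPoch_succ (z q : ℂ) (n : ℕ) : qPoch z q (n + 1) = qPoch z q n * (1 - z * q ^ n) :=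
  Finset.prod_range_succ _ _

variable (ξ s) in
/-- The factor `t_x(u) = (ξ_x u - s_x) / (1 - s_x ξ_x u)`. -/
def colFactor (x : ℕ) (u : ℂ) : ℂ := (ξ x * u - s x) / (1 - s x * (ξ x * u))

variable (q ξ s) in
/-- The coefficient of the term in which the rows in `K` send their paths up the column `x`, while
the paths of the other rows in `S` move on to the right. -/
def clusterCoeff (u : ι → ℂ) (x : ℕ) (S K : Finset ι) : ℂ :=
  qPoch q q K.card * (∏ i ∈ K, (1 - s x * (ξ x * u i))⁻¹) * (∏ j ∈ S \ K, colFactor ξ s x (u j)) *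
    ∏ i ∈ K, ∏ j ∈ S \ K, pairFactor q (u i) (u j)

theorem clusterCoeff_insert_insert (u : ι → ℂ) (x : ℕ) {S K : Finset ι} {v : ι} (hv : v ∉ S)
    (hK : K ⊆ S) :
    clusterCoeff q ξ s u x (insert v S) (insert v K) =
      (1 - q ^ (K.card + 1)) * (1 - s x * (ξ x * u v))⁻¹ *
        (∏ w ∈ S \ K, pairFactor q (u v) (u w)) * clusterCoeff q ξ s u x S K := by
  have hvK : v ∉ K := fun h => hv (hK h)
  have h1 : insert v S \ insert v K = S \ K := by
    rw [Finset.insert_sdiff_insert, Finset.sdiff_insert_of_notMem hv]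
  rw [clusterCoeff, clusterCoeff, h1, Finset.card_insert_of_notMem hvK, qPoch_succ,
    Finset.prod_insert hvK, Finset.prod_insert hvK]
  ring

theorem clusterCoeff_insert {u : ι → ℂ} (hu : Function.Injective u) (x : ℕ) {S K : Finset ι}
    {v : ι} (hv : v ∉ S) (hK : K ⊆ S) :
    clusterCoeff q ξ s u x (insert v S) K =
      (ξ x * u v - s x * q ^ K.card) * (1 - s x * (ξ x * u v))⁻¹ * clusterCoeff q ξ s u x S K +
      ∑ w ∈ K, (1 - q ^ K.card) * (1 - s x * (ξ x * u v))⁻¹ *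
        (clusterCoeff q ξ s u x S (K.erase w) * ((1 - q) * u v / (u v - u w) *
          ∏ w' ∈ S \ K, pairFactor q (u w) (u w'))) := by
  have hvK : v ∉ K := fun h => hv (hK h)
  have key : ∀ w ∈ K, (1 - q ^ K.card) * (1 - s x * (ξ x * u v))⁻¹ *
        (clusterCoeff q ξ s u x S (K.erase w) * ((1 - q) * u v / (u v - u w) *
          ∏ w' ∈ S \ K, pairFactor q (u w) (u w'))) =
      (1 - s x * (ξ x * u v))⁻¹ * clusterCoeff q ξ s u x S K *
        ((ξ x * u w - s x) * ((1 - q) * u v / (u v - u w) *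
          ∏ i ∈ K.erase w, pairFactor q (u i) (u w))) := by
    intro w hw
    have hwS : w ∉ S \ K := by simp [hw]
    have h1 : S \ K.erase w = insert w (S \ K) := Finset.sdiff_erase (hK hw)
    obtain ⟨n, hn⟩ : ∃ n, K.card = n + 1 :=
      ⟨_, (Nat.succ_pred_eq_of_pos (Finset.card_pos.2 ⟨w, hw⟩)).symm⟩
    have hn' : (K.erase w).card = n := by rw [Finset.card_erase_of_mem hw, hn]; rfl
    rw [clusterCoeff, clusterCoeff, h1, hn, hn', qPoch_succ]
    simp only [Finset.prod_insert hwS, Finset.prod_mul_distrib]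
    rw [← Finset.mul_prod_erase K _ hw, ← Finset.mul_prod_erase K _ hw, colFactor]
    ring
  have h2 : insert v S \ K = insert v (S \ K) := Finset.insert_sdiff_of_notMem _ hvK
  have hvSK : v ∉ S \ K := by simp [hv]
  have hL := prod_pairFactor_linear (q := q) hu K (u v)
    (fun i hi h => hvK (hu h ▸ hi)) (ξ x) (s x)
  rw [Finset.sum_congr rfl key, ← Finset.mul_sum, eq_sub_of_add_eq' hL.symm]
  rw [clusterCoeff, clusterCoeff, h2]
  simp only [Finset.prod_insert hvSK, Finset.prod_mul_distrib]
  rw [colFactor]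
  ring

/-- Summing over pairs of a set and an element outside it, or over pairs of a larger set and one
of its elements, is the same. -/
theorem sum_powersetCard_sdiff {M : Type*} [AddCommMonoid M] (S : Finset ι) (n : ℕ)
    (f : Finset ι → ι → M) :
    ∑ K ∈ S.powersetCard n, ∑ w ∈ S \ K, f K w =
      ∑ K ∈ S.powersetCard (n + 1), ∑ w ∈ K, f (K.erase w) w := by
  rw [Finset.sum_sigma', Finset.sum_sigma']
  refine Finset.sum_bij' (fun p _ => ⟨insert p.2 p.1, p.2⟩) (fun p _ => ⟨p.1.erase p.2, p.2⟩)
    ?_ ?_ ?_ ?_ ?_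
  · rintro ⟨K, w⟩ h
    simp only [Finset.mem_sigma, Finset.mem_powersetCard, Finset.mem_sdiff] at h ⊢
    exact ⟨⟨Finset.insert_subset h.2.1 h.1.1, by rw [Finset.card_insert_of_notMem h.2.2, h.1.2]⟩,
      Finset.mem_insert_self _ _⟩
  · rintro ⟨K, w⟩ h
    simp only [Finset.mem_sigma, Finset.mem_powersetCard, Finset.mem_sdiff] at h ⊢
    exact ⟨⟨(Finset.erase_subset _ _).trans h.1.1, by
      rw [Finset.card_erase_of_mem h.2, h.1.2]; rfl⟩, h.1.1 h.2, by simp⟩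
  · rintro ⟨K, w⟩ h
    simp only [Finset.mem_sigma, Finset.mem_powersetCard, Finset.mem_sdiff] at h
    simp [Finset.erase_insert h.2.2]
  · rintro ⟨K, w⟩ h
    simp only [Finset.mem_sigma] at h
    simp [Finset.insert_erase h.2]
  · rintro ⟨K, w⟩ h
    simp only [Finset.mem_sigma, Finset.mem_powersetCard, Finset.mem_sdiff] at h
    simp [Finset.erase_insert h.2.2]

/-- The column recursion of the Bethe vectors. -/
theorem slice_betheVector {u : ι → ℂ} (hu : Function.Injective u) (hreg : ∀ i, Regular ξ s (u i))
    (x : ℕ) (S : Finset ι) : ∀ n, slice n (betheVector q ξ s u x S) =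
      ∑ K ∈ S.powersetCard n, clusterCoeff q ξ s u x S K •
        betheVector q ξ s u (x + 1) (S \ K) := by
  induction S using Finset.induction_on with
  | empty =>
    intro n
    rw [betheVector_empty, slice_vacuum]
    rcases n with _ | n
    · simp [clusterCoeff, qPoch, betheVector_empty]
    · rw [Finset.powersetCard_eq_empty.2 (by simp)]; simp
  | insert v S hv ih =>
    intro n
    rw [betheVector_insert u x hv, slice_opB]
    rcases n with _ | n
    · rw [ih 0]
      have hv' : v ∉ S := hv
      simp only [pow_zero, sub_self, zero_mul, zero_smul, zero_add, Finset.powersetCard_zero,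
        Finset.sum_singleton, Finset.sdiff_empty, map_smul, mul_one]
      rw [betheVector_insert u _ hv, smul_smul]
      congr 1
      simp [clusterCoeff, qPoch, Finset.prod_insert hv, colFactor, div_eq_mul_inv]
    · rw [Nat.add_sub_cancel, ih n, ih (n + 1), Finset.powersetCard_succ_insert hv,
        Finset.sum_union, Finset.sum_image]
      · have e1 : ∀ K ∈ S.powersetCard n, opA q ξ s (x + 1) (u v)
            (betheVector q ξ s u (x + 1) (S \ K)) =
            (∏ w ∈ S \ K, pairFactor q (u v) (u w)) • betheVector q ξ s u (x + 1) (S \ K) +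
            ∑ w ∈ S \ K, ((1 - q) * u v / (u v - u w) *
              ∏ w' ∈ (S \ K).erase w, pairFactor q (u w) (u w')) •
                betheVector q ξ s u (x + 1) (insert v ((S \ K).erase w)) := fun K _ =>
          opA_betheVector hu hreg (x + 1) (S \ K) v (by simp [hv])
        -- The sets containing `v` come from the wanted terms.
        have e2 : ∀ K ∈ S.powersetCard n,
            clusterCoeff q ξ s u x (insert v S) (insert v K) •
              betheVector q ξ s u (x + 1) (insert v S \ insert v K) =
            ((1 - q ^ (n + 1)) * (1 - s x * (ξ x * u v))⁻¹) • clusterCoeff q ξ s u x S K •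
              (∏ w ∈ S \ K, pairFactor q (u v) (u w)) •
                betheVector q ξ s u (x + 1) (S \ K) := by
          intro K hK
          rw [Finset.mem_powersetCard] at hK
          rw [clusterCoeff_insert_insert u x hv hK.1, Finset.insert_sdiff_insert,
            Finset.sdiff_insert_of_notMem hv, hK.2, smul_smul, smul_smul]
          congr 1
          ring
        -- The sets avoiding `v` collect the terms in which the path of the row `v` moves on, and
        -- the unwanted terms.
        have e3 : ∀ K ∈ S.powersetCard (n + 1),
            clusterCoeff q ξ s u x (insert v S) K •
              betheVector q ξ s u (x + 1) (insert v S \ K) =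
            ((ξ x * u v - s x * q ^ (n + 1)) * (1 - s x * (ξ x * u v))⁻¹) •
              clusterCoeff q ξ s u x S K •
                opB q ξ s (x + 1) (u v) (betheVector q ξ s u (x + 1) (S \ K)) +
            ∑ w ∈ K, ((1 - q ^ (n + 1)) * (1 - s x * (ξ x * u v))⁻¹) •
              clusterCoeff q ξ s u x S (K.erase w) • ((1 - q) * u v / (u v - u w) *
                ∏ w' ∈ (S \ K.erase w).erase w, pairFactor q (u w) (u w')) •
                  betheVector q ξ s u (x + 1) (insert v ((S \ K.erase w).erase w)) := by
          intro K hK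
          rw [Finset.mem_powersetCard] at hK
          have hvK : v ∉ K := fun h => hv (hK.1 h)
          have e4 : ∀ w ∈ K, (S \ K.erase w).erase w = S \ K := fun w hw => by
            rw [Finset.sdiff_erase (hK.1 hw), Finset.erase_insert (by simp [hw])]
          rw [Finset.sum_congr rfl fun w hw => by rw [e4 w hw], clusterCoeff_insert hu x hv hK.1,
            Finset.insert_sdiff_of_notMem _ hvK, betheVector_insert u _ (by simp [hv]), hK.2,
            add_smul, smul_smul, Finset.sum_smul]
          congr 1
          refine Finset.sum_congr rfl fun w hw => ?_
          rw [smul_smul, smul_smul]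
          congr 1
          ring
        rw [Finset.sum_congr rfl e2, Finset.sum_congr rfl e3, Finset.sum_add_distrib,
          ← sum_powersetCard_sdiff S n (fun K w =>
            ((1 - q ^ (n + 1)) * (1 - s x * (ξ x * u v))⁻¹) •
              clusterCoeff q ξ s u x S K • ((1 - q) * u v / (u v - u w) *
                ∏ w' ∈ (S \ K).erase w, pairFactor q (u w) (u w')) •
                  betheVector q ξ s u (x + 1) (insert v ((S \ K).erase w)))]
        simp only [map_sum, map_smul]
        rw [Finset.sum_congr rfl fun K hK => by rw [e1 K hK]]
        simp only [smul_add, Finset.sum_add_distrib, Finset.smul_sum]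
        abel
      · intro K hK K' hK' h
        rw [Finset.mem_coe, Finset.mem_powersetCard] at hK hK'
        have h1 : v ∉ K := fun h => hv (hK.1 h)
        have h2 : v ∉ K' := fun h => hv (hK'.1 h)
        rw [← Finset.erase_insert h1, ← Finset.erase_insert h2]
        exact congrArg (fun T => T.erase v) h
      · rw [Finset.disjoint_left]
        intro K hK hK'
        rw [Finset.mem_powersetCard] at hK
        obtain ⟨K', -, rfl⟩ := Finset.mem_image.1 hK'
        exact hv (hK.1 (Finset.mem_insert_self _ _))

end

/-! ### Components of Bethe vectors as sums over words -/

noncomputable section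

variable {q : ℂ} {ξ s : ℕ → ℂ} {ι : Type*} [DecidableEq ι]

/-- The occupation numbers `n x, ..., n (x + N - 1)` of `N` consecutive columns. -/
def occupation (n : ℕ → ℕ) (x N : ℕ) : List ℕ := (List.range' x N).map n

theorem occupation_succ (n : ℕ → ℕ) (x N : ℕ) :
    occupation n x (N + 1) = n x :: occupation n (x + 1) N := by
  simp [occupation, List.range'_succ]

/-- The words with content `n` on the index set `S`: the maps assigning to each index in `S` one
of the columns `x, ..., x + N - 1`, in such a way that each column `y` is used `n y` times. Outside
`S` they take the value `0`. -/
def wordSet [Fintype ι] (n : ℕ → ℕ) (S : Finset ι) (x N : ℕ) : Finset (ι → ℕ) :=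
  (Fintype.piFinset fun _ => Finset.range (x + N + 1)).filter fun c =>
    (∀ i ∉ S, c i = 0) ∧ (∀ i ∈ S, x ≤ c i ∧ c i < x + N) ∧
      ∀ y, x ≤ y → y < x + N → (S.filter fun i => c i = y).card = n y

theorem mem_wordSet [Fintype ι] {n : ℕ → ℕ} {S : Finset ι} {x N : ℕ} {c : ι → ℕ} :
    c ∈ wordSet n S x N ↔ (∀ i ∉ S, c i = 0) ∧ (∀ i ∈ S, x ≤ c i ∧ c i < x + N) ∧
      ∀ y, x ≤ y → y < x + N → (S.filter fun i => c i = y).card = n y := by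
  rw [wordSet, Finset.mem_filter, and_iff_right_iff_imp]
  intro h
  rw [Fintype.mem_piFinset]
  intro i
  rw [Finset.mem_range]
  by_cases hi : i ∈ S
  · have := (h.2.1 i hi).2; omega
  · rw [h.1 i hi]; omega

variable (ξ s) in
/-- The one-variable factor of a path that moves from the column `x` to the column `m` and leaves
upwards there. For `x = 0` it is `φ_m / (1 - q)`. -/
def pathFactor (x m : ℕ) (u : ℂ) : ℂ :=
  (1 - s m * (ξ m * u))⁻¹ * ∏ j ∈ Finset.Ico x m, colFactor ξ s j u

variable (q ξ s) in
/-- The contribution of a word to the Bethe vector. -/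
def wordWeight (u : ι → ℂ) (x : ℕ) (S : Finset ι) (c : ι → ℕ) : ℂ :=
  (∏ i ∈ S, pathFactor ξ s x (c i) (u i)) *
    ∏ i ∈ S, ∏ j ∈ S.filter (fun j => c i < c j), pairFactor q (u i) (u j)

theorem betheVector_nil (u : ι → ℂ) (x : ℕ) (S : Finset ι) :
    betheVector q ξ s u x S [] = if S = ∅ then 1 else 0 := by
  rcases S.eq_empty_or_nonempty with rfl | ⟨i, hi⟩
  · rw [betheVector_empty]; simp [vacuum]
  · rw [← Finset.insert_erase hi, betheVector_insert u x (by simp), opB_nil]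
    simp

/-- Splitting off the letter `x` from a word. -/
theorem wordWeight_split (u : ι → ℂ) (x : ℕ) {S K : Finset ι} (hK : K ⊆ S) {c : ι → ℕ}
    (hc : ∀ i ∈ S \ K, x < c i) :
    qPoch q q K.card * wordWeight q ξ s u x S (fun i => if i ∈ K then x else c i) =
      clusterCoeff q ξ s u x S K * wordWeight q ξ s u (x + 1) (S \ K) c := by
  have h1 : ∏ i ∈ S, pathFactor ξ s x (if i ∈ K then x else c i) (u i) =
      (∏ i ∈ K, (1 - s x * (ξ x * u i))⁻¹) * ((∏ i ∈ S \ K, colFactor ξ s x (u i)) *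
        ∏ i ∈ S \ K, pathFactor ξ s (x + 1) (c i) (u i)) := by
    rw [← Finset.prod_sdiff hK, mul_comm, ← Finset.prod_mul_distrib]
    congr 1
    · refine Finset.prod_congr rfl fun i hi => ?_
      rw [if_pos hi, pathFactor]; simp
    · refine Finset.prod_congr rfl fun i hi => ?_
      rw [if_neg (Finset.mem_sdiff.1 hi).2, pathFactor, pathFactor,
        Finset.prod_eq_prod_Ico_succ_bot (hc i hi)]
      ring
  have h2 : ∏ i ∈ S, ∏ j ∈ S.filter (fun j => (if i ∈ K then x else c i) <
        (if j ∈ K then x else c j)), pairFactor q (u i) (u j) =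
      (∏ i ∈ K, ∏ j ∈ S \ K, pairFactor q (u i) (u j)) *
        ∏ i ∈ S \ K, ∏ j ∈ (S \ K).filter (fun j => c i < c j), pairFactor q (u i) (u j) := by
    rw [← Finset.prod_sdiff hK, mul_comm]
    congr 1
    · refine Finset.prod_congr rfl fun i hi => Finset.prod_congr ?_ fun _ _ => rfl
      ext j
      rw [Finset.mem_filter, if_pos hi, Finset.mem_sdiff]
      constructor
      · rintro ⟨hj, h⟩
        refine ⟨hj, fun hjK => ?_⟩
        simp [hjK] at h
      · rintro ⟨hj, hjK⟩
        rw [if_neg hjK]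
        exact ⟨hj, hc j (Finset.mem_sdiff.2 ⟨hj, hjK⟩)⟩
    · refine Finset.prod_congr rfl fun i hi => Finset.prod_congr ?_ fun _ _ => rfl
      ext j
      have hi' := hc i hi
      rw [Finset.mem_filter, if_neg (Finset.mem_sdiff.1 hi).2, Finset.mem_filter,
        Finset.mem_sdiff]
      by_cases hjK : j ∈ K
      · simp [hjK]; omega
      · simp [hjK]
  rw [wordWeight, wordWeight, clusterCoeff, h1, h2]
  ring

/-- The symmetrization formula for the components of a Bethe vector, as a sum over words. -/
theorem betheVector_occupation [Fintype ι] {u : ι → ℂ} (hu : Function.Injective u)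
    (hreg : ∀ i, Regular ξ s (u i)) (n : ℕ → ℕ) (N : ℕ) : ∀ (x : ℕ) (S : Finset ι),
    betheVector q ξ s u x S (occupation n x N) =
      (∏ y ∈ Finset.Ico x (x + N), qPoch q q (n y)) *
        ∑ c ∈ wordSet n S x N, wordWeight q ξ s u x S c := by
  induction N with
  | zero =>
    intro x S
    have h0 : occupation n x 0 = [] := rfl
    rw [h0, betheVector_nil]
    rcases S.eq_empty_or_nonempty with rfl | ⟨i, hi⟩
    · have : wordSet n (∅ : Finset ι) x 0 = {0} := by
        ext c
        rw [mem_wordSet, Finset.mem_singleton]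
        constructor
        · intro h; funext i; exact h.1 i (by simp)
        · rintro rfl
          exact ⟨fun _ _ => rfl, by simp, fun y h1 h2 => by omega⟩
      simp [this, wordWeight]
    · have : wordSet n S x 0 = ∅ := by
        rw [Finset.eq_empty_iff_forall_notMem]
        intro c hc
        have := (mem_wordSet.1 hc).2.1 i hi
        omega
      rw [this, Finset.sum_empty, mul_zero, if_neg (Finset.ne_empty_of_mem hi)]
  | succ N ih =>
    intro x S
    rw [occupation_succ, ← slice_apply (n x) (betheVector q ξ s u x S), slice_betheVector hu hreg,
      Finset.sum_apply]
    simp only [Pi.smul_apply, smul_eq_mul, ih]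
    have hx : x + 1 + N = x + (N + 1) := by omega
    rw [Finset.prod_eq_prod_Ico_succ_bot (by omega : x < x + (N + 1)), hx]
    simp only [Finset.mul_sum]
    rw [Finset.sum_sigma']
    refine Finset.sum_bij' (fun p _ i => if i ∈ p.1 then x else p.2 i)
      (fun c _ => ⟨S.filter fun i => c i = x, fun i => if c i = x then 0 else c i⟩) ?_ ?_ ?_ ?_ ?_
    · rintro ⟨K, c⟩ h
      rw [Finset.mem_sigma, Finset.mem_powersetCard, mem_wordSet] at h
      obtain ⟨⟨hKS, hK⟩, h1, h2, h3⟩ := h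
      dsimp only at h1 h2 h3 hK hKS
      rw [mem_wordSet]
      refine ⟨fun i hi => ?_, fun i hi => ?_, fun y hy hy' => ?_⟩
      · dsimp only
        rw [if_neg fun h => hi (hKS h)]
        exact h1 i fun h => hi (Finset.mem_sdiff.1 h).1
      · by_cases hiK : i ∈ K
        · simp [hiK]
        · have := h2 i (Finset.mem_sdiff.2 ⟨hi, hiK⟩)
          simp only [hiK, if_false]; omega
      · rcases hy.eq_or_lt with rfl | hy
        · rw [← hK]
          congr 1
          ext i
          rw [Finset.mem_filter]
          constructor
          · rintro ⟨hi, h⟩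
            by_contra hiK
            have := h2 i (Finset.mem_sdiff.2 ⟨hi, hiK⟩)
            simp only [hiK, if_false] at h; omega
          · intro hi; exact ⟨hKS hi, by simp [hi]⟩
        · rw [← h3 y hy (by omega)]
          congr 1
          ext i
          simp only [Finset.mem_filter, Finset.mem_sdiff]
          by_cases hiK : i ∈ K
          · simp [hiK]; omega
          · simp [hiK]
    · intro c h
      rw [mem_wordSet] at h
      obtain ⟨h1, h2, h3⟩ := h
      have hm : ∀ i, i ∈ S \ S.filter (fun i => c i = x) ↔ i ∈ S ∧ c i ≠ x := by
        intro i; simp only [Finset.mem_sdiff, Finset.mem_filter]; tauto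
      rw [Finset.mem_sigma, Finset.mem_powersetCard, mem_wordSet]
      refine ⟨⟨Finset.filter_subset _ _, h3 x le_rfl (by omega)⟩, fun i hi => ?_,
        fun i hi => ?_, fun y hy hy' => ?_⟩
      · rw [hm, not_and_not_right] at hi
        dsimp only
        split_ifs with h
        · rfl
        · exact h1 i fun hS => h (hi hS)
      · rw [hm] at hi
        have := h2 i hi.1
        dsimp only
        rw [if_neg hi.2]
        have := hi.2
        omega
      · rw [← h3 y (by omega) (by omega)]
        congr 1
        ext i
        rw [Finset.mem_filter, Finset.mem_filter, hm]
        dsimp only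
        split_ifs with h
        · constructor
          · intro h'; exact absurd h h'.1.2
          · intro h'; omega
        · tauto
    · rintro ⟨K, c⟩ h
      rw [Finset.mem_sigma, Finset.mem_powersetCard, mem_wordSet] at h
      obtain ⟨⟨hKS, hK⟩, h1, h2, h3⟩ := h
      dsimp only at h1 h2 h3 hKS ⊢
      have hK' : S.filter (fun i => (if i ∈ K then x else c i) = x) = K := by
        ext i
        rw [Finset.mem_filter]
        constructor
        · rintro ⟨hi, h⟩
          by_contra hiK
          have := h2 i (Finset.mem_sdiff.2 ⟨hi, hiK⟩)
          simp only [hiK, if_false] at h; omega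
        · intro hi; exact ⟨hKS hi, by simp [hi]⟩
      rw [hK']
      congr 1
      funext i
      by_cases hiK : i ∈ K
      · simp only [hiK, if_true]
        exact (h1 i (by simp [hiK])).symm
      · simp only [hiK, if_false]
        split_ifs with h
        · by_cases hS : i ∈ S
          · have := h2 i (Finset.mem_sdiff.2 ⟨hS, hiK⟩); omega
          · exact (h1 i fun h => hS (Finset.mem_sdiff.1 h).1).symm
        · rfl
    · intro c h
      rw [mem_wordSet] at h
      funext i
      simp only [Finset.mem_filter]
      by_cases hS : i ∈ S
      · by_cases hx : c i = x <;> simp [hS, hx]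
      · simp only [hS, false_and, if_false]
        split_ifs with hx
        · exact (h.1 i hS).symm
        · rfl
    · rintro ⟨K, c⟩ h
      rw [Finset.mem_sigma, Finset.mem_powersetCard, mem_wordSet] at h
      obtain ⟨⟨hKS, hK⟩, h1, h2, h3⟩ := h
      have := wordWeight_split (q := q) (ξ := ξ) (s := s) u x hKS (c := c)
        (fun i hi => (h2 i hi).1)
      rw [hK] at this
      dsimp only
      linear_combination (-∏ y ∈ Finset.Ico (x + 1) (x + (N + 1)), qPoch q q (n y)) * this

end

/-! ### Path collections as components of Bethe vectors -/

noncomputable section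

variable {q : ℂ} {ξ s : ℕ → ℂ}

/-- Path configurations in a single row: `n` records the occupation numbers above the row, `j` paths
enter from the left, and no path passes beyond the first `N` columns. -/
@[ext]
structure RowPath (N j : ℕ) (n : ℕ → ℕ) where
  /-- The occupation numbers below the row. -/
  bot : ℕ → ℕ
  /-- The numbers of paths along the horizontal edges. -/
  h : ℕ → ℕ
  left : h 0 = j
  right : ∀ x, N ≤ x → h x = 0
  conserve : ∀ x, bot x + h x = n x + h (x + 1)

theorem RowPath.h_le {N j : ℕ} {n : ℕ → ℕ} (r : RowPath N j n) (x : ℕ) :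
    r.h x ≤ ∑ y ∈ Finset.range N, n y := by
  have key : ∀ d x, x + d = N → r.h x ≤ ∑ y ∈ Finset.Ico x N, n y := by
    intro d
    induction d with
    | zero => intro x hx; rw [r.right x (by omega)]; exact Nat.zero_le _
    | succ d ih =>
      intro x hx
      rw [Finset.sum_eq_sum_Ico_succ_bot (by omega)]
      have := r.conserve x
      have := ih (x + 1) (by omega)
      omega
  rcases lt_or_ge x N with hx | hx
  · refine (key (N - x) x (by omega)).trans (Finset.sum_le_sum_of_subset ?_)
    intro y hy
    rw [Finset.mem_Ico] at hy
    rw [Finset.mem_range]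
    exact hy.2
  · rw [r.right x hx]; exact Nat.zero_le _

instance RowPath.finite (N j : ℕ) (n : ℕ → ℕ) : Finite (RowPath N j n) := by
  let f : RowPath N j n → (Fin N → Fin (∑ y ∈ Finset.range N, n y + 1)) := fun r x =>
    ⟨r.h x, Nat.lt_succ_of_le (r.h_le x)⟩
  refine Finite.of_injective f fun r r' hrr => ?_
  have hh : r.h = r'.h := by
    funext x
    rcases lt_or_ge x N with hx | hx
    · simpa [f] using congrFun hrr ⟨x, hx⟩
    · rw [r.right x hx, r'.right x hx]
  refine RowPath.ext ?_ hh
  funext x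
  have h1 := r.conserve x
  have h2 := r'.conserve x
  rw [hh] at h1
  omega

instance RowPath.fintype (N j : ℕ) (n : ℕ → ℕ) : Fintype (RowPath N j n) := Fintype.ofFinite _

/-- Adding a vertex at the left end of a row. -/
def RowPath.cons {N m : ℕ} (j : ℕ) {n : ℕ → ℕ} (hj : j ≤ n 0 + m)
    (r : RowPath N m fun y => n (y + 1)) : RowPath (N + 1) j n where
  bot
    | 0 => n 0 + m - j
    | y + 1 => r.bot y
  h
    | 0 => j
    | y + 1 => r.h y
  left := rfl
  right
    | 0, hx => absurd hx (by omega)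
    | y + 1, hx => r.right y (by omega)
  conserve
    | 0 => by have := r.left; simp only; omega
    | y + 1 => r.conserve y

/-- Removing the vertex at the left end of a row. -/
def RowPath.tail {N j : ℕ} {n : ℕ → ℕ} (r : RowPath (N + 1) j n) (m : ℕ) (hm : r.h 1 = m) :
    RowPath N m fun y => n (y + 1) where
  bot y := r.bot (y + 1)
  h y := r.h (y + 1)
  left := hm
  right y hy := r.right (y + 1) (by omega)
  conserve y := r.conserve (y + 1)

theorem RowPath.sum_filter {N j : ℕ} {n : ℕ → ℕ} (m : ℕ) (hj : j ≤ n 0 + m)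
    (f : RowPath (N + 1) j n → ℂ) :
    ∑ r ∈ Finset.univ.filter (fun r : RowPath (N + 1) j n => r.h 1 = m), f r =
      ∑ r : RowPath N m fun y => n (y + 1), f (r.cons j hj) := by
  refine (Finset.sum_bij' (fun r _ => r.cons j hj)
    (fun r hr => r.tail m (Finset.mem_filter.1 hr).2) ?_ ?_ ?_ ?_ ?_).symm
  · intro r _
    rw [Finset.mem_filter]
    exact ⟨Finset.mem_univ _, r.left⟩
  · intro r _; exact Finset.mem_univ _
  · intro r _; rfl
  · intro r hr
    have hm := (Finset.mem_filter.1 hr).2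
    have h1 := r.conserve 0
    have h2 := r.left
    rw [zero_add, hm] at h1
    ext y
    · cases y with
      | zero => change n 0 + m - j = r.bot 0; omega
      | succ y => rfl
    · cases y with
      | zero => exact h2.symm
      | succ y => rfl
  · intro r _; rfl

theorem RowPath.filter_eq_empty {N j : ℕ} {n : ℕ → ℕ} (m : ℕ) (hj : n 0 + m < j) :
    Finset.univ.filter (fun r : RowPath (N + 1) j n => r.h 1 = m) = ∅ := by
  rw [Finset.eq_empty_iff_forall_notMem]
  intro r hr
  have hm := (Finset.mem_filter.1 hr).2
  have h1 := r.conserve 0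
  have h2 := r.left
  rw [zero_add, hm] at h1
  omega

variable (q ξ s) in
/-- The product of the vertex weights along a row; the columns are numbered from `x` on. -/
def RowPath.weight {N j : ℕ} {n : ℕ → ℕ} (r : RowPath N j n) (x : ℕ) (u : ℂ) : ℂ :=
  ∏ y ∈ Finset.range N,
    vertexWeight q (s (x + y)) (ξ (x + y) * u) (r.bot y) (r.h y) (n y) (r.h (y + 1))

theorem RowPath.weight_cons {N m j : ℕ} {n : ℕ → ℕ} (hj : j ≤ n 0 + m)
    (r : RowPath N m fun y => n (y + 1)) (x : ℕ) (u : ℂ) :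
    (r.cons j hj).weight q ξ s x u =
      vertexWeight q (s x) (ξ x * u) (n 0 + m - j) j (n 0) m * r.weight q ξ s (x + 1) u := by
  rw [RowPath.weight, RowPath.weight, Finset.prod_range_succ', mul_comm]
  congr 1
  · change vertexWeight q (s (x + 0)) (ξ (x + 0) * u) (n 0 + m - j) j (n 0) (r.h 0) = _
    rw [r.left]
    rfl
  · refine Finset.prod_congr rfl fun y _ => ?_
    have : x + (y + 1) = x + 1 + y := by omega
    rw [this]
    rfl

theorem occupation_shift (n : ℕ → ℕ) (x N : ℕ) :
    occupation (fun y => n (y + 1)) x N = occupation n (x + 1) N := by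
  induction N generalizing x with
  | zero => rfl
  | succ N ih => rw [occupation_succ, occupation_succ, ih]

theorem RowPath.occupation_cons {N m j : ℕ} {n : ℕ → ℕ} (hj : j ≤ n 0 + m)
    (r : RowPath N m fun y => n (y + 1)) :
    occupation (r.cons j hj).bot 0 (N + 1) = (n 0 + m - j) :: occupation r.bot 0 N := by
  rw [occupation_succ, ← occupation_shift]
  rfl

/-- The linear forms `rowForm` are the partition functions of single rows. -/
theorem sum_rowPath (u : ℂ) (N : ℕ) : ∀ (x j : ℕ) (n : ℕ → ℕ) (ψ : List ℕ → ℂ),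
    ∑ r : RowPath N j n, r.weight q ξ s x u * ψ (occupation r.bot 0 N) =
      if j = 0 then rowForm q ξ s u (occupation n 0 N) x false ψ
      else if j = 1 then rowForm q ξ s u (occupation n 0 N) x true ψ else 0 := by
  induction N with
  | zero =>
    intro x j n ψ
    rcases Nat.eq_zero_or_pos j with rfl | hj
    · rw [if_pos rfl]
      have : (Finset.univ : Finset (RowPath 0 0 n)) =
          {⟨n, fun _ => 0, rfl, fun _ _ => rfl, fun _ => rfl⟩} := by
        ext r
        simp only [Finset.mem_univ, Finset.mem_singleton, true_iff]
        have hh : r.h = fun _ => 0 := funext fun x => r.right x (Nat.zero_le _)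
        refine RowPath.ext ?_ hh
        funext x
        have := r.conserve x
        rw [hh] at this
        exact this
      rw [this, Finset.sum_singleton, RowPath.weight, Finset.prod_range_zero, one_mul]
      rfl
    · have hE : IsEmpty (RowPath 0 j n) :=
        ⟨fun r => by have := r.left; have := r.right 0 le_rfl; omega⟩
      rw [Finset.univ_eq_empty, Finset.sum_empty, if_neg hj.ne']
      split_ifs <;> rfl
  | succ N ih =>
    intro x j n ψ
    -- The weight vanishes if more than one path leaves the first vertex to the right.
    have hsplit : ∑ r : RowPath (N + 1) j n,
        r.weight q ξ s x u * ψ (occupation r.bot 0 (N + 1)) =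
        ∑ r ∈ Finset.univ.filter (fun r : RowPath (N + 1) j n => r.h 1 = 0),
          r.weight q ξ s x u * ψ (occupation r.bot 0 (N + 1)) +
        ∑ r ∈ Finset.univ.filter (fun r : RowPath (N + 1) j n => r.h 1 = 1),
          r.weight q ξ s x u * ψ (occupation r.bot 0 (N + 1)) := by
      classical
      rw [← Finset.sum_union]
      · symm
        refine Finset.sum_subset (Finset.subset_univ _) fun r _ hr => ?_
        simp only [Finset.mem_union, Finset.mem_filter, Finset.mem_univ, true_and, not_or] at hr
        have : r.weight q ξ s x u = 0 := by
          refine Finset.prod_eq_zero (Finset.mem_range.2 (Nat.succ_pos N)) ?_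
          simp [vertexWeight, hr.1, hr.2]
        rw [this, zero_mul]
      · rw [Finset.disjoint_left]
        intro r h1 h2
        have h1 := (Finset.mem_filter.1 h1).2
        have h2 := (Finset.mem_filter.1 h2).2
        omega
    have hm : ∀ m (hj : j ≤ n 0 + m),
        ∑ r ∈ Finset.univ.filter (fun r : RowPath (N + 1) j n => r.h 1 = m),
          r.weight q ξ s x u * ψ (occupation r.bot 0 (N + 1)) =
        vertexWeight q (s x) (ξ x * u) (n 0 + m - j) j (n 0) m *
          if m = 0 then
            rowForm q ξ s u (occupation n 1 N) (x + 1) false (slice (n 0 + m - j) ψ)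
          else if m = 1 then
            rowForm q ξ s u (occupation n 1 N) (x + 1) true (slice (n 0 + m - j) ψ)
          else 0 := by
      intro m hj
      rw [RowPath.sum_filter m hj, ← occupation_shift n 0 N, ← ih (x + 1), Finset.mul_sum]
      refine Finset.sum_congr rfl fun r _ => ?_
      rw [RowPath.weight_cons, RowPath.occupation_cons, slice_apply]
      ring
    rw [hsplit]
    rcases Nat.lt_or_ge j 2 with hj | hj
    · have hj' : j = 0 ∨ j = 1 := by omega
      rw [occupation_succ]
      rcases hj' with rfl | rfl
      · rw [hm 0 (Nat.zero_le _), hm 1 (Nat.zero_le _)]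
        simp [vertexWeight, rowForm]
      · rw [hm 1 (by omega)]
        rcases Nat.eq_zero_or_pos (n 0) with h0 | h0
        · rw [RowPath.filter_eq_empty 0 (by omega)]
          simp [vertexWeight, rowForm, h0]
        · rw [hm 0 (by omega)]
          obtain ⟨a, ha⟩ : ∃ a, n 0 = a + 1 := ⟨n 0 - 1, by omega⟩
          simp [vertexWeight, rowForm, ha]
    · rw [if_neg (by omega), if_neg (by omega)]
      have : ∀ r : RowPath (N + 1) j n, r.weight q ξ s x u = 0 := by
        intro r
        refine Finset.prod_eq_zero (Finset.mem_range.2 (Nat.succ_pos N)) ?_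
        have h1 : r.h 0 ≠ 0 := by rw [r.left]; omega
        have h2 : r.h 0 ≠ 1 := by rw [r.left]; omega
        simp [vertexWeight, h1, h2]
      simp [this]

/-- Path configurations in `k` rows which do not pass beyond the first `N` columns, with
arbitrary occupation numbers `n` above the last row. Unlike `PathCollection`, this allows for an
induction on the number of rows. -/
@[ext]
structure PathGrid (N k : ℕ) (n : ℕ → ℕ) where
  /-- The numbers of paths along the vertical edges. -/
  vert : ℕ → Fin (k + 1) → ℕ
  /-- The numbers of paths along the horizontal edges. -/
  horiz : ℕ → Fin k → ℕ
  bottom : ∀ x, vert x 0 = 0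
  left : ∀ y, horiz 0 y = 1
  top : ∀ x, vert x (Fin.last k) = n x
  right : ∀ x, N ≤ x → ∀ y, horiz x y = 0
  conserve : ∀ x y, vert x y.castSucc + horiz x y = vert x y.succ + horiz (x + 1) y

theorem PathGrid.heq_of_eq {N k : ℕ} {n n' : ℕ → ℕ} (hn : n = n') {P : PathGrid N k n}
    {P' : PathGrid N k n'} (hv : P.vert = P'.vert) (hh : P.horiz = P'.horiz) : HEq P P' := by
  subst hn
  exact _root_.heq_of_eq (PathGrid.ext hv hh)

/-- Splitting off the last row. -/
def PathGrid.equivSigma (N k : ℕ) (n : ℕ → ℕ) :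
    PathGrid N (k + 1) n ≃ Σ r : RowPath N 1 n, PathGrid N k r.bot where
  toFun P := ⟨⟨fun x => P.vert x (Fin.last k).castSucc, fun x => P.horiz x (Fin.last k),
      P.left _, fun x hx => P.right x hx _, fun x => by
        rw [P.conserve, ← P.top, Fin.succ_last]⟩,
    ⟨fun x y => P.vert x y.castSucc, fun x y => P.horiz x y.castSucc, fun x => P.bottom x,
      fun y => P.left _, fun x => rfl, fun x hx y => P.right x hx _, fun x y => by
        rw [P.conserve, Fin.succ_castSucc]⟩⟩
  invFun p := ⟨fun x => Fin.snoc (α := fun _ => ℕ) (p.2.vert x) (n x),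
    fun x => Fin.snoc (α := fun _ => ℕ) (p.2.horiz x) (p.1.h x),
    fun x => by
      have : (0 : Fin (k + 1 + 1)) = (0 : Fin (k + 1)).castSucc := rfl
      rw [this, Fin.snoc_castSucc, p.2.bottom],
    fun y => by
      induction y using Fin.lastCases with
      | last => rw [Fin.snoc_last, p.1.left]
      | cast y => rw [Fin.snoc_castSucc, p.2.left],
    fun x => by rw [Fin.snoc_last],
    fun x hx y => by
      induction y using Fin.lastCases with
      | last => rw [Fin.snoc_last, p.1.right x hx]
      | cast y => rw [Fin.snoc_castSucc, p.2.right x hx],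
    fun x y => by
      induction y using Fin.lastCases with
      | last =>
        rw [Fin.snoc_last, Fin.snoc_last, Fin.snoc_castSucc, Fin.succ_last, Fin.snoc_last,
          p.2.top, p.1.conserve]
      | cast y =>
        rw [Fin.snoc_castSucc, Fin.snoc_castSucc, Fin.snoc_castSucc, Fin.succ_castSucc,
          Fin.snoc_castSucc, p.2.conserve]⟩
  left_inv P := by
    ext x y
    · induction y using Fin.lastCases with
      | last => simp [P.top]
      | cast y => simp
    · induction y using Fin.lastCases with
      | last => simp
      | cast y => simp
  right_inv p := by
    have h1 : (fun x => Fin.snoc (α := fun _ => ℕ) (p.2.vert x) (n x) (Fin.last k).castSucc) =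
        p.1.bot := funext fun x => by rw [Fin.snoc_castSucc, p.2.top]
    refine Sigma.ext (RowPath.ext h1 (funext fun x => ?_)) (PathGrid.heq_of_eq h1 ?_ ?_)
    · exact Fin.snoc_last (α := fun _ => ℕ) _ _
    · funext x y
      exact Fin.snoc_castSucc (α := fun _ => ℕ) _ _ _
    · funext x y
      exact Fin.snoc_castSucc (α := fun _ => ℕ) _ _ _

instance PathGrid.finite (N k : ℕ) : ∀ n, Finite (PathGrid N k n) := by
  induction k with
  | zero =>
    intro n
    refine Finite.of_injective (fun _ => ()) fun P P' _ => ?_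
    ext x y
    · have : y = 0 := Subsingleton.elim (α := Fin 1) _ _
      rw [this, P.bottom, P'.bottom]
    · exact y.elim0
  | succ k ih =>
    intro n
    exact Finite.of_equiv _ (PathGrid.equivSigma N k n).symm

instance PathGrid.fintype (N k : ℕ) (n : ℕ → ℕ) : Fintype (PathGrid N k n) := Fintype.ofFinite _

variable (q ξ s) in
/-- The product of the vertex weights in the first `N` columns. -/
def PathGrid.weight {N k : ℕ} {n : ℕ → ℕ} (P : PathGrid N k n) (u : Fin k → ℂ) : ℂ :=
  ∏ y : Fin k, ∏ x ∈ Finset.range N,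
    vertexWeight q (s x) (ξ x * u y)
      (P.vert x y.castSucc) (P.horiz x y) (P.vert x y.succ) (P.horiz (x + 1) y)

theorem PathGrid.weight_succ {N k : ℕ} {n : ℕ → ℕ} (p : Σ r : RowPath N 1 n, PathGrid N k r.bot)
    (u : Fin (k + 1) → ℂ) :
    ((PathGrid.equivSigma N k n).symm p).weight q ξ s u =
      p.1.weight q ξ s 0 (u (Fin.last k)) * p.2.weight q ξ s fun y => u y.castSucc := by
  rw [PathGrid.weight, Fin.prod_univ_castSucc, mul_comm, PathGrid.weight, RowPath.weight]
  congr 1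
  · refine Finset.prod_congr rfl fun x _ => ?_
    simp only [PathGrid.equivSigma, Equiv.coe_fn_symm_mk, Fin.snoc_last, Fin.snoc_castSucc,
      Fin.succ_last, zero_add]
    rw [p.2.top]
  · refine Finset.prod_congr rfl fun y _ => Finset.prod_congr rfl fun x _ => ?_
    simp only [PathGrid.equivSigma, Equiv.coe_fn_symm_mk, Fin.snoc_castSucc, Fin.succ_castSucc]

theorem betheVector_map {ι κ : Type*} [DecidableEq ι] [DecidableEq κ] (e : ι ↪ κ) (u : κ → ℂ)
    (x : ℕ) (S : Finset ι) :
    betheVector q ξ s u x (S.map e) = betheVector q ξ s (fun i => u (e i)) x S := by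
  induction S using Finset.induction_on with
  | empty => rw [Finset.map_empty, betheVector_empty, betheVector_empty]
  | insert i S hi ih =>
    rw [Finset.map_insert, betheVector_insert _ _ (by simpa using hi), betheVector_insert _ _ hi, ih]

theorem sum_pathGrid (N k : ℕ) : ∀ (n : ℕ → ℕ) (_ : ∀ x, N ≤ x → n x = 0) (u : Fin k → ℂ),
    ∑ P : PathGrid N k n, P.weight q ξ s u =
      betheVector q ξ s u 0 Finset.univ (occupation n 0 N) := by
  induction k with
  | zero =>
    intro n hn u
    rw [Finset.univ_eq_empty (α := Fin 0), betheVector_empty, vacuum]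
    by_cases h : ∀ m ∈ occupation n 0 N, m = 0
    · rw [if_pos h]
      have h' : ∀ x, n x = 0 := by
        intro x
        rcases lt_or_ge x N with hx | hx
        · exact h _ (List.mem_map_of_mem (by simp [hx]))
        · exact hn x hx
      have : (Finset.univ : Finset (PathGrid N 0 n)) =
          {⟨fun _ _ => 0, fun _ y => y.elim0, fun _ => rfl, fun y => y.elim0,
            fun x => (h' x).symm, fun _ _ y => y.elim0, fun _ y => y.elim0⟩} := by
        ext P
        simp only [Finset.mem_univ, Finset.mem_singleton, true_iff]
        ext x y
        · have : y = 0 := Subsingleton.elim (α := Fin 1) _ _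
          rw [this, P.bottom]
        · exact y.elim0
      rw [this, Finset.sum_singleton]
      rfl
    · rw [if_neg h]
      have hE : IsEmpty (PathGrid N 0 n) := by
        refine ⟨fun P => h fun m hm => ?_⟩
        obtain ⟨x, -, rfl⟩ := List.mem_map.1 hm
        rw [← P.top x]
        exact P.bottom x
      rw [Finset.univ_eq_empty, Finset.sum_empty]
  | succ k ih =>
    intro n hn u
    rw [← (PathGrid.equivSigma N k n).symm.sum_comp, Fintype.sum_sigma]
    simp only [PathGrid.weight_succ]
    have hu : (Finset.univ : Finset (Fin (k + 1))) =
        insert (Fin.last k) (Finset.univ.map Fin.castSuccEmb) := by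
      rw [Fin.univ_castSuccEmb, Finset.cons_eq_insert]
    rw [hu, betheVector_insert _ _ (by simp [Fin.castSucc_ne_last]), betheVector_map]
    have := sum_rowPath (q := q) (ξ := ξ) (s := s) (u (Fin.last k)) N 0 1 n
      (betheVector q ξ s (fun i => u (Fin.castSuccEmb i)) 0 Finset.univ)
    rw [if_neg one_ne_zero, if_pos rfl] at this
    refine Eq.trans ?_ this
    refine Finset.sum_congr rfl fun r _ => ?_
    rw [← Finset.mul_sum, ih r.bot]
    · rfl
    · intro x hx
      have := r.conserve x
      rw [r.right x hx, r.right (x + 1) (by omega), hn x hx] at this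
      exact this

/-- Path collections with endpoints in the first `N` columns, as path grids. -/
def PathCollection.equivPathGrid {k N : ℕ} (lam : NonnegSignature k) (hN : ∀ i, lam.1 i < N) :
    PathCollection lam ≃ PathGrid N k lam.mult where
  toFun P := ⟨P.vert, P.horiz, P.bottom, P.left, P.top,
    fun x hx y => P.horiz_eq_zero x (fun i => (hN i).trans_le hx) y, P.conserve⟩
  invFun P := ⟨P.vert, P.horiz, P.bottom, P.left, P.top, P.conserve⟩
  left_inv _ := rfl
  right_inv _ := rfl

theorem NonnegSignature.mult_eq_zero {k N : ℕ} {lam : NonnegSignature k} (hN : ∀ i, lam.1 i < N)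
    {x : ℕ} (hx : N ≤ x) : lam.mult x = 0 := by
  rw [NonnegSignature.mult, Finset.card_eq_zero, Finset.filter_eq_empty_iff]
  intro i _ h
  have := hN i
  omega

/-- The weight of a path collection is a product over finitely many columns. -/
theorem PathCollection.weight_eq {k N : ℕ} {lam : NonnegSignature k} (hN : ∀ i, lam.1 i < N)
    (P : PathCollection lam) {u : Fin k → ℂ} (hu : ∀ i, Regular ξ s (u i)) :
    P.weight q ξ s u = ∏ x ∈ Finset.range N, ∏ y : Fin k,
      vertexWeight q (s x) (ξ x * u y)
        (P.vert x y.castSucc) (P.horiz x y) (P.vert x y.succ) (P.horiz (x + 1) y) := by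
  refine finprod_eq_prod_of_mulSupport_subset _ fun x hx => ?_
  by_contra hxN
  have hxN : N ≤ x := by simpa using hxN
  refine hx (Finset.prod_eq_one fun y _ => ?_)
  have h1 : ∀ x', N ≤ x' → ∀ y, P.horiz x' y = 0 := fun x' hx' y =>
    P.horiz_eq_zero x' (fun i => (hN i).trans_le hx') y
  have h2 : ∀ y, P.vert x y = 0 := by
    intro y
    have := P.vert_le x y
    simp only [h1 x hxN, Finset.sum_const_zero] at this
    omega
  rw [h1 x hxN, h1 (x + 1) (by omega), h2, h2]
  simp [vertexWeight, div_self (hu y x)]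

/-- The function `F_lam` is a component of a Bethe vector. -/
theorem symF_eq_betheVector {k N : ℕ} {lam : NonnegSignature k} (hN : ∀ i, lam.1 i < N)
    {u : Fin k → ℂ} (hu : ∀ i, Regular ξ s (u i)) :
    symF q ξ s lam u = betheVector q ξ s u 0 Finset.univ (occupation lam.mult 0 N) := by
  rw [← sum_pathGrid N k lam.mult (fun x hx => NonnegSignature.mult_eq_zero hN hx) u, symF,
    ← finsum_eq_sum_of_fintype]
  refine finsum_eq_of_bijective _ (PathCollection.equivPathGrid lam hN).bijective fun P => ?_
  rw [PathCollection.weight_eq hN P hu, Finset.prod_comm]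
  rfl

end

/-! ### Symmetrization formulas for the functions `F_lam` -/

noncomputable section

variable {q : ℂ} {ξ s : ℕ → ℂ}

/-- The symmetrization formula for `F_lam`, as a sum over the rearrangements of `lam`. -/
theorem symF_eq_sum_words {k N : ℕ} {lam : NonnegSignature k} (hN : ∀ i, lam.1 i < N)
    {u : Fin k → ℂ} (hinj : Function.Injective u) (hu : ∀ i, Regular ξ s (u i)) :
    symF q ξ s lam u = (∏ y ∈ Finset.range N, qPoch q q (lam.mult y)) *
      ∑ c ∈ wordSet lam.mult Finset.univ 0 N, wordWeight q ξ s u 0 Finset.univ c := by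
  rw [symF_eq_betheVector hN hu, betheVector_occupation hinj hu, zero_add, Finset.range_eq_Ico]

theorem symF_comp_perm {k : ℕ} {lam : NonnegSignature k}
    {u : Fin k → ℂ} (hu : ∀ i, Regular ξ s (u i)) (σ : Equiv.Perm (Fin k)) :
    symF q ξ s lam (fun i => u (σ i)) = symF q ξ s lam u := by
  obtain ⟨N, hN⟩ : ∃ N, ∀ i, lam.1 i < N :=
    ⟨∑ i, lam.1 i + 1, fun i => Nat.lt_succ_of_le
      (Finset.single_le_sum (f := fun i => lam.1 i) (fun _ _ => Nat.zero_le _) (Finset.mem_univ i))⟩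
  rw [symF_eq_betheVector hN hu, symF_eq_betheVector hN fun i => hu (σ i)]
  have := betheVector_map (q := q) (ξ := ξ) (s := s) σ.toEmbedding u 0 Finset.univ
  rw [Finset.map_univ_equiv] at this
  rw [this]
  rfl

/-- The product of the factors `h(u i, u j)` over the pairs in `S` on which `c` increases. -/
def increaseProd {ι : Type*} (q : ℂ) (c : ι → ℕ) (w : ι → ℂ) (S : Finset ι) : ℂ :=
  ∏ i ∈ S, ∏ j ∈ S.filter (fun j => c i < c j), pairFactor q (w i) (w j)

theorem increaseProd_map {ι κ : Type*} (e : ι ↪ κ) (c : κ → ℕ) (w : κ → ℂ) (S : Finset ι) :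
    increaseProd q c w (S.map e) = increaseProd q (fun i => c (e i)) (fun i => w (e i)) S := by
  rw [increaseProd, Finset.prod_map]
  refine Finset.prod_congr rfl fun i _ => ?_
  rw [Finset.filter_map, Finset.prod_map]
  rfl

theorem increaseProd_erase_max {ι : Type*} [DecidableEq ι] (c : ι → ℕ) (w : ι → ℂ) {S : Finset ι}
    {p : ι} (hp : p ∈ S) (hmax : ∀ i ∈ S, c i ≤ c p) :
    increaseProd q c w S = (∏ i ∈ S.filter (fun i => c i ≠ c p), pairFactor q (w i) (w p)) *
      increaseProd q c w (S.erase p) := by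
  have h1 : ∀ i ∈ S.erase p, ∏ j ∈ S.filter (fun j => c i < c j), pairFactor q (w i) (w j) =
      (if c i ≠ c p then pairFactor q (w i) (w p) else 1) *
        ∏ j ∈ (S.erase p).filter (fun j => c i < c j), pairFactor q (w i) (w j) := by
    intro i hi
    rw [Finset.filter_erase]
    have hle := hmax i (Finset.mem_of_mem_erase hi)
    split_ifs with h
    · rw [Finset.mul_prod_erase _ (fun j => pairFactor q (w i) (w j))]
      exact Finset.mem_filter.2 ⟨hp, lt_of_le_of_ne hle h⟩
    · rw [one_mul, Finset.erase_eq_of_notMem]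
      rw [Finset.mem_filter, not_and]
      intro _ h'
      omega
  have h2 : S.filter (fun j => c p < c j) = ∅ :=
    Finset.filter_eq_empty_iff.2 fun i hi => not_lt.2 (hmax i hi)
  rw [increaseProd, ← Finset.mul_prod_erase _ _ hp, h2, Finset.prod_empty, one_mul,
    Finset.prod_congr rfl h1, Finset.prod_mul_distrib, ← Finset.prod_filter]
  congr 2
  ext i
  simp only [Finset.mem_filter, Finset.mem_erase]
  constructor
  · rintro ⟨⟨-, h⟩, h'⟩; exact ⟨h, h'⟩
  · rintro ⟨h, h'⟩; exact ⟨⟨fun hi => h' (by rw [hi]), h⟩, h'⟩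

/-- The embedding of `Fin k` into `Fin (k + 1)` which avoids `p`; the order is not preserved. -/
def swapEmb {k : ℕ} (p : Fin (k + 1)) : Fin k ↪ Fin (k + 1) :=
  (Fin.succEmb k).trans (Equiv.swap 0 p).toEmbedding

theorem map_swapEmb {k : ℕ} (p : Fin (k + 1)) :
    Finset.univ.map (swapEmb p) = Finset.univ.erase p := by
  ext i
  simp only [Finset.mem_map, Finset.mem_univ, true_and, Finset.mem_erase, and_true]
  constructor
  · rintro ⟨j, rfl⟩ h
    have h' : Equiv.swap 0 p j.succ = p := h
    rw [Equiv.swap_apply_eq_iff, Equiv.swap_apply_right] at h'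
    exact Fin.succ_ne_zero j h'
  · intro h
    have h0 : Equiv.swap 0 p i ≠ 0 := by
      rw [Ne, Equiv.swap_apply_eq_iff, Equiv.swap_apply_left]
      exact h
    obtain ⟨j, hj⟩ := Fin.exists_succ_eq.2 h0
    refine ⟨j, ?_⟩
    change Equiv.swap 0 p j.succ = i
    rw [hj, Equiv.swap_apply_self]

theorem decomposeFin_symm_succ {k : ℕ} (p : Fin (k + 1)) (e : Equiv.Perm (Fin k)) (i : Fin k) :
    Equiv.Perm.decomposeFin.symm (p, e) i.succ = swapEmb p (e i) :=
  Equiv.Perm.decomposeFin_symm_apply_succ e p i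

/-- The symmetrization over all the orderings of the indices along which `c` decreases. -/
theorem sum_perm_antitone (N k : ℕ) : ∀ (c : Fin k → ℕ) (_ : ∀ i, c i < N) (w : Fin k → ℂ)
    (_ : Function.Injective w),
    (1 - q) ^ k * ∑ σ : Equiv.Perm (Fin k), (if Antitone (fun i => c (σ i)) then
      ∏ α : Fin k, ∏ β ∈ Finset.Ioi α, pairFactor q (w (σ β)) (w (σ α)) else 0) =
      (∏ y ∈ Finset.range N, qPoch q q (Finset.univ.filter fun i => c i = y).card) *
        increaseProd q c w Finset.univ := by
  induction k with
  | zero =>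
    intro c _ w _
    have h : Antitone (fun i => c i) := fun i => i.elim0
    simp [increaseProd, qPoch, Subsingleton.antitone]
  | succ k ih =>
    intro c hc w hw
    obtain ⟨m, -, hm⟩ := Finset.exists_max_image Finset.univ c ⟨0, Finset.mem_univ _⟩
    have hm : ∀ i, c i ≤ c m := fun i => hm i (Finset.mem_univ i)
    -- The first position of the ordering carries an index `p` of the largest colour. The other
    -- positions are treated by induction, and `sum_prod_pairFactor` gives the sum over `p`.
    set K := Finset.univ.filter fun i => c i = c m with hK
    have hanti : ∀ (p : Fin (k + 1)) (e : Equiv.Perm (Fin k)),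
        Antitone (fun i => c (Equiv.Perm.decomposeFin.symm (p, e) i)) ↔
          p ∈ K ∧ Antitone (fun i => c (swapEmb p (e i))) := by
      intro p e
      rw [hK, Finset.mem_filter]
      constructor
      · intro h
        refine ⟨⟨Finset.mem_univ _, le_antisymm (hm p) ?_⟩, fun i j hij => ?_⟩
        · have := h (Fin.zero_le ((Equiv.Perm.decomposeFin.symm (p, e)).symm m))
          simpa using this
        · have := h (Fin.succ_le_succ_iff.2 hij)
          simpa only [decomposeFin_symm_succ] using this
      · rintro ⟨⟨-, hp⟩, h⟩ i j hij
        dsimp only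
        induction i using Fin.cases with
        | zero =>
          rw [Equiv.Perm.decomposeFin_symm_apply_zero, hp]
          exact hm _
        | succ i =>
          induction j using Fin.cases with
          | zero => exact absurd hij (by simp)
          | succ j =>
            rw [decomposeFin_symm_succ, decomposeFin_symm_succ]
            exact h (Fin.succ_le_succ_iff.1 hij)
    have hprod : ∀ (p : Fin (k + 1)) (e : Equiv.Perm (Fin k)),
        ∏ α, ∏ β ∈ Finset.Ioi α, pairFactor q (w (Equiv.Perm.decomposeFin.symm (p, e) β))
          (w (Equiv.Perm.decomposeFin.symm (p, e) α)) =
        (∏ i ∈ Finset.univ.erase p, pairFactor q (w i) (w p)) *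
          ∏ α, ∏ β ∈ Finset.Ioi α, pairFactor q (w (swapEmb p (e β))) (w (swapEmb p (e α))) := by
      intro p e
      rw [Fin.prod_univ_succ, Fin.prod_Ioi_zero]
      simp only [Fin.prod_Ioi_succ, decomposeFin_symm_succ,
        Equiv.Perm.decomposeFin_symm_apply_zero]
      congr 1
      rw [← map_swapEmb, Finset.prod_map,
        Equiv.prod_comp e (fun i => pairFactor q (w (swapEmb p i)) (w p))]
    have hcard : ∀ p ∈ K, ∏ y ∈ Finset.range N,
        qPoch q q (Finset.univ.filter fun i => c i = y).card =
        (1 - q ^ K.card) * ∏ y ∈ Finset.range N,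
          qPoch q q (Finset.univ.filter fun i => c (swapEmb p i) = y).card := by
      intro p hp
      have hp' : c p = c m := (Finset.mem_filter.1 hp).2
      have h1 : ∀ y, (Finset.univ.filter fun i => c (swapEmb p i) = y).card =
          ((Finset.univ.filter fun i => c i = y).erase p).card := by
        intro y
        rw [← Finset.filter_erase, ← map_swapEmb, Finset.filter_map, Finset.card_map]
        rfl
      have hmN : c m ∈ Finset.range N := Finset.mem_range.2 (hc m)
      simp only [h1]
      rw [← Finset.mul_prod_erase _ _ hmN, ← Finset.mul_prod_erase _ _ hmN, ← mul_assoc]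
      congr 1
      · obtain ⟨n, hn⟩ : ∃ n, K.card = n + 1 :=
          ⟨_, (Nat.succ_pred_eq_of_pos (Finset.card_pos.2 ⟨p, hp⟩)).symm⟩
        rw [← hK, Finset.card_erase_of_mem hp, hn, qPoch_succ, Nat.add_sub_cancel]
        ring
      · refine Finset.prod_congr rfl fun y hy => ?_
        rw [Finset.erase_eq_of_notMem]
        intro h
        exact (Finset.mem_erase.1 hy).1 ((Finset.mem_filter.1 h).2.symm.trans hp')
    have hinc : ∀ p ∈ K, (∏ i ∈ Finset.univ.erase p, pairFactor q (w i) (w p)) *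
        increaseProd q (fun i => c (swapEmb p i)) (fun i => w (swapEmb p i)) Finset.univ =
        increaseProd q c w Finset.univ * ∏ i ∈ K.erase p, pairFactor q (w i) (w p) := by
      intro p hp
      have hp' : c p = c m := (Finset.mem_filter.1 hp).2
      rw [← increaseProd_map, map_swapEmb, increaseProd_erase_max c w (Finset.mem_univ p)
        fun i _ => hp'.symm ▸ hm i, ← Finset.prod_filter_mul_prod_filter_not (Finset.univ.erase p)
        (fun i => c i = c m)]
      have e1 : (Finset.univ.erase p).filter (fun i => c i = c m) = K.erase p := by
        rw [Finset.filter_erase]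
      have e2 : (Finset.univ.erase p).filter (fun i => ¬ c i = c m) =
          Finset.univ.filter (fun i => c i ≠ c p) := by
        rw [Finset.filter_erase, hp', Finset.erase_eq_of_notMem]
        simp [hp']
      rw [e1, e2]
      ring
    rw [← Equiv.Perm.decomposeFin.symm.sum_comp, Fintype.sum_prod_type]
    simp only [hanti, hprod, ite_and]
    have hterm : ∀ p, (1 - q) ^ (k + 1) * ∑ e : Equiv.Perm (Fin k), (if p ∈ K then
        if Antitone (fun i => c (swapEmb p (e i))) then
          (∏ i ∈ Finset.univ.erase p, pairFactor q (w i) (w p)) *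
          ∏ α, ∏ β ∈ Finset.Ioi α, pairFactor q (w (swapEmb p (e β))) (w (swapEmb p (e α)))
        else 0 else 0) = if p ∈ K then
          (∏ y ∈ Finset.range N, qPoch q q
            (Finset.univ.filter fun i => c (swapEmb m i) = y).card) *
          increaseProd q c w Finset.univ *
            ((1 - q) * ∏ i ∈ K.erase p, pairFactor q (w i) (w p)) else 0 := by
      intro p
      split_ifs with hp
      · have h1 := ih (fun i => c (swapEmb p i)) (fun i => hc _) (fun i => w (swapEmb p i))
          (hw.comp (swapEmb p).injective)
        have h2 := hinc p hp
        have h3 : ∏ y ∈ Finset.range N, qPoch q q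
            (Finset.univ.filter fun i => c (swapEmb p i) = y).card = ∏ y ∈ Finset.range N,
            qPoch q q (Finset.univ.filter fun i => c (swapEmb m i) = y).card := by
          have hp' : c p = c m := (Finset.mem_filter.1 hp).2
          refine Finset.prod_congr rfl fun y _ => ?_
          have h4 : ∀ p, (Finset.univ.filter fun i => c (swapEmb p i) = y).card =
              ((Finset.univ.filter fun i => c i = y).erase p).card := by
            intro p
            rw [← Finset.filter_erase, ← map_swapEmb, Finset.filter_map, Finset.card_map]
            rfl
          rw [h4, h4, Finset.card_erase_eq_ite, Finset.card_erase_eq_ite]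
          simp [hp']
        simp only [← mul_ite_zero, ← Finset.mul_sum] at h1 ⊢
        rw [← h3]
        linear_combination (1 - q) * (∏ i ∈ Finset.univ.erase p, pairFactor q (w i) (w p)) * h1 +
          (1 - q) * (∏ y ∈ Finset.range N, qPoch q q
            (Finset.univ.filter fun i => c (swapEmb p i) = y).card) * h2
      · simp
    rw [Finset.mul_sum, Finset.sum_congr rfl fun p _ => hterm p, ← Finset.sum_filter,
      Finset.filter_mem_eq_inter, Finset.univ_inter, ← Finset.mul_sum, ← Finset.mul_sum,
      sum_prod_pairFactor hw K, hcard m (Finset.mem_filter.2 ⟨Finset.mem_univ _, rfl⟩)]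
    ring

end

/-! ### Contour integrals and winding numbers -/

noncomputable section

open MeasureTheory Set Filter Topology in
theorem IsContour.isCompact_curveTrace {γ : ℝ → ℂ} (hγ : IsContour γ) : IsCompact (curveTrace γ) :=
  isCompact_Icc.image_of_continuousOn hγ.continuousOn

theorem mem_curveTrace {γ : ℝ → ℂ} {t : ℝ} (h0 : 0 ≤ t) (h1 : t ≤ 1) : γ t ∈ curveTrace γ :=
  ⟨t, ⟨h0, h1⟩, rfl⟩

open MeasureTheory Set in
theorem IsContour.exists_hasDerivAt {γ : ℝ → ℂ} (hγ : IsContour γ) :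
    ∃ S : Finset ℝ, ∀ t ∈ Ioo (0 : ℝ) 1 \ (S : Set ℝ), HasDerivAt γ (deriv γ t) t := by
  obtain ⟨S, hS⟩ := hγ.piecewise_contDiff
  refine ⟨S, fun t ht => ?_⟩
  have hopen : IsOpen (Ioo (0 : ℝ) 1 \ (S : Set ℝ)) :=
    isOpen_Ioo.sdiff S.finite_toSet.isClosed
  obtain ⟨ε, hε, hball⟩ := Metric.isOpen_iff.1 hopen t ht
  rw [Real.ball_eq_Ioo] at hball
  have h1 : t - ε / 2 ∈ Ioo (t - ε) (t + ε) := ⟨by linarith, by linarith⟩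
  have h2 : t + ε / 2 ∈ Ioo (t - ε) (t + ε) := ⟨by linarith, by linarith⟩
  have h3 := hS (t - ε / 2) (t + ε / 2) (hball h1).1.1.le (by linarith) (hball h2).1.2.le
    (Set.disjoint_left.2 fun x hx hxS =>
      (hball ⟨by linarith [hx.1], by linarith [hx.2]⟩).2 hxS)
  exact ((h3.differentiableOn one_ne_zero).differentiableAt
    (Icc_mem_nhds (by linarith) (by linarith))).hasDerivAt

open MeasureTheory Set in
theorem IsContour.intervalIntegrable_deriv {γ : ℝ → ℂ} (hγ : IsContour γ) :
    IntervalIntegrable (deriv γ) volume 0 1 := by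
  obtain ⟨S, hS⟩ := hγ.piecewise_contDiff
  have piece : ∀ a b : ℝ, 0 ≤ a → a < b → b ≤ 1 → Disjoint (Ioo a b) (S : Set ℝ) →
      IntervalIntegrable (deriv γ) volume a b := by
    intro a b ha hab hb hdis
    have h1 := (hS a b ha hab hb hdis).continuousOn_derivWithin (uniqueDiffOn_Icc hab) le_rfl
    have h2 : IntervalIntegrable (derivWithin γ (Icc a b)) volume a b := by
      apply ContinuousOn.intervalIntegrable
      rwa [uIcc_of_le hab.le]
    rw [intervalIntegrable_iff_integrableOn_Ioo_of_le hab.le] at h2 ⊢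
    refine h2.congr_fun (fun x hx => ?_) measurableSet_Ioo
    exact derivWithin_of_mem_nhds (Icc_mem_nhds hx.1 hx.2)
  -- Cut the interval at the exceptional points, by induction on their number.
  have main : ∀ (n : ℕ) (a b : ℝ), 0 ≤ a → a < b → b ≤ 1 →
      (S.filter fun x => x ∈ Ioo a b).card ≤ n → IntervalIntegrable (deriv γ) volume a b := by
    intro n
    induction n with
    | zero =>
      intro a b ha hab hb hcard
      refine piece a b ha hab hb (Set.disjoint_left.2 fun x hx hxS => ?_)
      have := Finset.card_eq_zero.1 (Nat.le_zero.1 hcard)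
      exact Finset.notMem_empty x (this ▸ Finset.mem_filter.2 ⟨hxS, hx⟩)
    | succ n ih =>
      intro a b ha hab hb hcard
      by_cases hne : (S.filter fun x => x ∈ Ioo a b).Nonempty
      · obtain ⟨c, hc⟩ := hne
        have hc' := (Finset.mem_filter.1 hc).2
        have key : ∀ a' b', Ioo a' b' ⊆ Ioo a b → c ∉ Ioo a' b' →
            (S.filter fun x => x ∈ Ioo a' b').card ≤ n := by
          intro a' b' hsub hcn
          refine Nat.le_of_lt_succ (lt_of_lt_of_le (Finset.card_lt_card ?_) hcard)
          refine ⟨fun x hx => ?_, fun h => ?_⟩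
          · rw [Finset.mem_filter] at hx ⊢
            exact ⟨hx.1, hsub hx.2⟩
          · exact hcn (Finset.mem_filter.1 (h hc)).2
        exact (ih a c ha hc'.1 (hc'.2.le.trans hb)
          (key a c (Ioo_subset_Ioo_right hc'.2.le) fun h => lt_irrefl _ h.2)).trans
          (ih c b (ha.trans hc'.1.le) hc'.2 hb
            (key c b (Ioo_subset_Ioo_left hc'.1.le) fun h => lt_irrefl _ h.1))
      · refine ih a b ha hab hb ?_
        rw [Finset.not_nonempty_iff_eq_empty.1 hne, Finset.card_empty]
        exact Nat.zero_le _
  exact main _ 0 1 le_rfl one_pos le_rfl le_rfl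

open Set in
theorem IsContour.continuousOn_comp {γ : ℝ → ℂ} (hγ : IsContour γ) {f : ℂ → ℂ}
    (hf : ContinuousOn f (curveTrace γ)) : ContinuousOn (fun t => f (γ t)) (Icc 0 1) :=
  hf.comp hγ.continuousOn fun t ht => ⟨t, ht, rfl⟩

open MeasureTheory Set in
theorem IsContour.intervalIntegrable {γ : ℝ → ℂ} (hγ : IsContour γ) {f : ℂ → ℂ}
    (hf : ContinuousOn f (curveTrace γ)) :
    IntervalIntegrable (fun t => f (γ t) * deriv γ t) volume 0 1 := by
  refine hγ.intervalIntegrable_deriv.continuousOn_mul ?_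
  rw [uIcc_of_le zero_le_one]
  exact hγ.continuousOn_comp hf

theorem contourIntegral_congr {γ : ℝ → ℂ} {f g : ℂ → ℂ} (h : Set.EqOn f g (curveTrace γ)) :
    contourIntegral γ f = contourIntegral γ g := by
  rw [contourIntegral, contourIntegral]
  congr 1
  refine intervalIntegral.integral_congr fun t ht => ?_
  rw [Set.uIcc_of_le zero_le_one] at ht
  simp only [h ⟨t, ht, rfl⟩]

theorem IsContour.contourIntegral_add {γ : ℝ → ℂ} (hγ : IsContour γ) {f g : ℂ → ℂ}
    (hf : ContinuousOn f (curveTrace γ)) (hg : ContinuousOn g (curveTrace γ)) :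
    contourIntegral γ (fun w => f w + g w) = contourIntegral γ f + contourIntegral γ g := by
  simp only [contourIntegral, add_mul]
  rw [intervalIntegral.integral_add (hγ.intervalIntegrable hf) (hγ.intervalIntegrable hg), mul_add]

theorem contourIntegral_const_mul (γ : ℝ → ℂ) (c : ℂ) (f : ℂ → ℂ) :
    contourIntegral γ (fun w => c * f w) = c * contourIntegral γ f := by
  simp only [contourIntegral, mul_assoc]
  rw [intervalIntegral.integral_const_mul]
  ring

theorem IsContour.contourIntegral_linear {γ : ℝ → ℂ} (hγ : IsContour γ) (a b : ℂ) {f g : ℂ → ℂ}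
    (hf : ContinuousOn f (curveTrace γ)) (hg : ContinuousOn g (curveTrace γ)) :
    contourIntegral γ (fun w => a * f w + b * g w) =
      a * contourIntegral γ f + b * contourIntegral γ g := by
  rw [hγ.contourIntegral_add (f := fun w => a * f w) (g := fun w => b * g w)
    (continuousOn_const.mul hf) (continuousOn_const.mul hg), contourIntegral_const_mul,
    contourIntegral_const_mul]

theorem contourIntegral_zero (γ : ℝ → ℂ) : contourIntegral γ (fun _ => 0) = 0 := by
  simp [contourIntegral]

/-- The integral of a derivative over a closed contour vanishes. -/
theorem IsContour.contourIntegral_deriv {γ : ℝ → ℂ} (hγ : IsContour γ) {F f : ℂ → ℂ}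
    (hF : ∀ z ∈ curveTrace γ, HasDerivAt F (f z) z) (hf : ContinuousOn f (curveTrace γ)) :
    contourIntegral γ f = 0 := by
  obtain ⟨S, hS⟩ := hγ.exists_hasDerivAt
  have hFc : ContinuousOn F (curveTrace γ) := fun z hz =>
    (hF z hz).continuousAt.continuousWithinAt
  have h : ∫ t in (0 : ℝ)..1, f (γ t) * deriv γ t = F (γ 1) - F (γ 0) := by
    refine MeasureTheory.integral_eq_of_hasDerivAt_off_countable (fun t => F (γ t)) _
      S.countable_toSet ?_ ?_ (hγ.intervalIntegrable hf)
    · rw [Set.uIcc_of_le zero_le_one]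
      exact hγ.continuousOn_comp hFc
    · intro t ht
      rw [min_eq_left zero_le_one, max_eq_right zero_le_one] at ht
      exact (hF (γ t) (mem_curveTrace ht.1.1.le ht.1.2.le)).comp t (hS t ht)
  rw [contourIntegral, h, hγ.closed, sub_self, mul_zero]

theorem IsContour.norm_contourIntegral_le {γ : ℝ → ℂ} (hγ : IsContour γ) {f : ℂ → ℂ} {M : ℝ}
    (hM : ∀ z ∈ curveTrace γ, ‖f z‖ ≤ M) :
    ‖contourIntegral γ f‖ ≤
      M * (‖(2 * (Real.pi : ℂ) * Complex.I)⁻¹‖ * ∫ t in (0 : ℝ)..1, ‖deriv γ t‖) := by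
  have h := intervalIntegral.norm_integral_le_of_norm_le (f := fun t => f (γ t) * deriv γ t)
    (g := fun t => M * ‖deriv γ t‖) (μ := MeasureTheory.volume) zero_le_one
    (Filter.Eventually.of_forall fun t ht => by
      rw [norm_mul]
      exact mul_le_mul_of_nonneg_right (hM _ (mem_curveTrace ht.1.le ht.2)) (norm_nonneg _))
    (hγ.intervalIntegrable_deriv.norm.const_mul M)
  rw [intervalIntegral.integral_const_mul] at h
  rw [contourIntegral, norm_mul]
  calc _ ≤ ‖(2 * (Real.pi : ℂ) * Complex.I)⁻¹‖ * (M * ∫ t in (0 : ℝ)..1, ‖deriv γ t‖) :=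
        mul_le_mul_of_nonneg_left h (norm_nonneg _)
    _ = _ := by ring

theorem continuousOn_inv_sub {T : Set ℂ} {z : ℂ} (hz : z ∉ T) :
    ContinuousOn (fun w => (w - z)⁻¹) T :=
  (continuousOn_id.sub continuousOn_const).inv₀ fun w hw h => by
    have h' : w = z := sub_eq_zero.1 h
    exact hz (h' ▸ hw)

/-- The winding number of a curve around `z`. -/
def windingNumber (γ : ℝ → ℂ) (z : ℂ) : ℂ := contourIntegral γ fun w => (w - z)⁻¹

theorem hasDerivAt_inv_sub_pow (z w : ℂ) (hw : w ≠ z) (n : ℕ) :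
    HasDerivAt (fun w => -((n : ℂ) + 1)⁻¹ * ((w - z)⁻¹) ^ (n + 1)) (((w - z)⁻¹) ^ (n + 2)) w := by
  have h0 : w - z ≠ 0 := sub_ne_zero.2 hw
  have h1 := (((hasDerivAt_id w).sub_const z).fun_inv h0).fun_pow (n + 1)
  refine (h1.const_mul _).congr_deriv ?_
  have : (n : ℂ) + 1 ≠ 0 := Nat.cast_add_one_ne_zero n
  have h2 : -1 / (w - z) ^ 2 = -((w - z)⁻¹) ^ 2 := by rw [inv_pow, neg_div, one_div]
  simp only [Nat.add_sub_cancel, Nat.cast_add, Nat.cast_one, id]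
  rw [h2, pow_add _ n 2]
  field_simp

theorem IsContour.contourIntegral_inv_sub_pow {γ : ℝ → ℂ} (hγ : IsContour γ) {z : ℂ}
    (hz : z ∉ curveTrace γ) (n : ℕ) :
    contourIntegral γ (fun w => ((w - z)⁻¹) ^ (n + 2)) = 0 :=
  hγ.contourIntegral_deriv (fun w hw => hasDerivAt_inv_sub_pow z w (fun h => hz (h ▸ hw)) n)
    ((continuousOn_inv_sub hz).pow _)

/-- The winding number has derivative zero: its increments are of second order. -/
theorem IsContour.hasDerivAt_windingNumber {γ : ℝ → ℂ} (hγ : IsContour γ) {z : ℂ}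
    (hz : z ∉ curveTrace γ) : HasDerivAt (windingNumber γ) 0 z := by
  have hopen : IsOpen (curveTrace γ)ᶜ := hγ.isCompact_curveTrace.isClosed.isOpen_compl
  obtain ⟨δ, hδ, hball⟩ := Metric.isOpen_iff.1 hopen z hz
  have hfar : ∀ z' ∈ Metric.ball z (δ / 2), ∀ w ∈ curveTrace γ, δ / 2 ≤ ‖w - z'‖ := by
    intro z' hz' w hw
    by_contra hlt
    refine hball (a := w) ?_ hw
    rw [Metric.mem_ball, dist_eq_norm] at hz' ⊢
    calc ‖w - z‖ = ‖(w - z') + (z' - z)‖ := by ring_nf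
      _ ≤ ‖w - z'‖ + ‖z' - z‖ := norm_add_le _ _
      _ < δ := by linarith
  have hz0 : z ∈ Metric.ball z (δ / 2) := Metric.mem_ball_self (by linarith)
  have hnot : ∀ z' ∈ Metric.ball z (δ / 2), z' ∉ curveTrace γ := fun z' hz' hmem => by
    have := hfar z' hz' z' hmem
    rw [sub_self, norm_zero] at this
    linarith
  set C := ((δ / 2)⁻¹ ^ 2 * (δ / 2)⁻¹) *
    (‖(2 * (Real.pi : ℂ) * Complex.I)⁻¹‖ * ∫ t in (0 : ℝ)..1, ‖deriv γ t‖)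
  have key : ∀ z' ∈ Metric.ball z (δ / 2),
      ‖windingNumber γ z' - windingNumber γ z‖ ≤ C * ‖z' - z‖ ^ 2 := by
    intro z' hz'
    have hc : ContinuousOn (fun w => ((w - z)⁻¹) ^ 2) (curveTrace γ) :=
      (continuousOn_inv_sub hz).pow 2
    have hc' : ContinuousOn (fun w => ((w - z)⁻¹) ^ 2 * (w - z')⁻¹) (curveTrace γ) :=
      hc.mul (continuousOn_inv_sub (hnot z' hz'))
    have e : windingNumber γ z' = windingNumber γ z + (z' - z) ^ 2 *
        contourIntegral γ (fun w => ((w - z)⁻¹) ^ 2 * (w - z')⁻¹) := by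
      have e1 : windingNumber γ z' = contourIntegral γ (fun w => ((w - z)⁻¹ +
          (z' - z) * ((w - z)⁻¹) ^ (0 + 2)) +
            (z' - z) ^ 2 * (((w - z)⁻¹) ^ 2 * (w - z')⁻¹)) := by
        refine contourIntegral_congr fun w hw => ?_
        have h1 : w - z ≠ 0 := sub_ne_zero.2 fun h => hz (h ▸ hw)
        have h2 : w - z' ≠ 0 := sub_ne_zero.2 fun h => hnot z' hz' (h ▸ hw)
        simp only [zero_add, inv_pow]
        field_simp
        ring
      have hc0 : ContinuousOn (fun w => (z' - z) * ((w - z)⁻¹) ^ (0 + 2)) (curveTrace γ) :=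
        continuousOn_const.mul hc
      have hc1 : ContinuousOn (fun w => (w - z)⁻¹ + (z' - z) * ((w - z)⁻¹) ^ (0 + 2))
        (curveTrace γ) := (continuousOn_inv_sub hz).add hc0
      have hc2 : ContinuousOn (fun w => (z' - z) ^ 2 * (((w - z)⁻¹) ^ 2 * (w - z')⁻¹))
        (curveTrace γ) := continuousOn_const.mul hc'
      rw [e1, hγ.contourIntegral_add hc1 hc2, hγ.contourIntegral_add (continuousOn_inv_sub hz) hc0,
        contourIntegral_const_mul, contourIntegral_const_mul,
        hγ.contourIntegral_inv_sub_pow hz, mul_zero, add_zero]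
      rfl
    rw [e, add_sub_cancel_left, norm_mul, norm_pow, mul_comm]
    refine mul_le_mul_of_nonneg_right ?_ (by positivity)
    refine hγ.norm_contourIntegral_le fun w hw => ?_
    rw [norm_mul, norm_pow, norm_inv, norm_inv]
    have h1 := inv_anti₀ (by linarith : 0 < δ / 2) (hfar z hz0 w hw)
    have h2 := inv_anti₀ (by linarith : 0 < δ / 2) (hfar z' hz' w hw)
    gcongr
  have hO : (fun z' => windingNumber γ z' - windingNumber γ z) =O[nhds z]
      fun z' => ‖z' - z‖ ^ 2 := by
    refine Asymptotics.IsBigO.of_bound C ?_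
    filter_upwards [Metric.ball_mem_nhds z (by linarith : 0 < δ / 2)] with z' hz'
    rw [norm_pow, norm_norm]
    exact key z' hz'
  have h := (hO.hasFDerivAt (𝕜 := ℂ) one_lt_two).hasDerivAt
  simpa using h.add_const (windingNumber γ z)

/-- The winding number around exterior points vanishes: it is constant on the unbounded component
and tends to zero at infinity. -/
theorem IsContour.windingNumber_exterior {γ : ℝ → ℂ} (hγ : IsContour γ) {z : ℂ}
    (hz : z ∈ curveExterior γ) : windingNumber γ z = 0 := by
  obtain ⟨hz, hunb⟩ := hz
  have hopen : IsOpen (curveTrace γ)ᶜ := hγ.isCompact_curveTrace.isClosed.isOpen_compl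
  set K := connectedComponentIn (curveTrace γ)ᶜ z
  have hKsub : K ⊆ (curveTrace γ)ᶜ := connectedComponentIn_subset _ _
  have hconst : ∀ z' ∈ K, windingNumber γ z' = windingNumber γ z := by
    intro z' hz'
    refine hopen.connectedComponentIn.is_const_of_deriv_eq_zero
      isPreconnected_connectedComponentIn ?_ ?_ hz' (mem_connectedComponentIn hz)
    · exact fun y hy =>
        (hγ.hasDerivAt_windingNumber (hKsub hy)).differentiableAt.differentiableWithinAt
    · exact fun y hy => (hγ.hasDerivAt_windingNumber (hKsub hy)).deriv
  obtain ⟨R, hR⟩ := hγ.isCompact_curveTrace.isBounded.exists_norm_le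
  set L := ‖(2 * (Real.pi : ℂ) * Complex.I)⁻¹‖ * ∫ t in (0 : ℝ)..1, ‖deriv γ t‖
  have hL : 0 ≤ L := mul_nonneg (norm_nonneg _)
    (intervalIntegral.integral_nonneg zero_le_one fun t _ => norm_nonneg _)
  have hle : ∀ r : ℝ, 0 < r → ‖windingNumber γ z‖ ≤ r⁻¹ * L := by
    intro r hr
    obtain ⟨z', hz', hbig⟩ : ∃ z' ∈ K, R + r < ‖z'‖ := by
      by_contra! h
      exact hunb (isBounded_iff_forall_norm_le.2 ⟨_, h⟩)
    rw [← hconst z' hz']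
    refine hγ.norm_contourIntegral_le fun w hw => ?_
    rw [norm_inv]
    refine inv_anti₀ hr ?_
    have h1 := hR w hw
    have h2 := norm_sub_norm_le z' w
    rw [norm_sub_rev] at h2
    linarith
  have h0 : ‖windingNumber γ z‖ ≤ 0 := by
    refine ge_of_tendsto (x := Filter.atTop) (f := fun r : ℝ => r⁻¹ * L) ?_ ?_
    · simpa using tendsto_inv_atTop_zero.mul_const L
    · filter_upwards [Filter.eventually_gt_atTop 0] with r hr using hle r hr
  exact norm_le_zero_iff.1 h0

theorem IsContour.windingNumber_interior {γ : ℝ → ℂ} (hγ : IsContour γ) {z : ℂ}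
    (hz : z ∈ curveInterior γ) : windingNumber γ z = 1 := hγ.positive z hz

theorem continuousOn_prod_inv_sub {T : Set ℂ} (m : Multiset ℂ) (hm : ∀ z ∈ m, z ∉ T) :
    ContinuousOn (fun w => (m.map fun z => (w - z)⁻¹).prod) T := by
  induction m using Multiset.induction_on with
  | empty => simpa using continuousOn_const
  | cons z m ih =>
    simp only [Multiset.map_cons, Multiset.prod_cons]
    exact (continuousOn_inv_sub (hm z (Multiset.mem_cons_self _ _))).mul
      (ih fun z' hz' => hm z' (Multiset.mem_cons_of_mem hz'))

/-- A product of at least two simple poles with equal winding numbers integrates to zero. -/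
theorem IsContour.contourIntegral_prod_inv_sub {γ : ℝ → ℂ} (hγ : IsContour γ) (ω : ℂ) (n : ℕ) :
    ∀ m : Multiset ℂ, m.card = n + 2 → (∀ z ∈ m, z ∉ curveTrace γ) →
      (∀ z ∈ m, windingNumber γ z = ω) →
      contourIntegral γ (fun w => (m.map fun z => (w - z)⁻¹).prod) = 0 := by
  induction n with
  | zero =>
    intro m hm hT hω
    obtain ⟨a, b, rfl⟩ := Multiset.card_eq_two.1 hm
    have ha := hT a (by simp)
    have hb := hT b (by simp)
    simp only [Multiset.insert_eq_cons, Multiset.map_cons, Multiset.map_singleton,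
      Multiset.prod_cons, Multiset.prod_singleton]
    rcases eq_or_ne a b with rfl | hab
    · simpa [pow_two] using hγ.contourIntegral_inv_sub_pow ha 0
    · have e : contourIntegral γ (fun w => (w - a)⁻¹ * (w - b)⁻¹) =
          contourIntegral γ (fun w => (a - b)⁻¹ * (w - a)⁻¹ + -(a - b)⁻¹ * (w - b)⁻¹) := by
        refine contourIntegral_congr fun w hw => ?_
        have h1 : w - a ≠ 0 := sub_ne_zero.2 fun h => ha (h ▸ hw)
        have h2 : w - b ≠ 0 := sub_ne_zero.2 fun h => hb (h ▸ hw)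
        have h3 : a - b ≠ 0 := sub_ne_zero.2 hab
        field_simp
        ring
      rw [e, hγ.contourIntegral_linear _ _ (continuousOn_inv_sub ha) (continuousOn_inv_sub hb)]
      have h1 := hω a (by simp)
      have h2 := hω b (by simp)
      rw [windingNumber] at h1 h2
      rw [h1, h2]
      ring
  | succ n ih =>
    intro m hm hT hω
    obtain ⟨a, ha⟩ := Multiset.card_pos_iff_exists_mem.1 (by omega : 0 < m.card)
    by_cases hall : ∀ b ∈ m, b = a
    · rw [Multiset.eq_replicate.2 ⟨hm, hall⟩]
      simp only [Multiset.map_replicate, Multiset.prod_replicate]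
      exact hγ.contourIntegral_inv_sub_pow (hT a ha) (n + 1)
    · push Not at hall
      obtain ⟨b, hb, hba⟩ := hall
      obtain ⟨m', rfl⟩ := Multiset.exists_cons_of_mem ha
      have hb' : b ∈ m' := (Multiset.mem_cons.1 hb).resolve_left hba
      obtain ⟨t, rfl⟩ := Multiset.exists_cons_of_mem hb'
      have haT := hT a ha
      have hbT := hT b hb
      have hsub1 : ∀ z ∈ a ::ₘ t, z ∈ a ::ₘ b ::ₘ t := fun z hz => by
        rw [Multiset.mem_cons] at hz ⊢
        exact hz.imp_right Multiset.mem_cons_of_mem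
      have hsub2 : ∀ z ∈ b ::ₘ t, z ∈ a ::ₘ b ::ₘ t := fun z hz => Multiset.mem_cons_of_mem hz
      have e : contourIntegral γ (fun w => ((a ::ₘ b ::ₘ t).map fun z => (w - z)⁻¹).prod) =
          contourIntegral γ (fun w => (a - b)⁻¹ * ((a ::ₘ t).map fun z => (w - z)⁻¹).prod +
            -(a - b)⁻¹ * ((b ::ₘ t).map fun z => (w - z)⁻¹).prod) := by
        refine contourIntegral_congr fun w hw => ?_
        have h1 : w - a ≠ 0 := sub_ne_zero.2 fun h => haT (h ▸ hw)
        have h2 : w - b ≠ 0 := sub_ne_zero.2 fun h => hbT (h ▸ hw)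
        have h3 : a - b ≠ 0 := sub_ne_zero.2 hba.symm
        simp only [Multiset.map_cons, Multiset.prod_cons]
        field_simp
        ring
      rw [e, hγ.contourIntegral_linear _ _
        (continuousOn_prod_inv_sub _ fun z hz => hT z (hsub1 z hz))
        (continuousOn_prod_inv_sub _ fun z hz => hT z (hsub2 z hz)),
        ih _ (by simpa using hm) (fun z hz => hT z (hsub1 z hz)) (fun z hz => hω z (hsub1 z hz)),
        ih _ (by simpa using hm) (fun z hz => hT z (hsub2 z hz)) (fun z hz => hω z (hsub2 z hz))]
      ring

end

/-! ### Rational functions with interior or exterior poles -/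

noncomputable section

theorem curveInterior_disjoint_exterior {γ : ℝ → ℂ} {z : ℂ} (hz : z ∈ curveInterior γ) :
    z ∉ curveExterior γ := fun h => h.2 hz.2

theorem mem_exterior_of_notMem {γ : ℝ → ℂ} {z : ℂ} (hz : z ∉ curveInterior γ)
    (hT : z ∉ curveTrace γ) : z ∈ curveExterior γ := ⟨hT, fun h => hz ⟨hT, h⟩⟩

/-- A point which is not in the interior of a contour can be joined to infinity by a connected set
which avoids a given subset of the interior. This replaces an appeal to the Jordan curve theorem. -/
theorem IsContour.exists_unbounded_avoiding {γ : ℝ → ℂ} (hγ : IsContour γ)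
    (hext : (curveExterior γ).Nonempty) {C : Set ℂ} (hC : C ⊆ curveInterior γ) {z : ℂ}
    (hz : z ∉ curveInterior γ) :
    ∃ T : Set ℂ, z ∈ T ∧ IsPreconnected T ∧ ¬ Bornology.IsBounded T ∧ Disjoint T C := by
  have hopen : IsOpen (curveTrace γ)ᶜ := hγ.isCompact_curveTrace.isClosed.isOpen_compl
  have hdis : ∀ e ∈ curveExterior γ,
      Disjoint (connectedComponentIn (curveTrace γ)ᶜ e) C := by
    intro e he
    rw [Set.disjoint_left]
    intro c hc hcC
    have h := (hC hcC).2
    rw [← connectedComponentIn_eq hc] at h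
    exact he.2 h
  by_cases hT : z ∈ curveTrace γ
  · obtain ⟨e, he⟩ := hext
    set K := connectedComponentIn (curveTrace γ)ᶜ e
    have hKsub : K ⊆ (curveTrace γ)ᶜ := connectedComponentIn_subset _ _
    have heK : e ∈ K := mem_connectedComponentIn he.1
    have hcl : closure K ⊆ K ∪ curveTrace γ := by
      intro y hy
      by_cases hyT : y ∈ curveTrace γ
      · exact Or.inr hyT
      · left
        obtain ⟨w, hw1, hw2⟩ := mem_closure_iff.1 hy _ (hopen.connectedComponentIn (x := y))
          (mem_connectedComponentIn hyT)
        have h1 := connectedComponentIn_eq hw1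
        have h2 := connectedComponentIn_eq hw2
        have h3 : y ∈ connectedComponentIn (curveTrace γ)ᶜ y := mem_connectedComponentIn hyT
        rw [h1, ← h2] at h3
        exact h3
    have hmeet : ∃ y, y ∈ closure K ∧ y ∈ curveTrace γ := by
      by_contra! h
      have hclosed : IsClosed K := by
        refine isClosed_of_closure_subset fun y hy => (hcl hy).resolve_right (h y hy)
      have huniv := IsClopen.eq_univ ⟨hclosed, hopen.connectedComponentIn⟩ ⟨e, heK⟩
      exact hKsub (huniv ▸ Set.mem_univ z) hT
    obtain ⟨y, hy1, hy2⟩ := hmeet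
    refine ⟨closure K ∪ curveTrace γ, Or.inr hT, ?_, ?_, ?_⟩
    · exact IsPreconnected.union y hy1 hy2 isPreconnected_connectedComponentIn.closure
        (isPreconnected_Icc.image _ hγ.continuousOn)
    · exact fun h => he.2 (h.subset (subset_closure.trans Set.subset_union_left))
    · rw [Set.disjoint_left]
      intro c hc hcC
      have hc' : c ∈ K ∪ curveTrace γ := hc.elim (fun h => hcl h) Or.inr
      rcases hc' with h | h
      · exact Set.disjoint_left.1 (hdis e he) h hcC
      · exact (hC hcC).1 h
  · have he := mem_exterior_of_notMem hz hT
    exact ⟨_, mem_connectedComponentIn hT, isPreconnected_connectedComponentIn, he.2, hdis z he⟩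

/-- If the interior of `γ` contains `q` times the curve `γ'`, then it contains `q` times all points
that are not exterior to `γ'`. -/
theorem IsContour.exterior_of_nested {γ γ' : ℝ → ℂ} (hγ : IsContour γ)
    (hext : (curveExterior γ).Nonempty) {q : ℂ} (hq : q ≠ 0)
    (hnest : ∀ w ∈ curveTrace γ', q * w ∈ curveInterior γ) {z : ℂ}
    (hz : q * z ∉ curveInterior γ) : z ∈ curveExterior γ' := by
  obtain ⟨T, hzT, hconn, hunb, hdis⟩ := hγ.exists_unbounded_avoiding hext
    (C := (fun w => q * w) '' curveTrace γ') (by rintro _ ⟨w, hw, rfl⟩; exact hnest w hw) hz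
  have hsub : (fun w => q⁻¹ * w) '' T ⊆ (curveTrace γ')ᶜ := by
    rintro _ ⟨t, ht, rfl⟩ hmem
    refine Set.disjoint_left.1 hdis ht ⟨_, hmem, ?_⟩
    simp [mul_inv_cancel_left₀ hq]
  have hzmem : z ∈ (fun w => q⁻¹ * w) '' T := ⟨_, hzT, by simp [inv_mul_cancel_left₀ hq]⟩
  refine ⟨hsub hzmem, fun hb => hunb ?_⟩
  have h1 := (hconn.image (fun w => q⁻¹ * w)
    (continuous_const.mul continuous_id).continuousOn).subset_connectedComponentIn hzmem hsub
  obtain ⟨R, hR⟩ := isBounded_iff_forall_norm_le.1 (hb.subset h1)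
  refine isBounded_iff_forall_norm_le.2 ⟨‖q‖ * R, fun t ht => ?_⟩
  have h2 := hR _ ⟨t, ht, rfl⟩
  calc ‖t‖ = ‖q‖ * ‖q⁻¹ * t‖ := by rw [← norm_mul, mul_inv_cancel_left₀ hq]
    _ ≤ ‖q‖ * R := mul_le_mul_of_nonneg_left h2 (norm_nonneg _)

theorem IsContour.interior_of_nested {γ γ' : ℝ → ℂ} (hγ : IsContour γ)
    (hext : (curveExterior γ).Nonempty) {q : ℂ} (hq : q ≠ 0)
    (hnest : ∀ w ∈ curveTrace γ', q * w ∈ curveInterior γ) {z : ℂ}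
    (hz : z ∈ curveInterior γ') : q * z ∈ curveInterior γ := by
  by_contra h
  exact curveInterior_disjoint_exterior hz (hγ.exterior_of_nested hext hq hnest h)

/-- The rational functions all of whose finite poles are exterior to `γ`; they may have a pole at
infinity. -/
def extAlgebra (γ : ℝ → ℂ) : Subalgebra ℂ (ℂ → ℂ) :=
  Algebra.adjoin ℂ (insert (fun u => u) {f | ∃ z ∈ curveExterior γ, f = fun u => (u - z)⁻¹})

theorem inv_sub_mem_extAlgebra {γ : ℝ → ℂ} {z : ℂ} (hz : z ∈ curveExterior γ) :
    (fun u => (u - z)⁻¹) ∈ extAlgebra γ :=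
  Algebra.subset_adjoin (Set.mem_insert_of_mem _ ⟨z, hz, rfl⟩)

theorem const_mem_extAlgebra (γ : ℝ → ℂ) (a : ℂ) : (fun _ => a) ∈ extAlgebra γ :=
  (extAlgebra γ).algebraMap_mem a

theorem IsContour.extAlgebra_monomial {γ : ℝ → ℂ} (hγ : IsContour γ) (a : ℕ) :
    ∀ m : Multiset ℂ, (∀ z ∈ m, z ∈ curveExterior γ) →
      contourIntegral γ (fun w => w ^ a * (m.map fun z => (w - z)⁻¹).prod) = 0 := by
  have hpow : ∀ b : ℕ, contourIntegral γ (fun w => w ^ b) = 0 := fun b =>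
    hγ.contourIntegral_deriv (F := fun w => ((b : ℂ) + 1)⁻¹ * w ^ (b + 1))
      (fun z _ => by
        refine ((hasDerivAt_pow (b + 1) z).const_mul _).congr_deriv ?_
        have : (b : ℂ) + 1 ≠ 0 := Nat.cast_add_one_ne_zero b
        push_cast
        exact inv_mul_cancel_left₀ this _)
      (continuous_pow b).continuousOn
  induction a with
  | zero =>
    intro m hm
    simp only [pow_zero, one_mul]
    have hc : m.card = 0 ∨ m.card = 1 ∨ ∃ n, m.card = n + 2 := by
      rcases m.card with _ | _ | n
      · simp
      · simp
      · exact Or.inr (Or.inr ⟨n, rfl⟩)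
    rcases hc with h | h | ⟨n, h⟩
    · rw [Multiset.card_eq_zero.1 h]
      simpa using hpow 0
    · obtain ⟨z, rfl⟩ := Multiset.card_eq_one.1 h
      have := hγ.windingNumber_exterior (hm z (by simp))
      rw [windingNumber] at this
      simpa using this
    · exact hγ.contourIntegral_prod_inv_sub 0 n m h (fun z hz => (hm z hz).1)
        fun z hz => hγ.windingNumber_exterior (hm z hz)
  | succ a ih =>
    intro m hm
    rcases m.empty_or_exists_mem with rfl | ⟨z, hz⟩
    · simpa using hpow (a + 1)
    · obtain ⟨t, rfl⟩ := Multiset.exists_cons_of_mem hz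
      have ht : ∀ y ∈ t, y ∈ curveExterior γ := fun y hy => hm y (Multiset.mem_cons_of_mem hy)
      have hcont : ∀ m : Multiset ℂ, (∀ z ∈ m, z ∈ curveExterior γ) →
          ContinuousOn (fun w => w ^ a * (m.map fun z => (w - z)⁻¹).prod) (curveTrace γ) :=
        fun m hm => (continuous_pow a).continuousOn.mul
          (continuousOn_prod_inv_sub m fun z hz => (hm z hz).1)
      have e : contourIntegral γ
          (fun w => w ^ (a + 1) * ((z ::ₘ t).map fun z => (w - z)⁻¹).prod) =
          contourIntegral γ (fun w => 1 * (w ^ a * (t.map fun z => (w - z)⁻¹).prod) +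
            z * (w ^ a * ((z ::ₘ t).map fun z => (w - z)⁻¹).prod)) := by
        refine contourIntegral_congr fun w hw => ?_
        have h1 : w - z ≠ 0 := sub_ne_zero.2 fun h => (hm z hz).1 (h ▸ hw)
        simp only [Multiset.map_cons, Multiset.prod_cons]
        field_simp
        ring
      rw [e, hγ.contourIntegral_linear _ _ (hcont t ht) (hcont _ hm), ih t ht, ih _ hm]
      ring

/-- Cauchy's theorem for rational functions with exterior poles. -/
theorem IsContour.extAlgebra_integral {γ : ℝ → ℂ} (hγ : IsContour γ) {f : ℂ → ℂ}
    (hf : f ∈ extAlgebra γ) : ContinuousOn f (curveTrace γ) ∧ contourIntegral γ f = 0 := by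
  have hmono : ∀ M ∈ Submonoid.closure
      (insert (fun u => u) {f | ∃ z ∈ curveExterior γ, f = fun u : ℂ => (u - z)⁻¹}),
      ∃ (a : ℕ) (m : Multiset ℂ), (∀ z ∈ m, z ∈ curveExterior γ) ∧
        M = fun w => w ^ a * (m.map fun z => (w - z)⁻¹).prod := by
    intro M hM
    induction hM using Submonoid.closure_induction with
    | mem M hM =>
      rcases hM with rfl | ⟨z, hz, rfl⟩
      · exact ⟨1, 0, by simp, by simp⟩
      · exact ⟨0, {z}, by simpa using hz, by simp⟩
    | one => exact ⟨0, 0, by simp, by funext w; simp⟩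
    | mul M M' _ _ h h' =>
      obtain ⟨a, m, hm, rfl⟩ := h
      obtain ⟨a', m', hm', rfl⟩ := h'
      refine ⟨a + a', m + m', fun z hz => (Multiset.mem_add.1 hz).elim (hm z) (hm' z), ?_⟩
      funext w
      simp only [Pi.mul_apply, Multiset.map_add, Multiset.prod_add]
      ring
  have hf' : f ∈ Submodule.span ℂ (Submonoid.closure
      (insert (fun u => u) {f | ∃ z ∈ curveExterior γ, f = fun u : ℂ => (u - z)⁻¹}) :
        Set (ℂ → ℂ)) := by
    rw [← Algebra.adjoin_eq_span]
    exact hf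
  clear hf
  induction hf' using Submodule.span_induction with
  | mem M hM =>
    obtain ⟨a, m, hm, rfl⟩ := hmono M hM
    exact ⟨(continuous_pow a).continuousOn.mul
      (continuousOn_prod_inv_sub m fun z hz => (hm z hz).1), hγ.extAlgebra_monomial a m hm⟩
  | zero => exact ⟨continuousOn_const, contourIntegral_zero γ⟩
  | add f g _ _ h1 h2 =>
    exact ⟨h1.1.add h2.1, (hγ.contourIntegral_add h1.1 h2.1).trans (by rw [h1.2, h2.2, add_zero])⟩
  | smul a f _ h1 =>
    exact ⟨continuousOn_const.mul h1.1, (contourIntegral_const_mul γ a f).trans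
      (by rw [h1.2, mul_zero])⟩

theorem extAlgebra_divided_difference {γ : ℝ → ℂ} {p : ℂ} (hp : p ∉ curveExterior γ) {f : ℂ → ℂ}
    (hf : f ∈ extAlgebra γ) :
    ∃ g ∈ extAlgebra γ, ∀ u ∉ curveExterior γ, f u = f p + (u - p) * g u := by
  induction hf using Algebra.adjoin_induction with
  | mem f hf =>
    rcases hf with rfl | ⟨z, hz, rfl⟩
    · exact ⟨1, one_mem _, fun u _ => by simp⟩
    · refine ⟨(fun _ => -(p - z)⁻¹) * fun u => (u - z)⁻¹,
        mul_mem (const_mem_extAlgebra γ _) (inv_sub_mem_extAlgebra hz), fun u hu => ?_⟩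
      have h1 : u - z ≠ 0 := sub_ne_zero.2 fun h => hu (h ▸ hz)
      have h2 : p - z ≠ 0 := sub_ne_zero.2 fun h => hp (h ▸ hz)
      simp only [Pi.mul_apply]
      field_simp
      ring
  | algebraMap a => exact ⟨0, zero_mem _, fun u _ => by simp⟩
  | add f g _ _ h1 h2 =>
    obtain ⟨f', hf', h1⟩ := h1
    obtain ⟨g', hg', h2⟩ := h2
    refine ⟨f' + g', add_mem hf' hg', fun u hu => ?_⟩
    simp only [Pi.add_apply]
    rw [h1 u hu, h2 u hu]
    ring
  | mul f g _ hg h1 h2 =>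
    obtain ⟨f', hf', h1⟩ := h1
    obtain ⟨g', hg', h2⟩ := h2
    refine ⟨f' * g + (fun _ => f p) * g', add_mem (mul_mem hf' hg)
      (mul_mem (const_mem_extAlgebra γ _) hg'), fun u hu => ?_⟩
    simp only [Pi.add_apply, Pi.mul_apply]
    rw [h1 u hu, h2 u hu]
    ring

/-- Cauchy's integral formula for rational functions with exterior poles. -/
theorem IsContour.extAlgebra_cauchy {γ : ℝ → ℂ} (hγ : IsContour γ) {p : ℂ}
    (hp : p ∈ curveInterior γ) {f : ℂ → ℂ} (hf : f ∈ extAlgebra γ) :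
    contourIntegral γ (fun u => f u * (u - p)⁻¹) = f p := by
  obtain ⟨g, hg, h⟩ := extAlgebra_divided_difference (curveInterior_disjoint_exterior hp) hf
  have hg' := hγ.extAlgebra_integral hg
  have e : contourIntegral γ (fun u => f u * (u - p)⁻¹) =
      contourIntegral γ (fun u => f p * (u - p)⁻¹ + 1 * g u) := by
    refine contourIntegral_congr fun u hu => ?_
    have h1 : u - p ≠ 0 := sub_ne_zero.2 fun h => hp.1 (h ▸ hu)
    rw [h u fun hx => hx.1 hu]
    field_simp
  have h1 := hγ.windingNumber_interior hp
  rw [windingNumber] at h1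
  rw [e, hγ.contourIntegral_linear _ _ (continuousOn_inv_sub hp.1) hg'.1, hg'.2, h1]
  ring

/-- The functions which agree on `T` with an element of the algebra `A`. -/
def AgreesIn (A : Subalgebra ℂ (ℂ → ℂ)) (T : Set ℂ) (f : ℂ → ℂ) : Prop := ∃ g ∈ A, Set.EqOn f g T

section AgreesIn

variable {A : Subalgebra ℂ (ℂ → ℂ)} {T : Set ℂ}

theorem AgreesIn.const (A : Subalgebra ℂ (ℂ → ℂ)) (T : Set ℂ) (a : ℂ) : AgreesIn A T fun _ => a :=
  ⟨algebraMap ℂ (ℂ → ℂ) a, A.algebraMap_mem _, fun _ _ => rfl⟩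

theorem AgreesIn.mul {f g : ℂ → ℂ} (hf : AgreesIn A T f) (hg : AgreesIn A T g) :
    AgreesIn A T fun u => f u * g u := by
  obtain ⟨f', hf', h1⟩ := hf
  obtain ⟨g', hg', h2⟩ := hg
  exact ⟨f' * g', mul_mem hf' hg', fun u hu => by simp only [Pi.mul_apply, h1 hu, h2 hu]⟩

theorem AgreesIn.prod {ι : Type*} (S : Finset ι) {f : ι → ℂ → ℂ}
    (hf : ∀ i ∈ S, AgreesIn A T (f i)) : AgreesIn A T fun u => ∏ i ∈ S, f i u := by
  classical
  induction S using Finset.induction_on with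
  | empty => simpa using AgreesIn.const A T 1
  | insert i S hi ih =>
    simp only [Finset.prod_insert hi]
    exact (hf i (Finset.mem_insert_self _ _)).mul
      (ih fun j hj => hf j (Finset.mem_insert_of_mem hj))

theorem AgreesIn.linear_div {z : ℂ} (hA : (fun u => (u - z)⁻¹) ∈ A) (hz : z ∉ T) (a b : ℂ) {c : ℂ}
    (hc : c ≠ 0) {d : ℂ} (hd : d = c * z) : AgreesIn A T fun u => (a * u + b) / (c * u - d) := by
  refine ⟨algebraMap ℂ (ℂ → ℂ) (a / c) + algebraMap ℂ (ℂ → ℂ) ((a * z + b) / c) *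
    fun u => (u - z)⁻¹, add_mem (A.algebraMap_mem _) (mul_mem (A.algebraMap_mem _) hA),
    fun u hu => ?_⟩
  have h1 : u - z ≠ 0 := sub_ne_zero.2 fun h => hz (h ▸ hu)
  have h2 : c * u - d = c * (u - z) := by rw [hd]; ring
  simp only [Pi.add_apply, Pi.mul_apply, Pi.algebraMap_apply, Algebra.algebraMap_self,
    RingHom.id_apply]
  rw [h2]
  field_simp
  ring

end AgreesIn

/-- The functions which agree off the exterior of `γ` with a rational function that has all its
poles in the exterior. -/
abbrev ExtRegular (γ : ℝ → ℂ) (f : ℂ → ℂ) : Prop := AgreesIn (extAlgebra γ) (curveExterior γ)ᶜ f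

theorem ExtRegular.linear_div {γ : ℝ → ℂ} {z : ℂ} (hz : z ∈ curveExterior γ) (a b : ℂ) {c : ℂ}
    (hc : c ≠ 0) {d : ℂ} (hd : d = c * z) : ExtRegular γ fun u => (a * u + b) / (c * u - d) :=
  AgreesIn.linear_div (inv_sub_mem_extAlgebra hz) (Set.notMem_compl_iff.2 hz) a b hc hd

theorem ExtRegular.integral_eq_zero {γ : ℝ → ℂ} (hγ : IsContour γ) {f : ℂ → ℂ}
    (hf : ExtRegular γ f) : contourIntegral γ f = 0 := by
  obtain ⟨g, hg, h⟩ := hf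
  rw [contourIntegral_congr fun u hu => h fun hu' => hu'.1 hu]
  exact (hγ.extAlgebra_integral hg).2

theorem ExtRegular.cauchy {γ : ℝ → ℂ} (hγ : IsContour γ) {p : ℂ} (hp : p ∈ curveInterior γ)
    {f : ℂ → ℂ} (hf : ExtRegular γ f) : contourIntegral γ (fun u => f u * (u - p)⁻¹) = f p := by
  obtain ⟨g, hg, h⟩ := hf
  rw [h (curveInterior_disjoint_exterior hp), ← hγ.extAlgebra_cauchy hp hg]
  exact contourIntegral_congr fun u hu => by simp only [h fun hu' => hu'.1 hu]

/-- The rational functions which are bounded at infinity and have all their poles in the interior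
of `γ`. -/
def intAlgebra (γ : ℝ → ℂ) : Subalgebra ℂ (ℂ → ℂ) :=
  Algebra.adjoin ℂ {f : ℂ → ℂ | ∃ z ∈ curveInterior γ, f = fun u => (u - z)⁻¹}

/-- The functions which agree on `γ` with an element of `intAlgebra γ`. -/
abbrev IntRegular (γ : ℝ → ℂ) (f : ℂ → ℂ) : Prop := AgreesIn (intAlgebra γ) (curveTrace γ) f

theorem IntRegular.linear_div {γ : ℝ → ℂ} {z : ℂ} (hz : z ∈ curveInterior γ) (a b : ℂ) {c : ℂ}
    (hc : c ≠ 0) {d : ℂ} (hd : d = c * z) : IntRegular γ fun u => (a * u + b) / (c * u - d) :=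
  AgreesIn.linear_div (A := intAlgebra γ) (Algebra.subset_adjoin ⟨z, hz, rfl⟩) hz.1 a b hc hd

/-- The integral of a rational function which has only interior poles and decays quadratically
vanishes. -/
theorem IntRegular.integral_eq_zero {γ : ℝ → ℂ} (hγ : IsContour γ) {f : ℂ → ℂ}
    (hf : IntRegular γ f) {z z' : ℂ} (hz : z ∈ curveInterior γ) (hz' : z' ∈ curveInterior γ) :
    contourIntegral γ (fun u => f u * ((u - z)⁻¹ * (u - z')⁻¹)) = 0 := by
  obtain ⟨g, hg, hfg⟩ := hf
  have hcont2 : ContinuousOn (fun u => (u - z)⁻¹ * (u - z')⁻¹) (curveTrace γ) :=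
    (continuousOn_inv_sub hz.1).mul (continuousOn_inv_sub hz'.1)
  have hmono : ∀ M ∈ Submonoid.closure {f : ℂ → ℂ | ∃ z ∈ curveInterior γ, f = fun u => (u - z)⁻¹},
      ∃ m : Multiset ℂ, (∀ z ∈ m, z ∈ curveInterior γ) ∧
        M = fun w => (m.map fun z => (w - z)⁻¹).prod := by
    intro M hM
    induction hM using Submonoid.closure_induction with
    | mem M hM =>
      obtain ⟨z, hz, rfl⟩ := hM
      exact ⟨{z}, by simpa using hz, by simp⟩
    | one => exact ⟨0, by simp, by funext w; simp⟩
    | mul M M' _ _ h h' =>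
      obtain ⟨m, hm, rfl⟩ := h
      obtain ⟨m', hm', rfl⟩ := h'
      refine ⟨m + m', fun z hz => (Multiset.mem_add.1 hz).elim (hm z) (hm' z), ?_⟩
      funext w
      simp only [Pi.mul_apply, Multiset.map_add, Multiset.prod_add]
  have e : contourIntegral γ (fun u => f u * ((u - z)⁻¹ * (u - z')⁻¹)) =
      contourIntegral γ (fun u => g u * ((u - z)⁻¹ * (u - z')⁻¹)) :=
    contourIntegral_congr fun u hu => by simp only [hfg hu]
  rw [e]
  clear e hfg
  suffices h : ContinuousOn g (curveTrace γ) ∧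
      contourIntegral γ (fun u => g u * ((u - z)⁻¹ * (u - z')⁻¹)) = 0 from h.2
  rw [← Subalgebra.mem_toSubmodule, intAlgebra, Algebra.adjoin_eq_span] at hg
  induction hg using Submodule.span_induction with
  | mem M hM =>
    obtain ⟨m, hm, rfl⟩ := hmono M hM
    refine ⟨continuousOn_prod_inv_sub m fun z hz => (hm z hz).1, ?_⟩
    have hall : ∀ y ∈ z ::ₘ z' ::ₘ m, y ∈ curveInterior γ := by
      intro y hy
      rw [Multiset.mem_cons, Multiset.mem_cons] at hy
      rcases hy with rfl | rfl | hy
      · exact hz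
      · exact hz'
      · exact hm y hy
    have h := hγ.contourIntegral_prod_inv_sub 1 m.card (z ::ₘ z' ::ₘ m) (by simp)
      (fun y hy => (hall y hy).1) (fun y hy => hγ.windingNumber_interior (hall y hy))
    rw [← h]
    refine contourIntegral_congr fun u _ => ?_
    simp only [Multiset.map_cons, Multiset.prod_cons]
    ring
  | zero =>
    refine ⟨continuousOn_const, ?_⟩
    simpa using contourIntegral_zero γ
  | add f g _ _ h1 h2 =>
    refine ⟨h1.1.add h2.1, ?_⟩
    have := hγ.contourIntegral_linear 1 1 (h1.1.mul hcont2) (h2.1.mul hcont2)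
    rw [show (contourIntegral γ ((fun u => f u) * fun u => (u - z)⁻¹ * (u - z')⁻¹)) = 0 from h1.2,
      show (contourIntegral γ ((fun u => g u) * fun u => (u - z)⁻¹ * (u - z')⁻¹)) = 0 from h2.2]
      at this
    rw [show (0 : ℂ) = 1 * 0 + 1 * 0 by ring, ← this]
    refine contourIntegral_congr fun u _ => ?_
    simp only [Pi.add_apply, Pi.mul_apply]
    ring
  | smul a f _ h1 =>
    refine ⟨continuousOn_const.mul h1.1, ?_⟩
    have := contourIntegral_const_mul γ a (fun u => f u * ((u - z)⁻¹ * (u - z')⁻¹))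
    rw [h1.2, mul_zero] at this
    rw [← this]
    refine contourIntegral_congr fun u _ => ?_
    simp only [Pi.smul_apply, smul_eq_mul]
    ring

end

/-! ### Iterated contour integrals -/

noncomputable section

open MeasureTheory Set

/-- Lebesgue measure on the unit interval. -/
def unitMeasure : Measure ℝ := volume.restrict (Ioc 0 1)

instance : SigmaFinite unitMeasure := by unfold unitMeasure; infer_instance

/-- Lebesgue measure on the unit cube. -/
def cubeMeasure (k : ℕ) : Measure (Fin k → ℝ) := Measure.pi fun _ => unitMeasure

instance (k : ℕ) : SigmaFinite (cubeMeasure k) := by unfold cubeMeasure; infer_instance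

/-- The integrand of an iterated contour integral, pulled back to the parameters of the curves. -/
def pullback {k : ℕ} (γ : Fin k → ℝ → ℂ) (f : (Fin k → ℂ) → ℂ) (t : Fin k → ℝ) : ℂ :=
  f (fun i => γ i (t i)) * ∏ i, deriv (γ i) (t i)

/-- The product of the curves. -/
def traceSet {k : ℕ} (γ : Fin k → ℝ → ℂ) : Set (Fin k → ℂ) := {u | ∀ i, u i ∈ curveTrace (γ i)}

theorem contourIntegral_eq (γ : ℝ → ℂ) (f : ℂ → ℂ) : contourIntegral γ f =
    (2 * (Real.pi : ℂ) * Complex.I)⁻¹ * ∫ t, f (γ t) * deriv γ t ∂unitMeasure := by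
  rw [contourIntegral, intervalIntegral.integral_of_le zero_le_one]
  rfl

theorem ae_cubeMeasure (k : ℕ) : ∀ᵐ t ∂cubeMeasure k, ∀ i, t i ∈ Icc (0 : ℝ) 1 := by
  have h : cubeMeasure k = (Measure.pi fun _ : Fin k => (volume : Measure ℝ)).restrict
      (Set.univ.pi fun _ => Ioc 0 1) := (Measure.restrict_pi_pi _ _).symm
  rw [h]
  filter_upwards [ae_restrict_mem (MeasurableSet.univ_pi fun _ => measurableSet_Ioc)] with t ht i
  exact Ioc_subset_Icc_self (ht i (mem_univ i))

theorem integrable_pullback {k : ℕ} {γ : Fin k → ℝ → ℂ} (hγ : ∀ i, IsContour (γ i))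
    {f : (Fin k → ℂ) → ℂ} (hf : ContinuousOn f (traceSet γ)) :
    Integrable (pullback γ f) (cubeMeasure k) := by
  have h1 : Integrable (fun t : Fin k → ℝ => ∏ i, deriv (γ i) (t i)) (cubeMeasure k) := by
    refine Integrable.fintype_prod (f := fun i => deriv (γ i)) fun i => ?_
    have := (hγ i).intervalIntegrable_deriv
    rwa [intervalIntegrable_iff_integrableOn_Ioc_of_le zero_le_one] at this
  have hc : ContinuousOn (fun t : Fin k → ℝ => f fun i => γ i (t i))
      (Set.univ.pi fun _ => Icc (0 : ℝ) 1) := by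
    refine hf.comp (continuousOn_pi.2 fun i => ?_) fun t ht i => ⟨t i, ht i (mem_univ i), rfl⟩
    exact (hγ i).continuousOn.comp (continuous_apply i).continuousOn fun t ht => ht i (mem_univ i)
  have hcomp : IsCompact (Set.univ.pi fun _ : Fin k => Icc (0 : ℝ) 1) :=
    isCompact_univ_pi fun _ => isCompact_Icc
  obtain ⟨C, hC⟩ := hcomp.exists_bound_of_continuousOn hc
  refine h1.bdd_mul (c := C) ?_ ?_
  · have hm : MeasurableSet (Set.univ.pi fun _ : Fin k => Icc (0 : ℝ) 1) :=
      MeasurableSet.univ_pi fun _ => measurableSet_Icc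
    have := hc.aestronglyMeasurable (μ := cubeMeasure k) hm
    rwa [Measure.restrict_eq_self_of_ae_mem] at this
    filter_upwards [ae_cubeMeasure k] with t ht i _ using ht i
  · filter_upwards [ae_cubeMeasure k] with t ht
    exact hC t fun i _ => ht i

theorem measurePreserving_insertNth {k : ℕ} (i : Fin (k + 1)) :
    MeasurePreserving (MeasurableEquiv.piFinSuccAbove (fun _ => ℝ) i).symm
      (unitMeasure.prod (cubeMeasure k)) (cubeMeasure (k + 1)) :=
  (measurePreserving_piFinSuccAbove (fun _ => unitMeasure) i).symm

theorem pullback_insertNth {k : ℕ} (γ : Fin (k + 1) → ℝ → ℂ) (f : (Fin (k + 1) → ℂ) → ℂ)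
    (i : Fin (k + 1)) (p : ℝ × (Fin k → ℝ)) :
    pullback γ f ((MeasurableEquiv.piFinSuccAbove (fun _ => ℝ) i).symm p) =
      f (i.insertNth (γ i p.1) fun j => γ (i.succAbove j) (p.2 j)) * deriv (γ i) p.1 *
        ∏ j, deriv (γ (i.succAbove j)) (p.2 j) := by
  have h : (MeasurableEquiv.piFinSuccAbove (fun _ => ℝ) i).symm p =
      i.insertNth (α := fun _ => ℝ) p.1 p.2 := rfl
  rw [h, pullback, Fin.prod_univ_succAbove _ i, ← mul_assoc]
  simp only [Fin.insertNth_apply_same, Fin.insertNth_apply_succAbove]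
  congr 3
  funext j
  induction j using i.succAboveCases with
  | x => simp
  | p j => simp

/-- Iterated contour integrals are integrals over the unit cube. -/
theorem nestedIntegral_eq (k : ℕ) : ∀ (γ : Fin k → ℝ → ℂ) (f : (Fin k → ℂ) → ℂ),
    Integrable (pullback γ f) (cubeMeasure k) →
    nestedIntegral k γ f =
      ((2 * (Real.pi : ℂ) * Complex.I)⁻¹) ^ k * ∫ t, pullback γ f t ∂cubeMeasure k := by
  induction k with
  | zero =>
    intro γ f _
    rw [cubeMeasure, Measure.pi_of_empty _ Fin.elim0, integral_dirac, pullback]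
    simp only [pow_zero, one_mul, Finset.univ_eq_empty, Finset.prod_empty, mul_one, nestedIntegral]
    congr 1
    exact Subsingleton.elim _ _
  | succ k ih =>
    intro γ f hf
    have hmp := measurePreserving_insertNth (k := k) 0
    have hint := (hmp.integrable_comp_emb (MeasurableEquiv.measurableEmbedding _)).2 hf
    have hval := hmp.integral_comp (MeasurableEquiv.measurableEmbedding _) (pullback γ f)
    rw [← hval]
    have hint' := integral_prod _ hint
    simp only [Function.comp_apply] at hint'
    rw [hint', nestedIntegral, contourIntegral_eq]
    generalize (2 * (Real.pi : ℂ) * Complex.I)⁻¹ = a at ih ⊢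
    rw [pow_succ', mul_assoc]
    congr 1
    rw [← integral_const_mul]
    refine integral_congr_ae ?_
    filter_upwards [hint.prod_right_ae] with t ht
    simp only [Function.comp_apply, pullback_insertNth] at ht ⊢
    have he : ∀ t' : Fin k → ℝ, f (Fin.insertNth 0 (γ 0 t)
        fun j => γ (Fin.succAbove 0 j) (t' j)) * deriv (γ 0) t *
          ∏ j, deriv (γ (Fin.succAbove 0 j)) (t' j) =
        deriv (γ 0) t * pullback (fun i => γ i.succ) (fun u => f (Fin.cons (γ 0 t) u)) t' := by
      intro t'
      rw [pullback, Fin.insertNth_zero']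
      simp only [Fin.zero_succAbove]
      ring
    simp only [he] at ht ⊢
    rw [integral_const_mul]
    -- Where the derivative vanishes, the section of `f` need not be integrable.
    by_cases h0 : deriv (γ 0) t = 0
    · rw [h0]; ring
    · rw [ih]
      · ring
      · have h2 := ht.const_mul (deriv (γ 0) t)⁻¹
        simpa only [inv_mul_cancel_left₀ h0] using h2

/-- If the integral over one of the variables vanishes for all values of the other ones on their
curves, then so does the iterated integral. -/
theorem nestedIntegral_eq_zero {k : ℕ} {γ : Fin (k + 1) → ℝ → ℂ} (hγ : ∀ i, IsContour (γ i))
    {f : (Fin (k + 1) → ℂ) → ℂ} (hf : ContinuousOn f (traceSet γ)) (i : Fin (k + 1))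
    (h : ∀ u : Fin k → ℂ, (∀ j, u j ∈ curveTrace (γ (i.succAbove j))) →
      contourIntegral (γ i) (fun z => f (i.insertNth z u)) = 0) :
    nestedIntegral (k + 1) γ f = 0 := by
  have hI := integrable_pullback hγ hf
  rw [nestedIntegral_eq _ γ f hI]
  have hmp := measurePreserving_insertNth (k := k) i
  have hint := (hmp.integrable_comp_emb (MeasurableEquiv.measurableEmbedding _)).2 hI
  rw [← hmp.integral_comp (MeasurableEquiv.measurableEmbedding _) (pullback γ f)]
  have hint' := integral_prod_symm _ hint
  simp only [Function.comp_apply] at hint'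
  rw [hint', integral_eq_zero_of_ae, mul_zero]
  filter_upwards [ae_cubeMeasure k] with t ht
  simp only [pullback_insertNth, Pi.zero_apply]
  rw [integral_mul_const]
  have h1 := h (fun j => γ (i.succAbove j) (t j)) fun j => ⟨t j, ht j, rfl⟩
  rw [contourIntegral_eq] at h1
  have h2 : (2 * (Real.pi : ℂ) * Complex.I)⁻¹ ≠ 0 := inv_ne_zero Complex.two_pi_I_ne_zero
  rw [(mul_eq_zero.1 h1).resolve_left h2, zero_mul]

theorem nestedIntegral_congr (k : ℕ) : ∀ (γ : Fin k → ℝ → ℂ) {f g : (Fin k → ℂ) → ℂ},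
    EqOn f g (traceSet γ) → nestedIntegral k γ f = nestedIntegral k γ g := by
  induction k with
  | zero => intro γ f g h; exact h fun i => i.elim0
  | succ k ih =>
    intro γ f g h
    refine contourIntegral_congr fun z hz => ih _ fun u hu => h fun i => ?_
    induction i using Fin.cases with
    | zero => exact hz
    | succ i => exact hu i

theorem nestedIntegral_const_mul (k : ℕ) : ∀ (γ : Fin k → ℝ → ℂ) (c : ℂ) (f : (Fin k → ℂ) → ℂ),
    nestedIntegral k γ (fun u => c * f u) = c * nestedIntegral k γ f := by
  induction k with
  | zero => intro γ c f; rfl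
  | succ k ih =>
    intro γ c f
    simp only [nestedIntegral, ih]
    exact contourIntegral_const_mul _ _ _

theorem nestedIntegral_sum {k : ℕ} {γ : Fin k → ℝ → ℂ} (hγ : ∀ i, IsContour (γ i)) {ι : Type*}
    (S : Finset ι) {f : ι → (Fin k → ℂ) → ℂ} (hf : ∀ i ∈ S, ContinuousOn (f i) (traceSet γ)) :
    nestedIntegral k γ (fun u => ∑ i ∈ S, f i u) = ∑ i ∈ S, nestedIntegral k γ (f i) := by
  rw [nestedIntegral_eq _ γ _ (integrable_pullback hγ (continuousOn_finsetSum S hf))]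
  have h : ∀ t, pullback γ (fun u => ∑ i ∈ S, f i u) t = ∑ i ∈ S, pullback γ (f i) t := by
    intro t
    simp only [pullback, Finset.sum_mul]
  simp only [h]
  rw [integral_finsetSum S fun i hi => integrable_pullback hγ (hf i hi), Finset.mul_sum]
  exact Finset.sum_congr rfl fun i hi =>
    (nestedIntegral_eq _ γ _ (integrable_pullback hγ (hf i hi))).symm

/-- An iterated integral over a single contour does not depend on the order of the variables. -/
theorem nestedIntegral_comp_perm {k : ℕ} {γ : ℝ → ℂ} (hγ : IsContour γ) {f : (Fin k → ℂ) → ℂ}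
    (hf : ContinuousOn f (traceSet fun _ : Fin k => γ)) (σ : Equiv.Perm (Fin k)) :
    nestedIntegral k (fun _ => γ) (fun u => f fun i => u (σ i)) =
      nestedIntegral k (fun _ => γ) f := by
  have hf' : ContinuousOn (fun u : Fin k → ℂ => f fun i => u (σ i))
      (traceSet fun _ : Fin k => γ) := by
    refine hf.comp (continuous_pi fun i => continuous_apply (σ i)).continuousOn ?_
    exact fun u hu i => hu (σ i)
  rw [nestedIntegral_eq _ _ _ (integrable_pullback (fun _ => hγ) hf'),
    nestedIntegral_eq _ _ _ (integrable_pullback (fun _ => hγ) hf)]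
  congr 1
  have hmp : MeasurePreserving (MeasurableEquiv.piCongrLeft (fun _ => ℝ) σ.symm)
      (cubeMeasure k) (cubeMeasure k) :=
    measurePreserving_piCongrLeft (fun _ : Fin k => unitMeasure) σ.symm
  rw [← hmp.integral_comp (MeasurableEquiv.measurableEmbedding _) (pullback (fun _ => γ) f)]
  refine integral_congr_ae (Filter.Eventually.of_forall fun t => ?_)
  have h : ∀ i, MeasurableEquiv.piCongrLeft (fun _ => ℝ) σ.symm t i = t (σ i) := by
    intro i
    have := Equiv.piCongrLeft_apply_apply (fun _ : Fin k => ℝ) σ.symm t (σ i)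
    rwa [Equiv.symm_apply_apply] at this
  simp only [pullback, h]
  congr 1
  exact (Equiv.prod_comp σ fun i => deriv γ (t i)).symm

/-- The innermost integral of an iterated integral. -/
theorem nestedIntegral_succ_last (k : ℕ) : ∀ (γ : Fin (k + 1) → ℝ → ℂ)
    (f : (Fin (k + 1) → ℂ) → ℂ), nestedIntegral (k + 1) γ f =
      nestedIntegral k (fun i => γ i.castSucc) fun u =>
        contourIntegral (γ (Fin.last k)) fun z => f (Fin.snoc (α := fun _ => ℂ) u z) := by
  induction k with
  | zero =>
    intro γ f
    simp only [nestedIntegral]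
    congr 1
    funext z
    congr 1
    funext i
    rw [Subsingleton.elim (α := Fin 1) i 0]
    rfl
  | succ k ih =>
    intro γ f
    refine congrArg (contourIntegral (γ 0)) (funext fun z => ?_)
    rw [ih]
    simp only [Fin.cons_snoc_eq_snoc_cons]
    rfl

theorem contourIntegral_congr_off_finset {γ : ℝ → ℂ} (hγ : IsContour γ) (F : Finset ℂ)
    {f g : ℂ → ℂ} (h : ∀ u ∈ curveTrace γ, u ∉ F → f u = g u) :
    contourIntegral γ f = contourIntegral γ g := by
  have hfin : (Ico (0 : ℝ) 1 ∩ γ ⁻¹' F).Finite :=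
    Set.Finite.of_injOn (f := γ) (fun t ht => ht.2) (hγ.simple.mono inter_subset_left) F.finite_toSet
  rw [contourIntegral_eq, contourIntegral_eq, integral_congr_ae]
  have h1 : ∀ᵐ t : ℝ, t ∉ Ico (0 : ℝ) 1 ∩ γ ⁻¹' F :=
    measure_eq_zero_iff_ae_notMem.1 (hfin.measure_zero volume)
  have h2 : ∀ᵐ t : ℝ, t ∉ ({1} : Set ℝ) :=
    measure_eq_zero_iff_ae_notMem.1 (measure_singleton 1)
  filter_upwards [ae_restrict_of_ae h1, ae_restrict_of_ae h2,
    ae_restrict_mem measurableSet_Ioc] with t ht1 ht2 ht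
  rw [h _ ⟨t, Ioc_subset_Icc_self ht, rfl⟩ fun hF => ht1 ⟨⟨ht.1.le, lt_of_le_of_ne ht.2 ht2⟩, hF⟩]

/-- The integrand may be changed where two variables coincide, or where some of them lies in a
given finite set. -/
theorem nestedIntegral_congr_of_injective (k : ℕ) : ∀ {γ : Fin k → ℝ → ℂ}
    (_ : ∀ i, IsContour (γ i)) (F : Finset ℂ) {f g : (Fin k → ℂ) → ℂ}
    (_ : ∀ u ∈ traceSet γ, Function.Injective u → (∀ i, u i ∉ F) → f u = g u),
    nestedIntegral k γ f = nestedIntegral k γ g := by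
  induction k with
  | zero =>
    intro γ _ F f g h
    exact h _ (fun i => i.elim0) (fun i => i.elim0) fun i => i.elim0
  | succ k ih =>
    intro γ hγ F f g h
    refine contourIntegral_congr_off_finset (hγ 0) F fun z hz hzF =>
      ih (fun i => hγ i.succ) (insert z F) fun u hu hinj huF => h _ ?_ ?_ ?_
    · intro i
      induction i using Fin.cases with
      | zero => exact hz
      | succ i => exact hu i
    · rw [Fin.cons_injective_iff]
      exact ⟨fun ⟨i, hi⟩ => huF i (hi ▸ Finset.mem_insert_self _ _), hinj⟩
    · intro i
      induction i using Fin.cases with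
      | zero => exact hzF
      | succ i => exact fun hF => huF i (Finset.mem_insert_of_mem hF)

end

/-! ### The integrand over nested contours -/

noncomputable section

variable {q : ℂ} {ξ s : ℕ → ℂ}

/-- The factor of the integrand coming from two variables `x`, `y`, in this order, of colours `a`
and `b`. It has no pole when `b < a`. -/
def pairKernel (q : ℂ) (a b : ℕ) (x y : ℂ) : ℂ :=
  if b < a then 1 else if a = b then (x - y) / (x - q * y) else (q * x - y) / (x - q * y)

/-- The product of the factors `pairKernel` over all pairs of variables. -/
def wordKernel (q : ℂ) {k : ℕ} (c : Fin k → ℕ) (u : Fin k → ℂ) : ℂ :=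
  ∏ α, ∏ β ∈ Finset.Ioi α, pairKernel q (c α) (c β) (u α) (u β)

theorem kernel_mul_wordWeight {k : ℕ} {u : Fin k → ℂ} (hinj : Function.Injective u)
    (hq : ∀ α β, α < β → u α - q * u β ≠ 0) (c : Fin k → ℕ) :
    (∏ α, ∏ β ∈ Finset.Ioi α, (u α - u β) / (u α - q * u β)) *
        wordWeight q ξ s u 0 Finset.univ c =
      wordKernel q c u * ∏ i, pathFactor ξ s 0 (c i) (u i) := by
  -- Each pair of indices contributes at most one of the factors `h(u i, u j)` and `h(u j, u i)`.
  have h1 : ∏ i, ∏ j ∈ Finset.univ.filter (fun j => c i < c j), pairFactor q (u i) (u j) =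
      ∏ i, ∏ j ∈ Finset.Ioi i, ((if c i < c j then pairFactor q (u i) (u j) else 1) *
        if c j < c i then pairFactor q (u j) (u i) else 1) := by
    rw [Finset.prod_prod_Ioi_mul_eq_prod_prod_off_diag
      (fun j i => if c i < c j then pairFactor q (u i) (u j) else 1)]
    refine Finset.prod_congr rfl fun i _ => ?_
    rw [Finset.prod_filter]
    refine (Finset.prod_subset (Finset.subset_univ _) fun j _ hj => ?_).symm
    rw [Finset.mem_compl, Finset.mem_singleton, not_not] at hj
    rw [hj, if_neg (lt_irrefl _)]
  rw [wordWeight, h1, mul_left_comm, mul_comm (wordKernel q c u), wordKernel,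
    ← Finset.prod_mul_distrib]
  congr 1
  refine Finset.prod_congr rfl fun i _ => ?_
  rw [← Finset.prod_mul_distrib]
  refine Finset.prod_congr rfl fun j hj => ?_
  have hij := Finset.mem_Ioi.1 hj
  have h2 : u i - u j ≠ 0 := sub_ne_zero.2 fun h => hij.ne (hinj h)
  have h3 : u j - u i ≠ 0 := sub_ne_zero.2 fun h => hij.ne' (hinj h)
  have h4 := hq i j hij
  rw [pairKernel]
  rcases lt_trichotomy (c i) (c j) with h | h | h
  · rw [if_pos h, if_neg h.not_gt, if_neg h.not_gt, if_neg h.ne, mul_one, pairFactor]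
    field_simp
    ring
  · simp [h]
  · rw [if_neg h.not_gt, if_pos h, if_pos h, one_mul, pairFactor,
      div_mul_div_cancel₀ h4, div_self h2]

variable (ξ s) in
/-- The function `u⁻¹ φ_m(u⁻¹ | ξ⁻¹, s) / (1 - q)`, in a form that is also regular at `u = 0`. -/
def dualFactor (m : ℕ) (u : ℂ) : ℂ :=
  ξ m * (ξ m * u - s m)⁻¹ * ∏ j ∈ Finset.range m, (colFactor ξ s j u)⁻¹

theorem inv_mul_phi_inv (hξ : ∀ j, ξ j ≠ 0) (m : ℕ) {u : ℂ} (hu : u ≠ 0) :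
    u⁻¹ * phi q (fun j => (ξ j)⁻¹) s m u⁻¹ = (1 - q) * dualFactor ξ s m u := by
  have h : ∀ j, 1 - s j * (ξ j)⁻¹ * u⁻¹ = (ξ j * u)⁻¹ * (ξ j * u - s j) := by
    intro j
    have := hξ j
    field_simp
  have h2 : ∀ j, (ξ j)⁻¹ * u⁻¹ - s j = (ξ j * u)⁻¹ * (1 - s j * (ξ j * u)) := by
    intro j
    have := hξ j
    field_simp
  have h3 : ∀ j, ((ξ j)⁻¹ * u⁻¹ - s j) / (1 - s j * (ξ j)⁻¹ * u⁻¹) = (colFactor ξ s j u)⁻¹ := by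
    intro j
    rw [h, h2, colFactor, inv_div, mul_div_mul_left]
    exact inv_ne_zero (mul_ne_zero (hξ j) hu)
  rw [phi, dualFactor, Finset.prod_congr rfl fun j _ => h3 j, h, div_eq_mul_inv, mul_inv, inv_inv]
  field_simp

/-- A system of contours as in the definition of a `q`-nested system, with complex parameters. -/
structure NestedSystem (q : ℂ) (ξ s : ℕ → ℂ) {k : ℕ} (γ : Fin k → ℝ → ℂ) : Prop where
  q_ne : q ≠ 0
  ξ_ne : ∀ j, ξ j ≠ 0
  s_ne : ∀ j, s j ≠ 0
  contour : ∀ α, IsContour (γ α)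
  inside : ∀ α j, (ξ j)⁻¹ * s j ∈ curveInterior (γ α)
  outside : ∀ α j, (ξ j)⁻¹ * (s j)⁻¹ ∈ curveExterior (γ α)
  nested : ∀ α β, α < β → ∀ z ∈ curveTrace (γ β), q * z ∈ curveInterior (γ α)

namespace NestedSystem

variable {k : ℕ} {γ : Fin k → ℝ → ℂ}

theorem exterior_nonempty (H : NestedSystem q ξ s γ) (α : Fin k) : (curveExterior (γ α)).Nonempty :=
  ⟨_, H.outside α 0⟩

theorem regular (H : NestedSystem q ξ s γ) {α : Fin k} {z : ℂ} (hz : z ∉ curveExterior (γ α)) :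
    Regular ξ s z := by
  intro j h
  refine hz ?_
  have h1 := H.ξ_ne j
  have h2 := H.s_ne j
  have : z = (ξ j)⁻¹ * (s j)⁻¹ := by
    field_simp
    linear_combination -h
  exact this ▸ H.outside α j

theorem ne_zero (H : NestedSystem q ξ s γ) {α : Fin k} {z : ℂ} (hz : z ∈ curveTrace (γ α)) (j : ℕ) :
    ξ j * z - s j ≠ 0 := by
  intro h
  have h1 := H.ξ_ne j
  have : z = (ξ j)⁻¹ * s j := by
    field_simp
    linear_combination h
  exact (H.inside α j).1 (this ▸ hz)

theorem notMem_exterior {γ : ℝ → ℂ} {z : ℂ} (hz : z ∈ curveTrace γ) : z ∉ curveExterior γ :=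
  fun h => h.1 hz

theorem sub_ne_zero (H : NestedSystem q ξ s γ) {u : Fin k → ℂ} (hu : u ∈ traceSet γ) {α β : Fin k}
    (h : α < β) : u α - q * u β ≠ 0 := by
  intro h0
  have h1 := (H.nested α β h _ (hu β)).1
  rw [← sub_eq_zero.1 h0] at h1
  exact h1 (hu α)

theorem div_mem_exterior (H : NestedSystem q ξ s γ) {α β : Fin k} (h : α < β) {z : ℂ}
    (hz : z ∈ curveTrace (γ α)) : q⁻¹ * z ∈ curveExterior (γ β) := by
  refine (H.contour α).exterior_of_nested (H.exterior_nonempty α) H.q_ne (H.nested α β h) ?_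
  rw [mul_inv_cancel_left₀ H.q_ne]
  exact fun hi => hi.1 hz

theorem extRegular_pairKernel (H : NestedSystem q ξ s γ) {α β : Fin k} (h : α < β) {x : ℂ}
    (hx : x ∈ curveTrace (γ α)) (a b : ℕ) : ExtRegular (γ β) fun z => pairKernel q a b x z := by
  have hd : ∀ a' b' : ℂ, ExtRegular (γ β) fun z => (a' * z + b') / (-q * z - -x) := fun a' b' =>
    ExtRegular.linear_div (H.div_mem_exterior h hx) a' b' (neg_ne_zero.2 H.q_ne) (by
      rw [neg_mul, mul_inv_cancel_left₀ H.q_ne])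
  have h0 : ∀ z, -q * z - -x = x - q * z := fun z => by ring
  have h1 : ∀ y z : ℂ, -1 * z + y = y - z := fun y z => by ring
  unfold pairKernel
  split_ifs
  · exact AgreesIn.const _ _ _
  · simpa only [h0, h1] using hd (-1) x
  · simpa only [h0, h1] using hd (-1) (q * x)

theorem continuousOn_pairKernel (H : NestedSystem q ξ s γ) {α β : Fin k} (h : α < β) (a b : ℕ) :
    ContinuousOn (fun u : Fin k → ℂ => pairKernel q a b (u α) (u β)) (traceSet γ) := by
  have hα : ContinuousOn (fun u : Fin k → ℂ => u α) (traceSet γ) :=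
    (continuous_apply α).continuousOn
  have hβ : ContinuousOn (fun u : Fin k → ℂ => u β) (traceSet γ) :=
    (continuous_apply β).continuousOn
  have hne : ∀ u ∈ traceSet γ, u α - q * u β ≠ 0 := fun u hu => H.sub_ne_zero hu h
  unfold pairKernel
  split_ifs
  · exact continuousOn_const
  · exact (hα.sub hβ).div (hα.sub (continuousOn_const.mul hβ)) hne
  · exact ((continuousOn_const.mul hα).sub hβ).div (hα.sub (continuousOn_const.mul hβ)) hne

theorem continuousOn_wordKernel (H : NestedSystem q ξ s γ) (c : Fin k → ℕ) :
    ContinuousOn (wordKernel q c) (traceSet γ) :=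
  continuousOn_finsetProd _ fun _ _ => continuousOn_finsetProd _ fun _ hβ =>
    H.continuousOn_pairKernel (Finset.mem_Ioi.1 hβ) _ _

theorem colFactor_ne_zero (H : NestedSystem q ξ s γ) {α : Fin k} {z : ℂ}
    (hz : z ∈ curveTrace (γ α)) (j : ℕ) : colFactor ξ s j z ≠ 0 :=
  div_ne_zero (H.ne_zero hz j) (H.regular (notMem_exterior hz) j)

theorem continuousOn_colFactor (H : NestedSystem q ξ s γ) (α : Fin k) (j : ℕ) :
    ContinuousOn (colFactor ξ s j) (curveTrace (γ α)) := by
  unfold colFactor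
  exact ContinuousOn.div (by fun_prop) (by fun_prop) fun z hz => H.regular (notMem_exterior hz) j

theorem continuousOn_pathFactor (H : NestedSystem q ξ s γ) (α : Fin k) (x c : ℕ) :
    ContinuousOn (pathFactor ξ s x c) (curveTrace (γ α)) := by
  unfold pathFactor
  exact (ContinuousOn.inv₀ (by fun_prop) fun z hz => H.regular (notMem_exterior hz) c).mul
    (continuousOn_finsetProd _ fun j _ => H.continuousOn_colFactor α j)

theorem continuousOn_dualFactor (H : NestedSystem q ξ s γ) (α : Fin k) (m : ℕ) :
    ContinuousOn (dualFactor ξ s m) (curveTrace (γ α)) := by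
  unfold dualFactor
  exact (continuousOn_const.mul (ContinuousOn.inv₀ (by fun_prop) fun z hz => H.ne_zero hz m)).mul
    (continuousOn_finsetProd _ fun j _ =>
      (H.continuousOn_colFactor α j).inv₀ fun z hz => H.colFactor_ne_zero hz j)

/-- The one-variable factor for the colours `c` and `m` decays quadratically and has interior
poles only, if `c < m`. -/
theorem factor_of_lt (H : NestedSystem q ξ s γ) (α : Fin k) {c m : ℕ} (h : c < m) :
    ∃ f, IntRegular (γ α) f ∧ ∀ z ∈ curveTrace (γ α), pathFactor ξ s 0 c z * dualFactor ξ s m z =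
      f z * ((z - (ξ c)⁻¹ * s c)⁻¹ * (z - (ξ m)⁻¹ * s m)⁻¹) := by
  refine ⟨fun z => (ξ c)⁻¹ * ∏ j ∈ Finset.Ico (c + 1) m, ((-(s j * ξ j)) * z + 1) / (ξ j * z - s j),
    (AgreesIn.const _ _ _).mul (AgreesIn.prod _ fun j _ =>
      IntRegular.linear_div (H.inside α j) _ _ (H.ξ_ne j) ?_), fun z hz => ?_⟩
  · rw [mul_inv_cancel_left₀ (H.ξ_ne j)]
  · have h1 : ∏ j ∈ Finset.range m, (colFactor ξ s j z)⁻¹ =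
        (∏ j ∈ Finset.Ico 0 c, (colFactor ξ s j z)⁻¹) * ((colFactor ξ s c z)⁻¹ *
          ∏ j ∈ Finset.Ico (c + 1) m, ((-(s j * ξ j)) * z + 1) / (ξ j * z - s j)) := by
      rw [Finset.range_eq_Ico, ← Finset.prod_Ico_consecutive _ (Nat.zero_le c) h.le,
        Finset.prod_eq_prod_Ico_succ_bot h]
      congr 2
      refine Finset.prod_congr rfl fun j _ => ?_
      rw [colFactor, inv_div]
      congr 1
      ring
    have h2 : (∏ j ∈ Finset.Ico 0 c, colFactor ξ s j z) *
        ∏ j ∈ Finset.Ico 0 c, (colFactor ξ s j z)⁻¹ = 1 := by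
      rw [← Finset.prod_mul_distrib]
      exact Finset.prod_eq_one fun j _ => mul_inv_cancel₀ (H.colFactor_ne_zero hz j)
    have h3 : ∀ j, (z - (ξ j)⁻¹ * s j)⁻¹ = ξ j * (ξ j * z - s j)⁻¹ := by
      intro j
      have := H.ξ_ne j
      rw [← inv_inj, mul_inv, inv_inv, inv_inv, mul_sub, inv_mul_cancel_left₀ this]
    rw [pathFactor, dualFactor, h1, h3, h3]
    have h4 : (1 - s c * (ξ c * z))⁻¹ * (colFactor ξ s c z)⁻¹ = (ξ c * z - s c)⁻¹ := by
      rw [colFactor, inv_div, inv_mul_eq_div, div_right_comm,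
        div_self (H.regular (notMem_exterior hz) c), one_div]
    rw [← h4]
    have h5 := inv_mul_cancel₀ (H.ξ_ne c)
    dsimp only
    generalize (∏ j ∈ Finset.Ico (c + 1) m, ((-(s j * ξ j)) * z + 1) / (ξ j * z - s j)) = X
    generalize (∏ j ∈ Finset.Ico 0 c, (colFactor ξ s j z)⁻¹) = Y at h2 ⊢
    linear_combination (1 - s c * (ξ c * z))⁻¹ * ξ m * (ξ m * z - s m)⁻¹ *
      (colFactor ξ s c z)⁻¹ * X * (h2 - h5)

/-- The one-variable factor for the colours `c` and `m` has exterior poles only, if `m < c`. -/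
theorem factor_of_gt (H : NestedSystem q ξ s γ) (α : Fin k) {c m : ℕ} (h : m < c) :
    ∃ f, ExtRegular (γ α) f ∧ ∀ z ∈ curveTrace (γ α),
      pathFactor ξ s 0 c z * dualFactor ξ s m z = f z := by
  have hd : ∀ j (a b : ℂ), ExtRegular (γ α) fun z => (a * z + b) / (-(s j * ξ j) * z - -1) := by
    intro j a b
    refine ExtRegular.linear_div (H.outside α j) a b
      (neg_ne_zero.2 (mul_ne_zero (H.s_ne j) (H.ξ_ne j))) ?_
    have h1 := H.ξ_ne j
    have h2 := H.s_ne j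
    field_simp
  refine ⟨fun z => ((0 * z + 1) / (-(s c * ξ c) * z - -1)) * (((0 * z + ξ m) /
    (-(s m * ξ m) * z - -1)) * ∏ j ∈ Finset.Ico (m + 1) c, (ξ j * z + -s j) /
      (-(s j * ξ j) * z - -1)), (hd _ _ _).mul ((hd _ _ _).mul (AgreesIn.prod _ fun j _ => hd _ _ _)),
    fun z hz => ?_⟩
  have h0 : ∀ j, -(s j * ξ j) * z - -1 = 1 - s j * (ξ j * z) := fun j => by ring
  simp only [h0, zero_mul, zero_add, ← sub_eq_add_neg]
  have h1 : ∏ j ∈ Finset.Ico 0 c, colFactor ξ s j z = (∏ j ∈ Finset.range m, colFactor ξ s j z) *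
      (colFactor ξ s m z * ∏ j ∈ Finset.Ico (m + 1) c, (ξ j * z - s j) / (1 - s j * (ξ j * z))) := by
    rw [← Finset.prod_Ico_consecutive _ (Nat.zero_le m) h.le, Finset.prod_eq_prod_Ico_succ_bot h,
      Finset.range_eq_Ico]
    rfl
  have h2 : (∏ j ∈ Finset.range m, colFactor ξ s j z) *
      ∏ j ∈ Finset.range m, (colFactor ξ s j z)⁻¹ = 1 := by
    rw [← Finset.prod_mul_distrib]
    exact Finset.prod_eq_one fun j _ => mul_inv_cancel₀ (H.colFactor_ne_zero hz j)
  rw [pathFactor, dualFactor, h1]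
  generalize (∏ j ∈ Finset.Ico (m + 1) c, (ξ j * z - s j) / (1 - s j * (ξ j * z))) = X
  generalize (∏ j ∈ Finset.range m, (colFactor ξ s j z)⁻¹) = Y at h2 ⊢
  generalize (∏ j ∈ Finset.range m, colFactor ξ s j z) = Z at h2 ⊢
  have h3 : colFactor ξ s m z * (ξ m * z - s m)⁻¹ = (1 - s m * (ξ m * z))⁻¹ := by
    rw [colFactor, div_mul_eq_mul_div, mul_inv_cancel₀ (H.ne_zero hz m), one_div]
  rw [div_eq_mul_inv, div_eq_mul_inv, ← h3]
  linear_combination (1 - s c * (ξ c * z))⁻¹ * colFactor ξ s m z * X * ξ m *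
    (ξ m * z - s m)⁻¹ * h2

/-- The one-variable factor for equal colours has a single interior pole. -/
theorem factor_self (H : NestedSystem q ξ s γ) {α : Fin k} {z : ℂ} (hz : z ∈ curveTrace (γ α))
    (m : ℕ) : pathFactor ξ s 0 m z * dualFactor ξ s m z =
      (1 - s m * (ξ m * z))⁻¹ * (z - (ξ m)⁻¹ * s m)⁻¹ := by
  have h2 : (∏ j ∈ Finset.Ico 0 m, colFactor ξ s j z) *
      ∏ j ∈ Finset.range m, (colFactor ξ s j z)⁻¹ = 1 := by
    rw [Finset.range_eq_Ico, ← Finset.prod_mul_distrib]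
    exact Finset.prod_eq_one fun j _ => mul_inv_cancel₀ (H.colFactor_ne_zero hz j)
  have h3 : (z - (ξ m)⁻¹ * s m)⁻¹ = ξ m * (ξ m * z - s m)⁻¹ := by
    rw [← inv_inj, mul_inv, inv_inv, inv_inv, mul_sub, inv_mul_cancel_left₀ (H.ξ_ne m)]
  rw [h3, pathFactor, dualFactor]
  linear_combination (1 - s m * (ξ m * z))⁻¹ * ξ m * (ξ m * z - s m)⁻¹ * h2

end NestedSystem

end

/-! ### Integration over nested contours -/

noncomputable section

variable {q : ℂ} {ξ s : ℕ → ℂ}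

namespace NestedSystem

variable {k : ℕ} {γ : Fin k → ℝ → ℂ}

/-- As a function of a variable whose colour is smaller than the colours of all preceding
variables, the kernel has interior poles only. -/
theorem intRegular_wordKernel (H : NestedSystem q ξ s γ) {c : Fin k → ℕ} {i : Fin k}
    (hc : ∀ α < i, c i < c α) {w : Fin k → ℂ} (hw : ∀ j ≠ i, w j ∈ curveTrace (γ j)) :
    IntRegular (γ i) fun z => wordKernel q c (Function.update w i z) := by
  refine AgreesIn.prod _ fun α _ => AgreesIn.prod _ fun β hβ => ?_
  have hαβ := Finset.mem_Ioi.1 hβ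
  rcases eq_or_ne α i with rfl | hα
  · simp only [Function.update_self, Function.update_of_ne hαβ.ne']
    have hin := H.nested _ _ hαβ _ (hw β hαβ.ne')
    unfold pairKernel
    split_ifs
    · exact AgreesIn.const _ _ _
    · simpa [sub_eq_add_neg] using
        IntRegular.linear_div hin 1 (-w β) (one_ne_zero (α := ℂ)) (d := q * w β) (by ring)
    · simpa [sub_eq_add_neg] using
        IntRegular.linear_div hin q (-w β) (one_ne_zero (α := ℂ)) (d := q * w β) (by ring)
  · rcases eq_or_ne β i with rfl | hβ
    · simp only [pairKernel, if_pos (hc α hαβ)]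
      exact AgreesIn.const _ _ _
    · simp only [Function.update_of_ne hα, Function.update_of_ne hβ]
      exact AgreesIn.const _ _ _

/-- As a function of a variable whose colour is larger than the colours of all following
variables, the kernel has exterior poles only. -/
theorem extRegular_wordKernel (H : NestedSystem q ξ s γ) {c : Fin k → ℕ} {i : Fin k}
    (hc : ∀ β, i < β → c β < c i) {w : Fin k → ℂ} (hw : ∀ j ≠ i, w j ∈ curveTrace (γ j)) :
    ExtRegular (γ i) fun z => wordKernel q c (Function.update w i z) := by
  refine AgreesIn.prod _ fun α _ => AgreesIn.prod _ fun β hβ => ?_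
  have hαβ := Finset.mem_Ioi.1 hβ
  rcases eq_or_ne α i with rfl | hα
  · simp only [pairKernel, if_pos (hc β hαβ)]
    exact AgreesIn.const _ _ _
  · rcases eq_or_ne β i with rfl | hβ
    · simp only [Function.update_self, Function.update_of_ne hα]
      exact H.extRegular_pairKernel hαβ (hw α hα) _ _
    · simp only [Function.update_of_ne hα, Function.update_of_ne hβ]
      exact AgreesIn.const _ _ _

theorem continuousOn_term (H : NestedSystem q ξ s γ) (c m : Fin k → ℕ) :
    ContinuousOn (fun u => wordKernel q c u *
      ∏ i, (pathFactor ξ s 0 (c i) (u i) * dualFactor ξ s (m i) (u i))) (traceSet γ) := by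
  refine (H.continuousOn_wordKernel c).mul (continuousOn_finsetProd _ fun i _ => ?_)
  have h : Set.MapsTo (fun u : Fin k → ℂ => u i) (traceSet γ) (curveTrace (γ i)) := fun u hu => hu i
  exact ((H.continuousOn_pathFactor i 0 (c i)).comp (continuous_apply i).continuousOn h).mul
    ((H.continuousOn_dualFactor i (m i)).comp (continuous_apply i).continuousOn h)

/-- Only the word equal to the signature itself contributes: for any other word, one of the
variables can be integrated out to give zero. -/
theorem integral_word_eq_zero (H : NestedSystem q ξ s γ) {c m : Fin k → ℕ} (hm : Antitone m)
    (hcm : c ≠ m) : nestedIntegral k γ (fun u => wordKernel q c u *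
      ∏ i, (pathFactor ξ s 0 (c i) (u i) * dualFactor ξ s (m i) (u i))) = 0 := by
  obtain ⟨j, hj⟩ := Function.ne_iff.1 hcm
  obtain _ | k := k
  · exact j.elim0
  have hterm : ∀ (i : Fin (k + 1)) (u : Fin k → ℂ) (z : ℂ),
      wordKernel q c (i.insertNth z u) * ∏ a, (pathFactor ξ s 0 (c a)
        (i.insertNth (α := fun _ => ℂ) z u a) *
          dualFactor ξ s (m a) (i.insertNth (α := fun _ => ℂ) z u a)) =
      (∏ a : Fin k, (pathFactor ξ s 0 (c (i.succAbove a)) (u a) *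
          dualFactor ξ s (m (i.succAbove a)) (u a))) *
        (wordKernel q c (Function.update (i.insertNth 0 u) i z) *
        (pathFactor ξ s 0 (c i) z * dualFactor ξ s (m i) z)) := by
    intro i u z
    rw [Fin.prod_univ_succAbove _ i, Fin.update_insertNth]
    simp only [Fin.insertNth_apply_same, Fin.insertNth_apply_succAbove]
    ring
  have hw : ∀ (i : Fin (k + 1)) (u : Fin k → ℂ), (∀ a, u a ∈ curveTrace (γ (i.succAbove a))) →
      ∀ a ≠ i, i.insertNth (α := fun _ => ℂ) 0 u a ∈ curveTrace (γ a) := by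
    intro i u hu a ha
    obtain ⟨b, rfl⟩ := Fin.exists_succAbove_eq ha
    rw [Fin.insertNth_apply_succAbove]
    exact hu b
  rcases hj.lt_or_gt with hj | hj
  -- If `c j < m j`, the first minimizer `i` of `c` on `Iic j` still satisfies `c i < m i`, and all
  -- poles in its variable are interior.
  · obtain ⟨i, hi, hmin⟩ := Finset.exists_min_image (Finset.Iic j) (fun i => toLex (c i, i))
      ⟨j, Finset.mem_Iic.2 le_rfl⟩
    have hij := Finset.mem_Iic.1 hi
    have h1 : ∀ α < i, c i < c α := by
      intro α hα
      have := hmin α (Finset.mem_Iic.2 (hα.le.trans hij))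
      rw [Prod.Lex.toLex_le_toLex] at this
      exact this.resolve_right fun h => absurd h.2 (not_le.2 hα)
    have h2 : c i < m i := by
      have := hmin j (Finset.mem_Iic.2 le_rfl)
      rw [Prod.Lex.toLex_le_toLex] at this
      have h3 : c i ≤ c j := this.elim le_of_lt fun h => h.1.le
      exact (h3.trans_lt hj).trans_le (hm hij)
    refine nestedIntegral_eq_zero H.contour (H.continuousOn_term c m) i fun u hu => ?_
    simp only [hterm]
    rw [contourIntegral_const_mul]
    obtain ⟨f, hf, h⟩ := H.factor_of_lt i h2
    rw [contourIntegral_congr fun z hz => by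
      rw [h z hz, ← mul_assoc], IntRegular.integral_eq_zero (H.contour i)
        ((H.intRegular_wordKernel h1 (hw i u hu)).mul hf) (H.inside i _) (H.inside i _), mul_zero]
  -- If `m j < c j`, the last maximizer `i` of `c` on `Ici j` still satisfies `m i < c i`, and all
  -- poles in its variable are exterior.
  · obtain ⟨i, hi, hmax⟩ := Finset.exists_max_image (Finset.Ici j) (fun i => toLex (c i, i))
      ⟨j, Finset.mem_Ici.2 le_rfl⟩
    have hij := Finset.mem_Ici.1 hi
    have h1 : ∀ β, i < β → c β < c i := by
      intro β hβ
      have := hmax β (Finset.mem_Ici.2 (hij.trans hβ.le))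
      rw [Prod.Lex.toLex_le_toLex] at this
      exact this.resolve_right fun h => absurd h.2 (not_le.2 hβ)
    have h2 : m i < c i := by
      have := hmax j (Finset.mem_Ici.2 le_rfl)
      rw [Prod.Lex.toLex_le_toLex] at this
      have h3 : c j ≤ c i := this.elim le_of_lt fun h => h.1.le
      exact (hm hij).trans_lt (hj.trans_le h3)
    refine nestedIntegral_eq_zero H.contour (H.continuousOn_term c m) i fun u hu => ?_
    simp only [hterm]
    rw [contourIntegral_const_mul]
    obtain ⟨f, hf, h⟩ := H.factor_of_gt i h2
    rw [contourIntegral_congr fun z hz => by rw [h z hz],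
      ExtRegular.integral_eq_zero (H.contour i) ((H.extRegular_wordKernel h1 (hw i u hu)).mul hf),
      mul_zero]

/-- The contribution of the word equal to the signature, for shifted poles. The integral over the
last variable is given by the residue at its pole, and shifts the pole of the same colour of the
remaining variables. -/
theorem integral_self (k : ℕ) : ∀ {γ : Fin k → ℝ → ℂ} (_ : NestedSystem q ξ s γ) {N : ℕ}
    {c : Fin k → ℕ} (_ : Antitone c) (_ : ∀ i, c i < N) (m : ℕ → ℕ)
    (_ : ∀ α y, q ^ m y * ((ξ y)⁻¹ * s y) ∈ curveInterior (γ α)),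
    nestedIntegral k γ (fun u => wordKernel q c u * ∏ i, ((1 - s (c i) * (ξ (c i) * u i))⁻¹ *
      (u i - q ^ m (c i) * ((ξ (c i))⁻¹ * s (c i)))⁻¹)) =
    ∏ y ∈ Finset.range N,
      (qPoch (s y ^ 2 * q ^ m y) q (Finset.univ.filter fun i => c i = y).card)⁻¹ := by
  induction k with
  | zero =>
    intro γ _ N c _ _ m _
    simp [nestedIntegral, wordKernel, qPoch]
  | succ k ih =>
    intro γ H N c hc hcN m hm
    set y := c (Fin.last k) with hy
    set p := q ^ m y * ((ξ y)⁻¹ * s y) with hp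
    have hle : ∀ i : Fin k, y ≤ c i.castSucc := fun i => hc (Fin.le_last _)
    have H' : NestedSystem q ξ s fun i => γ (Fin.castSucc i) :=
      { q_ne := H.q_ne
        ξ_ne := H.ξ_ne
        s_ne := H.s_ne
        contour := fun α => H.contour _
        inside := fun α => H.inside _
        outside := fun α => H.outside _
        nested := fun α β h => H.nested _ _ (Fin.castSucc_lt_castSucc_iff.2 h) }
    have hstep : ∀ u : Fin k → ℂ, (∀ i, u i ∈ curveTrace (γ i.castSucc)) →
        contourIntegral (γ (Fin.last k)) (fun z =>
          wordKernel q c (Fin.snoc (α := fun _ => ℂ) u z) *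
          ∏ i, ((1 - s (c i) * (ξ (c i) * Fin.snoc (α := fun _ => ℂ) u z i))⁻¹ *
          (Fin.snoc (α := fun _ => ℂ) u z i - q ^ m (c i) * ((ξ (c i))⁻¹ * s (c i)))⁻¹)) =
        (1 - s y ^ 2 * q ^ m y)⁻¹ * (wordKernel q (fun i => c i.castSucc) u *
          ∏ i, ((1 - s (c i.castSucc) * (ξ (c i.castSucc) * u i))⁻¹ *
          (u i - q ^ (Function.update m y (m y + 1)) (c i.castSucc) *
            ((ξ (c i.castSucc))⁻¹ * s (c i.castSucc)))⁻¹)) := by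
      intro u hu
      have hreg : ExtRegular (γ (Fin.last k)) fun z =>
          (∏ i : Fin k, pairKernel q (c i.castSucc) y (u i) z) *
            ((0 * z + 1) / (-(s y * ξ y) * z - -1)) := by
        refine (AgreesIn.prod _ fun i _ => H.extRegular_pairKernel (Fin.castSucc_lt_last i) (hu i)
          _ _).mul (ExtRegular.linear_div (H.outside _ y) _ _
          (neg_ne_zero.2 (mul_ne_zero (H.s_ne y) (H.ξ_ne y))) ?_)
        have h1 := H.ξ_ne y
        have h2 := H.s_ne y
        field_simp
      have hcauchy := hreg.cauchy (H.contour _) (hm (Fin.last k) y)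
      have hsplit : ∀ z, wordKernel q c (Fin.snoc (α := fun _ => ℂ) u z) *
          ∏ i, ((1 - s (c i) * (ξ (c i) * Fin.snoc (α := fun _ => ℂ) u z i))⁻¹ *
          (Fin.snoc (α := fun _ => ℂ) u z i - q ^ m (c i) * ((ξ (c i))⁻¹ * s (c i)))⁻¹) =
          (wordKernel q (fun i => c i.castSucc) u *
            ∏ i, ((1 - s (c i.castSucc) * (ξ (c i.castSucc) * u i))⁻¹ *
            (u i - q ^ m (c i.castSucc) * ((ξ (c i.castSucc))⁻¹ * s (c i.castSucc)))⁻¹)) *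
          ((∏ i : Fin k, pairKernel q (c i.castSucc) y (u i) z) *
            ((0 * z + 1) / (-(s y * ξ y) * z - -1)) * (z - p)⁻¹) := by
        intro z
        have h1 : wordKernel q c (Fin.snoc (α := fun _ => ℂ) u z) =
            wordKernel q (fun i => c i.castSucc) u *
              ∏ i : Fin k, pairKernel q (c i.castSucc) y (u i) z := by
          simp only [wordKernel, ← Finset.filter_lt_eq_Ioi, Finset.prod_filter]
          rw [Fin.prod_univ_castSucc]
          have h3 : ∀ i : Fin (k + 1), ¬ Fin.last k < i := fun i => not_lt.2 (Fin.le_last i)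
          simp only [Fin.prod_univ_castSucc (n := k), Fin.snoc_castSucc, Fin.snoc_last,
            Fin.castSucc_lt_castSucc_iff, Fin.castSucc_lt_last, if_true, h3, if_false,
            Finset.prod_const_one, mul_one, Finset.prod_mul_distrib]
          rfl
        rw [h1, Fin.prod_univ_castSucc]
        simp only [Fin.snoc_castSucc, Fin.snoc_last, ← hy, ← hp]
        have h2 : (0 * z + 1) / (-(s y * ξ y) * z - -1) = (1 - s y * (ξ y * z))⁻¹ := by
          rw [zero_mul, zero_add, one_div]
          congr 1
          ring
        rw [h2]
        ring
      simp only [hsplit]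
      rw [contourIntegral_const_mul, hcauchy]
      have h2 : (0 * p + 1) / (-(s y * ξ y) * p - -1) = (1 - s y ^ 2 * q ^ m y)⁻¹ := by
        rw [zero_mul, zero_add, one_div, hp]
        congr 1
        have := H.ξ_ne y
        field_simp
        ring
      rw [h2, ← mul_assoc, mul_comm, mul_assoc, ← Finset.prod_mul_distrib]
      congr 2
      refine Finset.prod_congr rfl fun i _ => ?_
      rcases (hle i).eq_or_lt with h | h
      · rw [← h, Function.update_self, pairKernel, if_neg (lt_irrefl _), if_pos rfl, pow_succ',
          mul_assoc q, ← hp]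
        have h3 : u i - p ≠ 0 := _root_.sub_ne_zero.2 fun h =>
          (hm i.castSucc y).1 (hp ▸ h ▸ hu i)
        field_simp
      · rw [Function.update_of_ne h.ne', pairKernel, if_pos h, mul_one]
    rw [nestedIntegral_succ_last, nestedIntegral_congr k _ fun u hu => hstep u hu,
      nestedIntegral_const_mul, ih H' (fun i j h => hc (Fin.castSucc_le_castSucc_iff.2 h))
        (fun i => hcN _)]
    · have hmem : y ∈ Finset.range N := Finset.mem_range.2 (hcN _)
      rw [← Finset.mul_prod_erase _ _ hmem, ← Finset.mul_prod_erase _ _ hmem, ← mul_assoc]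
      have hcard : ∀ x, (Finset.univ.filter fun i => c i = x).card =
          (Finset.univ.filter fun i : Fin k => c i.castSucc = x).card + if y = x then 1 else 0 := by
        intro x
        simp only [Finset.card_filter]
        rw [Fin.sum_univ_castSucc]
      congr 1
      · rw [Function.update_self, hcard, if_pos rfl, qPoch, qPoch, Finset.prod_range_succ',
          mul_inv, mul_comm]
        congr 2
        · refine Finset.prod_congr rfl fun j _ => ?_
          ring
        · simp
      · refine Finset.prod_congr rfl fun x hx => ?_
        have hxy := (Finset.mem_erase.1 hx).1
        rw [Function.update_of_ne hxy, hcard, if_neg hxy.symm, add_zero]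
    · intro α x
      rcases eq_or_ne x y with rfl | hx
      · rw [Function.update_self, pow_succ', mul_assoc]
        exact (H.contour _).interior_of_nested (H.exterior_nonempty _) H.q_ne
          (H.nested _ _ (Fin.castSucc_lt_last α)) (hm (Fin.last k) _)
      · rw [Function.update_of_ne hx]
        exact hm _ _

end NestedSystem

end

/-! ### Orthogonality -/

noncomputable section

variable {q : ℂ} {ξ s : ℕ → ℂ}

/-- A decreasing word is determined by its content. -/
theorem eq_of_antitone_of_card_eq {k : ℕ} {f g : Fin k → ℕ} (hf : Antitone f) (hg : Antitone g)
    (h : ∀ y, (Finset.univ.filter fun i => f i = y).card =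
      (Finset.univ.filter fun i => g i = y).card) : f = g := by
  have hcount : ∀ (f : Fin k → ℕ) (y : ℕ),
      (List.ofFn f).count y = (Finset.univ.filter fun i => f i = y).card := by
    intro f y
    rw [← Multiset.coe_count, ← Fin.univ_val_map, Multiset.count_map]
    simp only [eq_comm]
    rfl
  have hperm : (List.ofFn f).Perm (List.ofFn g) := by
    rw [List.perm_iff_count]
    intro y
    rw [hcount, hcount, h]
  exact List.ofFn_injective (hperm.eq_of_sortedGE (List.sortedGE_ofFn_iff.2 hf)
    (List.sortedGE_ofFn_iff.2 hg))

theorem NonnegSignature.exists_bound {k : ℕ} (lam mu : NonnegSignature k) :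
    ∃ N, (∀ i, lam.1 i < N) ∧ ∀ i, mu.1 i < N := by
  refine ⟨∑ i, (lam.1 i + mu.1 i) + 1, fun i => ?_, fun i => ?_⟩ <;>
  · have := Finset.single_le_sum (f := fun i => lam.1 i + mu.1 i) (fun _ _ => Nat.zero_le _)
      (Finset.mem_univ i)
    omega

/-- The only decreasing word with the content of `lam` is `lam` itself. -/
theorem NonnegSignature.mem_wordSet_iff {k N : ℕ} {lam mu : NonnegSignature k}
    (hlam : ∀ i, lam.1 i < N) (hmu : ∀ i, mu.1 i < N) :
    mu.1 ∈ wordSet lam.mult Finset.univ 0 N ↔ lam = mu := by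
  rw [mem_wordSet]
  constructor
  · rintro ⟨-, -, h⟩
    refine Subtype.ext (eq_of_antitone_of_card_eq lam.2 mu.2 fun y => ?_)
    by_cases hy : y < N
    · exact (h y (Nat.zero_le y) (by omega)).symm
    · exact (lam.mult_eq_zero hlam (not_lt.1 hy)).trans (mu.mult_eq_zero hmu (not_lt.1 hy)).symm
  · rintro rfl
    exact ⟨fun i hi => absurd (Finset.mem_univ i) hi,
      fun i _ => ⟨Nat.zero_le _, by have := hlam i; omega⟩, fun y _ _ => rfl⟩

theorem qPoch_ne_zero {z q : ℂ} (hz : ‖z‖ < 1) (hq : ‖q‖ ≤ 1) (n : ℕ) : qPoch z q n ≠ 0 := by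
  refine Finset.prod_ne_zero_iff.2 fun i _ h => ?_
  have h1 : ‖z * q ^ i‖ < 1 := by
    rw [norm_mul, norm_pow]
    exact (mul_le_of_le_one_right (norm_nonneg _) (pow_le_one₀ (norm_nonneg _) hq)).trans_lt hz
  rw [← sub_eq_zero.1 h, norm_one] at h1
  exact lt_irrefl _ h1

theorem conjFactor_eq {k N : ℕ} {lam : NonnegSignature k} (hlam : ∀ i, lam.1 i < N) :
    conjFactor q s lam =
      ∏ y ∈ Finset.range N, qPoch (s y ^ 2) q (lam.mult y) / qPoch q q (lam.mult y) := by
  refine finprod_eq_prod_of_mulSupport_subset _ fun y hy => ?_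
  by_contra h
  refine hy ?_
  dsimp only
  rw [Finset.mem_coe, Finset.mem_range, not_lt] at h
  rw [lam.mult_eq_zero hlam h]
  simp [qPoch]

/-- The integrand of the orthogonality relation, expanded over the rearrangements of `lam` as
a function that is continuous on the contours. -/
def wordIntegrand (q : ℂ) (ξ s : ℕ → ℂ) {k : ℕ} (N : ℕ) (lam mu : NonnegSignature k)
    (u : Fin k → ℂ) : ℂ :=
  (∏ y ∈ Finset.range N, qPoch q q (lam.mult y)) *
    ∑ c ∈ wordSet lam.mult Finset.univ 0 N, wordKernel q c u *
      ∏ i, (pathFactor ξ s 0 (c i) (u i) * dualFactor ξ s (mu.1 i) (u i))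

theorem wordIntegrand_eq {k N : ℕ} {lam : NonnegSignature k} (mu : NonnegSignature k)
    (hlam : ∀ i, lam.1 i < N) {u : Fin k → ℂ} (hinj : Function.Injective u)
    (hu : ∀ i, Regular ξ s (u i)) (hq : ∀ α β, α < β → u α - q * u β ≠ 0) :
    wordIntegrand q ξ s N lam mu u =
      (∏ α, ∏ β ∈ Finset.Ioi α, (u α - u β) / (u α - q * u β)) * symF q ξ s lam u *
        ∏ i, dualFactor ξ s (mu.1 i) (u i) := by
  rw [symF_eq_sum_words hlam hinj hu, wordIntegrand, mul_left_comm, mul_assoc]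
  congr 1
  rw [Finset.mul_sum, Finset.sum_mul]
  refine Finset.sum_congr rfl fun c _ => ?_
  rw [kernel_mul_wordWeight hinj hq, Finset.prod_mul_distrib, mul_assoc]

namespace NestedSystem

variable {k : ℕ} {γ : Fin k → ℝ → ℂ}

theorem continuousOn_wordIntegrand (H : NestedSystem q ξ s γ) (N : ℕ) (lam mu : NonnegSignature k) :
    ContinuousOn (wordIntegrand q ξ s N lam mu) (traceSet γ) :=
  continuousOn_const.mul (continuousOn_finsetSum _ fun c _ => H.continuousOn_term c _)

theorem integral_wordIntegrand (H : NestedSystem q ξ s γ) {N : ℕ} {lam mu : NonnegSignature k}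
    (hlam : ∀ i, lam.1 i < N) (hmu : ∀ i, mu.1 i < N) :
    nestedIntegral k γ (wordIntegrand q ξ s N lam mu) = if lam = mu then
      ∏ y ∈ Finset.range N, qPoch q q (lam.mult y) / qPoch (s y ^ 2) q (lam.mult y) else 0 := by
  unfold wordIntegrand
  rw [nestedIntegral_const_mul, nestedIntegral_sum H.contour _ fun c _ => H.continuousOn_term c _,
    Finset.sum_congr rfl (g := fun c => if mu.1 = c then
      ∏ y ∈ Finset.range N, (qPoch (s y ^ 2) q (mu.mult y))⁻¹ else 0), Finset.sum_ite_eq]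
  · simp only [NonnegSignature.mem_wordSet_iff hlam hmu]
    split_ifs with h
    · rw [← h, ← Finset.prod_mul_distrib]
      rfl
    · rw [mul_zero]
  · intro c _
    split_ifs with h
    · subst h
      have h1 := integral_self k H mu.2 hmu (fun _ => 0) fun α y => by
        rw [pow_zero, one_mul]
        exact H.inside α y
      simp only [pow_zero, one_mul, mul_one] at h1
      rw [← show _ = ∏ y ∈ Finset.range N, (qPoch (s y ^ 2) q (mu.mult y))⁻¹ from h1]
      refine nestedIntegral_congr k γ fun u hu => ?_
      congr 1
      exact Finset.prod_congr rfl fun i _ => H.factor_self (hu i) _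
    · exact H.integral_word_eq_zero mu.2 fun h' => h h'.symm

/-- The conjugation factor normalizes the orthogonality relation. -/
theorem conjFactor_mul_integral (H : NestedSystem q ξ s γ) (hq : ‖q‖ < 1) (hs : ∀ j, ‖s j‖ < 1)
    {N : ℕ} {lam mu : NonnegSignature k} (hlam : ∀ i, lam.1 i < N) (hmu : ∀ i, mu.1 i < N) :
    conjFactor q s lam * nestedIntegral k γ (wordIntegrand q ξ s N lam mu) =
      if lam = mu then 1 else 0 := by
  rw [H.integral_wordIntegrand hlam hmu, conjFactor_eq hlam, mul_ite, mul_zero,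
    ← Finset.prod_mul_distrib]
  congr 1
  refine Finset.prod_eq_one fun y _ => ?_
  have h1 := qPoch_ne_zero hq hq.le (lam.mult y)
  have h2 : qPoch (s y ^ 2) q (lam.mult y) ≠ 0 := by
    refine qPoch_ne_zero ?_ hq.le _
    rw [norm_pow]
    exact pow_lt_one₀ (norm_nonneg _) (hs y) two_ne_zero
  rw [div_mul_div_cancel₀ h1, div_self h2]

/-- The orthogonality relation over nested contours. -/
theorem orthogonality (H : NestedSystem q ξ s γ) (hq : ‖q‖ < 1) (hs : ∀ j, ‖s j‖ < 1)
    (lam mu : NonnegSignature k) :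
    ((1 - q) ^ k)⁻¹ * nestedIntegral k γ (fun u =>
      (∏ α, ∏ β ∈ Finset.Ioi α, (u α - u β) / (u α - q * u β)) * symFc q ξ s lam u *
        ∏ i, (u i)⁻¹ * phi q (fun j => (ξ j)⁻¹) s (mu.1 i) (u i)⁻¹) =
      if lam = mu then 1 else 0 := by
  obtain ⟨N, hlam, hmu⟩ := lam.exists_bound mu
  have hq1 : (1 - q) ^ k ≠ 0 := pow_ne_zero _ fun h => by
    rw [← sub_eq_zero.1 h, norm_one] at hq
    exact lt_irrefl _ hq
  -- The contours may pass through `0`, where `φ_m(u⁻¹)` takes a junk value.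
  rw [← H.conjFactor_mul_integral hq hs hlam hmu, nestedIntegral_congr_of_injective k H.contour {0}
    (g := fun u => (1 - q) ^ k * (conjFactor q s lam * wordIntegrand q ξ s N lam mu u)),
    nestedIntegral_const_mul, nestedIntegral_const_mul, inv_mul_cancel_left₀ hq1]
  intro u hu hinj h0
  have hphi : ∏ i, (u i)⁻¹ * phi q (fun j => (ξ j)⁻¹) s (mu.1 i) (u i)⁻¹ =
      (1 - q) ^ k * ∏ i, dualFactor ξ s (mu.1 i) (u i) := by
    rw [Finset.prod_congr rfl fun i _ => inv_mul_phi_inv H.ξ_ne (mu.1 i) (u := u i) (by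
      simpa using h0 i), Finset.prod_mul_distrib, Finset.prod_const, Finset.card_univ,
      Fintype.card_fin]
  rw [hphi, wordIntegrand_eq mu hlam hinj (fun i => H.regular (notMem_exterior (hu i)))
    fun α β h => H.sub_ne_zero hu h, symFc]
  ring

end NestedSystem

/-- The symmetrization formula for `F_mu`, as a sum over all permutations. -/
theorem symF_eq_sum_perm {k N : ℕ} {mu : NonnegSignature k} (hmu : ∀ i, mu.1 i < N)
    {x : Fin k → ℂ} (hinj : Function.Injective x) (hx : ∀ i, Regular ξ s (x i)) :
    symF q ξ s mu x = (1 - q) ^ k * ∑ σ : Equiv.Perm (Fin k),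
      (∏ i, pathFactor ξ s 0 (mu.1 i) (x (σ i))) *
        ∏ α, ∏ β ∈ Finset.Ioi α, pairFactor q (x (σ β)) (x (σ α)) := by
  have hterm : ∀ c ∈ wordSet mu.mult Finset.univ 0 N,
      (∏ y ∈ Finset.range N, qPoch q q (mu.mult y)) * wordWeight q ξ s x 0 Finset.univ c =
      ∑ σ : Equiv.Perm (Fin k), if (fun i => mu.1 (σ.symm i)) = c then
        (1 - q) ^ k * ((∏ i, pathFactor ξ s 0 (mu.1 i) (x (σ i))) *
          ∏ α, ∏ β ∈ Finset.Ioi α, pairFactor q (x (σ β)) (x (σ α))) else 0 := by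
    intro c hc
    obtain ⟨-, hcN, hcard⟩ := mem_wordSet.1 hc
    have hcN' : ∀ i, c i < N := fun i => by simpa using (hcN i (Finset.mem_univ i)).2
    have h1 : ∏ y ∈ Finset.range N, qPoch q q (mu.mult y) = ∏ y ∈ Finset.range N,
        qPoch q q (Finset.univ.filter fun i => c i = y).card :=
      Finset.prod_congr rfl fun y hy => by
        rw [hcard y (Nat.zero_le y) (by simpa using hy)]
    have h2 := sum_perm_antitone (q := q) N k c hcN' x hinj
    rw [h1, show wordWeight q ξ s x 0 Finset.univ c = (∏ i, pathFactor ξ s 0 (c i) (x i)) *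
      increaseProd q c x Finset.univ from rfl, mul_left_comm, ← h2, mul_left_comm, Finset.mul_sum,
      Finset.mul_sum]
    refine Finset.sum_congr rfl fun σ _ => ?_
    -- Along `σ`, the word `c` decreases if and only if it is the rearrangement of `mu` by `σ`.
    have h3 : Antitone (fun i => c (σ i)) ↔ (fun i => mu.1 (σ.symm i)) = c := by
      constructor
      · intro h
        have h4 : (fun i => c (σ i)) = mu.1 := by
          refine eq_of_antitone_of_card_eq h mu.2 fun y => ?_
          have h5 : (Finset.univ.filter fun i => c (σ i) = y).card =
              (Finset.univ.filter fun i => c i = y).card :=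
            Finset.card_equiv σ fun i => by simp
          rw [h5]
          by_cases hy : y < N
          · exact hcard y (Nat.zero_le y) (by omega)
          · rw [show (Finset.univ.filter fun i => mu.1 i = y).card = 0 from
              mu.mult_eq_zero hmu (not_lt.1 hy), Finset.card_eq_zero, Finset.filter_eq_empty_iff]
            intro i _ hi
            exact hy (hi ▸ hcN' i)
        rw [← h4]
        funext i
        simp
      · rintro rfl
        simpa using mu.2
    simp only [h3]
    split_ifs with h
    · subst h
      rw [← Equiv.prod_comp σ]
      simp only [Equiv.symm_apply_apply]
    · rw [mul_zero, mul_zero]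
  rw [symF_eq_sum_words hmu hinj hx, Finset.mul_sum, Finset.sum_congr rfl hterm, Finset.sum_comm,
    Finset.mul_sum]
  refine Finset.sum_congr rfl fun σ _ => ?_
  rw [Finset.sum_ite_eq, if_pos]
  refine mem_wordSet.2 ⟨fun i hi => absurd (Finset.mem_univ i) hi,
    fun i _ => ⟨Nat.zero_le _, by simpa using hmu _⟩, fun y _ _ => ?_⟩
  exact Finset.card_equiv σ.symm fun i => by simp

namespace NestedSystem

/-- The integrand over a single contour is the symmetrization of the integrand over nested
contours, as the kernel and `F_lam` can be moved under the symmetrization of `F_mu`. -/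
theorem symmetrization {k N : ℕ} {γ : ℝ → ℂ} (H : NestedSystem q ξ s fun _ : Fin k => γ)
    (hnest : ∀ z ∈ curveTrace γ, q * z ∈ curveInterior γ) {lam mu : NonnegSignature k}
    (hlam : ∀ i, lam.1 i < N) (hmu : ∀ i, mu.1 i < N) {u : Fin k → ℂ}
    (hu : u ∈ traceSet fun _ : Fin k => γ) (hinj : Function.Injective u) (h0 : ∀ i, u i ≠ 0)
    (hq1 : 1 - q ≠ 0) :
    (∏ i, (u i)⁻¹) * (∏ α, ∏ β ∈ Finset.univ.erase α, (u α - u β) / (u α - q * u β)) *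
        symF q ξ s lam u * symF q (fun j => (ξ j)⁻¹) s mu (fun i => (u i)⁻¹) =
      (1 - q) ^ k * ∑ σ : Equiv.Perm (Fin k),
        wordIntegrand q ξ s N lam mu fun i => u (σ i) := by
  have hreg : ∀ i, Regular ξ s (u i) := fun i => H.regular (α := i) (notMem_exterior (hu i))
  have hne : ∀ i j, u i - q * u j ≠ 0 := by
    intro i j h
    have h1 := (hnest _ (hu j)).1
    rw [← sub_eq_zero.1 h] at h1
    exact h1 (hu i)
  have hreg' : ∀ i, Regular (fun j => (ξ j)⁻¹) s (u i)⁻¹ := by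
    intro i j h
    refine H.ne_zero (α := i) (hu i) j ?_
    have h1 := H.ξ_ne j
    have h2 := h0 i
    field_simp at h
    rwa [mul_zero] at h
  have hdual : ∀ (m : ℕ) i, (u i)⁻¹ * pathFactor (fun j => (ξ j)⁻¹) s 0 m (u i)⁻¹ =
      dualFactor ξ s m (u i) := by
    intro m i
    refine mul_left_cancel₀ hq1 ?_
    rw [← inv_mul_phi_inv H.ξ_ne m (h0 i), phi, pathFactor, ← Finset.range_eq_Ico]
    simp only [colFactor, mul_assoc, div_eq_mul_inv]
    ring
  rw [symF_eq_sum_perm hmu (fun i j h => hinj (inv_injective h)) hreg', mul_left_comm,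
    Finset.mul_sum]
  congr 1
  refine Finset.sum_congr rfl fun σ _ => ?_
  rw [wordIntegrand_eq (u := fun i => u (σ i)) mu hlam (hinj.comp σ.injective) (fun i => hreg _) fun α β _ => hne _ _,
    symF_comp_perm hreg]
  have h1 : ∏ i, dualFactor ξ s (mu.1 i) (u (σ i)) =
      (∏ i, (u i)⁻¹) * ∏ i, pathFactor (fun j => (ξ j)⁻¹) s 0 (mu.1 i) (u (σ i))⁻¹ := by
    rw [← Equiv.prod_comp σ fun i => (u i)⁻¹, ← Finset.prod_mul_distrib]
    exact Finset.prod_congr rfl fun i _ => (hdual _ _).symm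
  have h2 : ∏ α, ∏ β ∈ Finset.univ.erase α, (u α - u β) / (u α - q * u β) =
      ∏ α, ∏ β ∈ Finset.univ.erase α, (u (σ α) - u (σ β)) / (u (σ α) - q * u (σ β)) := by
    rw [← Equiv.prod_comp σ]
    refine Finset.prod_congr rfl fun α _ => (Finset.prod_equiv σ (fun β => ?_) fun β _ => rfl).symm
    simp
  -- The symmetrization of `F_mu` cancels the half of the kernel with `α > β`.
  have h3 : (∏ α, ∏ β ∈ Finset.univ.erase α, (u (σ α) - u (σ β)) / (u (σ α) - q * u (σ β))) *
      ∏ α, ∏ β ∈ Finset.Ioi α, pairFactor q (u (σ β))⁻¹ (u (σ α))⁻¹ =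
      ∏ α, ∏ β ∈ Finset.Ioi α, (u (σ α) - u (σ β)) / (u (σ α) - q * u (σ β)) := by
    have h4 := Finset.prod_prod_Ioi_mul_eq_prod_prod_off_diag
      fun β α => (u (σ α) - u (σ β)) / (u (σ α) - q * u (σ β))
    simp only [Finset.compl_singleton] at h4
    rw [← h4, ← Finset.prod_mul_distrib]
    refine Finset.prod_congr rfl fun α _ => ?_
    rw [← Finset.prod_mul_distrib]
    refine Finset.prod_congr rfl fun β hβ => ?_
    have hαβ : σ α ≠ σ β := fun h => (Finset.mem_Ioi.1 hβ).ne (σ.injective h)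
    have h5 : u (σ β) - u (σ α) ≠ 0 := _root_.sub_ne_zero.2 fun h => hαβ (hinj h).symm
    have h6 := hne (σ β) (σ α)
    have h7 : pairFactor q (u (σ β))⁻¹ (u (σ α))⁻¹ =
        (u (σ β) - q * u (σ α)) / (u (σ β) - u (σ α)) := by
      have ha := h0 (σ α)
      have hb := h0 (σ β)
      have h8 : (u (σ α))⁻¹ - (u (σ β))⁻¹ ≠ 0 := _root_.sub_ne_zero.2 fun h =>
        hαβ (hinj (inv_injective h))
      rw [pairFactor, div_eq_div_iff h8 h5]
      field_simp
    rw [h7, mul_assoc, div_mul_div_cancel₀ h6, div_self h5, mul_one]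
  rw [h1, ← h3, h2]
  ring

/-- The orthogonality relation over a single large contour. -/
theorem orthogonality_single {k : ℕ} {γ : ℝ → ℂ} (H : NestedSystem q ξ s fun _ : Fin k => γ)
    (hγ : IsContour γ)
    (hnest : ∀ z ∈ curveTrace γ, q * z ∈ curveInterior γ) (hq : ‖q‖ < 1) (hs : ∀ j, ‖s j‖ < 1)
    (lam mu : NonnegSignature k) :
    conjFactor q s lam / ((1 - q) ^ k * (k.factorial : ℂ)) * nestedIntegral k (fun _ => γ)
      (fun u => (∏ i, (u i)⁻¹) *
        (∏ α, ∏ β ∈ Finset.univ.erase α, (u α - u β) / (u α - q * u β)) *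
        symF q ξ s lam u * symF q (fun j => (ξ j)⁻¹) s mu (fun i => (u i)⁻¹)) =
      if lam = mu then 1 else 0 := by
  obtain ⟨N, hlam, hmu⟩ := lam.exists_bound mu
  have hq1 : 1 - q ≠ 0 := fun h => by
    rw [← sub_eq_zero.1 h, norm_one] at hq
    exact lt_irrefl _ hq
  have hcont : ∀ σ : Equiv.Perm (Fin k), ContinuousOn
      (fun u : Fin k → ℂ => wordIntegrand q ξ s N lam mu fun i => u (σ i))
      (traceSet fun _ : Fin k => γ) := fun σ =>
    (H.continuousOn_wordIntegrand N lam mu).comp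
      (continuous_pi fun i => continuous_apply (σ i)).continuousOn fun u hu i => hu (σ i)
  rw [nestedIntegral_congr_of_injective k (fun _ => hγ) {0} fun u hu hinj h0 =>
    H.symmetrization hnest hlam hmu hu hinj (fun i => by simpa using h0 i) hq1,
    nestedIntegral_const_mul, nestedIntegral_sum (fun _ => hγ) _ fun σ _ => hcont σ,
    Finset.sum_congr rfl fun σ _ =>
      nestedIntegral_comp_perm hγ (H.continuousOn_wordIntegrand N lam mu) σ,
    Finset.sum_const, Finset.card_univ, Fintype.card_perm, Fintype.card_fin, nsmul_eq_mul,
    ← H.conjFactor_mul_integral hq hs hlam hmu]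
  have h1 : (1 - q) ^ k ≠ 0 := pow_ne_zero _ hq1
  have h2 : (k.factorial : ℂ) ≠ 0 := Nat.cast_ne_zero.2 (Nat.factorial_ne_zero k)
  field_simp

end NestedSystem

end

/-! ### Contours in the form of circles -/

noncomputable section

/-- The circle of radius `r` around the origin, parametrized by the unit interval. -/
def circleContour (r t : ℝ) : ℂ := circleMap 0 r (2 * Real.pi * t)

theorem curveTrace_circleContour {r : ℝ} (hr : 0 < r) :
    curveTrace (circleContour r) = Metric.sphere 0 r := by
  ext z
  constructor
  · rintro ⟨t, -, rfl⟩
    exact circleMap_mem_sphere 0 hr.le _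
  · intro hz
    rw [← abs_of_pos hr, ← image_circleMap_Ioc] at hz
    obtain ⟨θ, hθ, rfl⟩ := hz
    refine ⟨θ / (2 * Real.pi), ⟨div_nonneg hθ.1.le Real.two_pi_pos.le,
      (div_le_one Real.two_pi_pos).2 hθ.2⟩, ?_⟩
    rw [circleContour, mul_div_cancel₀ _ Real.two_pi_pos.ne']

theorem mem_curveInterior_circleContour {r : ℝ} (hr : 0 < r) {z : ℂ} (hz : ‖z‖ < r) :
    z ∈ curveInterior (circleContour r) := by
  rw [curveInterior, Set.mem_ofPred_eq, curveTrace_circleContour hr]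
  have h : z ∉ Metric.sphere (0 : ℂ) r := by
    rw [mem_sphere_zero_iff_norm]
    exact hz.ne
  refine ⟨h, (Metric.isBounded_ball (x := (0 : ℂ)) (r := r)).subset ?_⟩
  refine IsPreconnected.subset_left_of_subset_union Metric.isOpen_ball
    Metric.isClosed_closedBall.isOpen_compl (v := (Metric.closedBall (0 : ℂ) r)ᶜ) ?_ ?_
    ⟨z, mem_connectedComponentIn h, mem_ball_zero_iff.2 hz⟩ isPreconnected_connectedComponentIn
  · exact Set.disjoint_compl_right_iff_subset.2 Metric.ball_subset_closedBall
  · intro w hw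
    have h1 := connectedComponentIn_subset _ _ hw
    rw [Set.mem_compl_iff, mem_sphere_zero_iff_norm] at h1
    rw [Set.mem_union, Set.mem_compl_iff, mem_ball_zero_iff, mem_closedBall_zero_iff, not_le]
    exact lt_or_gt_of_ne h1

theorem mem_curveExterior_circleContour {r : ℝ} (hr : 0 < r) {z : ℂ} (hz : r < ‖z‖) :
    z ∈ curveExterior (circleContour r) := by
  rw [curveExterior, Set.mem_ofPred_eq, curveTrace_circleContour hr]
  have hz0 : 0 < ‖z‖ := hr.trans hz
  have hray : (fun t : ℝ => (t : ℂ) * z) '' Set.Ici 1 ⊆ (Metric.sphere (0 : ℂ) r)ᶜ := by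
    rintro _ ⟨t, ht, rfl⟩
    have ht' : (1 : ℝ) ≤ t := ht
    rw [Set.mem_compl_iff, mem_sphere_zero_iff_norm, norm_mul, Complex.norm_real,
      Real.norm_of_nonneg (zero_le_one.trans ht')]
    nlinarith
  have hmem : z ∈ (fun t : ℝ => (t : ℂ) * z) '' Set.Ici 1 := ⟨1, Set.self_mem_Ici, by simp⟩
  refine ⟨hray hmem, fun hb => ?_⟩
  have h1 := ((isPreconnected_Ici (a := (1 : ℝ))).image (fun t : ℝ => (t : ℂ) * z)
    (by fun_prop)).subset_connectedComponentIn hmem hray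
  obtain ⟨R, hR⟩ := isBounded_iff_forall_norm_le.1 (hb.subset h1)
  have h2 := hR _ ⟨max 1 (R / ‖z‖ + 1), Set.mem_Ici.2 (le_max_left _ _), rfl⟩
  rw [norm_mul, Complex.norm_real, Real.norm_of_nonneg (zero_le_one.trans (le_max_left _ _))] at h2
  have h3 : (R / ‖z‖ + 1) * ‖z‖ ≤ R :=
    (mul_le_mul_of_nonneg_right (le_max_right _ _) hz0.le).trans h2
  rw [add_mul, div_mul_cancel₀ _ hz0.ne'] at h3
  linarith

theorem contourIntegral_circleContour (r : ℝ) (f : ℂ → ℂ) :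
    contourIntegral (circleContour r) f = (2 * (Real.pi : ℂ) * Complex.I)⁻¹ * ∮ z in C(0, r), f z := by
  have hd : ∀ t, deriv (circleContour r) t =
      (2 * Real.pi : ℝ) * deriv (circleMap 0 r) (2 * Real.pi * t) := by
    intro t
    have h := ((differentiable_circleMap 0 r).differentiableAt.hasDerivAt (x := 2 * Real.pi * t)).scomp
      t ((hasDerivAt_id t).const_mul (2 * Real.pi))
    rw [mul_one] at h
    exact h.deriv
  rw [contourIntegral, circleIntegral]
  congr 1
  have h := intervalIntegral.integral_comp_mul_left (a := 0) (b := 1)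
    (fun θ => deriv (circleMap 0 r) θ • f (circleMap 0 r θ)) Real.two_pi_pos.ne'
  rw [mul_zero, mul_one, eq_inv_smul_iff₀ Real.two_pi_pos.ne'] at h
  rw [← h, ← intervalIntegral.integral_smul]
  refine intervalIntegral.integral_congr fun t _ => ?_
  simp only [hd, circleContour, smul_eq_mul, Complex.real_smul]
  ring

theorem isContour_circleContour {r : ℝ} (hr : 0 < r) : IsContour (circleContour r) := by
  have hsmooth : ContDiff ℝ 1 (circleContour r) :=
    (contDiff_circleMap 0 r).comp (contDiff_const.mul contDiff_id)
  refine ⟨hsmooth.continuous.continuousOn, ⟨∅, fun _ _ _ _ _ _ => hsmooth.contDiffOn⟩, ?_, ?_, ?_⟩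
  · have := periodic_circleMap 0 r 0
    rw [zero_add] at this
    simp only [circleContour, mul_zero, mul_one, this]
  · intro a ha b hb hab
    have h := injOn_circleMap_of_abs_sub_le' (c := 0) (a := 0) (b := 2 * Real.pi) hr.ne'
      (by rw [sub_zero])
    have hmem : ∀ t ∈ Set.Ico (0 : ℝ) 1, 2 * Real.pi * t ∈ Set.Ico 0 (2 * Real.pi) := fun t ht =>
      ⟨mul_nonneg Real.two_pi_pos.le ht.1, mul_lt_of_lt_one_right Real.two_pi_pos ht.2⟩
    exact mul_left_cancel₀ Real.two_pi_pos.ne' (h (hmem a ha) (hmem b hb) hab)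
  · intro z hz
    have hz' : z ∈ Metric.ball (0 : ℂ) r := by
      rw [mem_ball_zero_iff]
      by_contra h
      rcases (not_lt.1 h).eq_or_lt with h | h
      · refine hz.1 ?_
        rw [curveTrace_circleContour hr, mem_sphere_zero_iff_norm]
        exact h.symm
      · exact curveInterior_disjoint_exterior hz (mem_curveExterior_circleContour hr h)
    rw [contourIntegral_circleContour, circleIntegral.integral_sub_inv_of_mem_ball hz',
      inv_mul_cancel₀ Complex.two_pi_I_ne_zero]

variable {q : ℝ} {ξ s : ℕ → ℝ}

theorem StochasticParams.ξ_pos (h : StochasticParams q ξ s) (j : ℕ) : 0 < ξ j := by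
  obtain ⟨a, b, ha, hab⟩ := h.ξ_bounds
  exact ha.trans_le (hab j).1

theorem StochasticParams.s_neg (h : StochasticParams q ξ s) (j : ℕ) : s j < 0 := by
  obtain ⟨ε, hε, hs⟩ := h.s_bounds
  linarith [(hs j).2]

theorem StochasticParams.abs_s_lt_one (h : StochasticParams q ξ s) (j : ℕ) : |s j| < 1 := by
  obtain ⟨ε, hε, hs⟩ := h.s_bounds
  rw [abs_lt]
  constructor <;> linarith [(hs j).1, (hs j).2]

/-- A circle around the origin which separates the points `ξ⁻¹ s` from the points `ξ⁻¹ s⁻¹`. -/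
theorem StochasticParams.exists_radius (h : StochasticParams q ξ s)
    (hs : (⨆ j, (ξ j)⁻¹ * |s j|) < ⨅ j, (ξ j)⁻¹ * |(s j)⁻¹|) :
    ∃ r : ℝ, 0 < r ∧ (∀ j, |(ξ j)⁻¹ * s j| < r) ∧ ∀ j, r < |(ξ j)⁻¹ * (s j)⁻¹| := by
  obtain ⟨r, h1, h2⟩ := exists_between hs
  have hbdd : BddAbove (Set.range fun j => (ξ j)⁻¹ * |s j|) := by
    obtain ⟨a, b, ha, hab⟩ := h.ξ_bounds
    refine ⟨a⁻¹ * 1, ?_⟩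
    rintro _ ⟨j, rfl⟩
    exact mul_le_mul (inv_anti₀ ha (hab j).1) (h.abs_s_lt_one j).le (abs_nonneg _)
      (inv_nonneg.2 ha.le)
  have hbdd' : BddBelow (Set.range fun j => (ξ j)⁻¹ * |(s j)⁻¹|) := by
    refine ⟨0, ?_⟩
    rintro _ ⟨j, rfl⟩
    exact mul_nonneg (inv_nonneg.2 (h.ξ_pos j).le) (abs_nonneg _)
  have habs : ∀ j x, |(ξ j)⁻¹ * x| = (ξ j)⁻¹ * |x| := fun j x => by
    rw [abs_mul, abs_of_pos (inv_pos.2 (h.ξ_pos j))]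
  have h3 : ∀ j, |(ξ j)⁻¹ * s j| < r := fun j => by
    rw [habs]
    exact (le_ciSup hbdd j).trans_lt h1
  refine ⟨r, (abs_nonneg _).trans_lt (h3 0), h3, fun j => ?_⟩
  rw [habs]
  exact h2.trans_le (ciInf_le hbdd' j)

theorem StochasticParams.norm_q_mul_lt (h : StochasticParams q ξ s) {r : ℝ} (hr : 0 < r) {z : ℂ}
    (hz : z ∈ curveTrace (circleContour r)) : ‖(q : ℂ) * z‖ < r := by
  rw [curveTrace_circleContour hr, mem_sphere_zero_iff_norm] at hz
  rw [norm_mul, hz, Complex.norm_real, Real.norm_of_nonneg h.q_pos.le]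
  exact mul_lt_of_lt_one_left hr h.q_lt_one

theorem StochasticParams.isQNested_circle (h : StochasticParams q ξ s) {r : ℝ} (hr : 0 < r)
    (h1 : ∀ j, |(ξ j)⁻¹ * s j| < r) (h2 : ∀ j, r < |(ξ j)⁻¹ * (s j)⁻¹|) (k : ℕ) :
    IsQNested q ξ s fun _ : Fin k => circleContour r where
  contour _ := isContour_circleContour hr
  inside _ j := mem_curveInterior_circleContour hr (by
    rw [Complex.norm_real]
    exact h1 j)
  outside _ j := mem_curveExterior_circleContour hr (by
    rw [Complex.norm_real]
    exact h2 j)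
  nested _ _ _ _ hz := mem_curveInterior_circleContour hr (h.norm_q_mul_lt hr hz)
  small _ _ _ hz := (mem_curveInterior_circleContour hr (h.norm_q_mul_lt hr hz)).1

theorem StochasticParams.isLargeContour_circle (h : StochasticParams q ξ s) {r : ℝ} (hr : 0 < r)
    (h1 : ∀ j, |(ξ j)⁻¹ * s j| < r) (h2 : ∀ j, r < |(ξ j)⁻¹ * (s j)⁻¹|) (k : ℕ) :
    IsLargeContour q ξ s k (circleContour r) where
  contour := isContour_circleContour hr
  inside i _ j := mem_curveInterior_circleContour hr (by
    rw [Complex.norm_real, norm_mul, norm_pow, Real.norm_of_nonneg h.q_pos.le]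
    exact (mul_le_of_le_one_left (norm_nonneg _)
      (pow_le_one₀ h.q_pos.le h.q_lt_one.le)).trans_lt (h1 j))
  outside j := mem_curveExterior_circleContour hr (by
    rw [Complex.norm_real]
    exact h2 j)
  nested _ hz := mem_curveInterior_circleContour hr (h.norm_q_mul_lt hr hz)

theorem IsQNested.nestedSystem (h : StochasticParams q ξ s) {k : ℕ} {γ : Fin k → ℝ → ℂ}
    (hγ : IsQNested q ξ s γ) : NestedSystem (q : ℂ) (fun j => (ξ j : ℂ)) (fun j => (s j : ℂ)) γ where
  q_ne := Complex.ofReal_ne_zero.2 h.q_pos.ne'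
  ξ_ne j := Complex.ofReal_ne_zero.2 (h.ξ_pos j).ne'
  s_ne j := Complex.ofReal_ne_zero.2 (h.s_neg j).ne
  contour := hγ.contour
  inside α j := by
    have := hγ.inside α j
    push_cast at this
    exact this
  outside α j := by
    have := hγ.outside α j
    push_cast at this
    exact this
  nested := hγ.nested

theorem IsLargeContour.isQNested {k : ℕ} {γ : ℝ → ℂ} (hk : 1 ≤ k) (hγ : IsLargeContour q ξ s k γ) :
    IsQNested q ξ s fun _ : Fin k => γ where
  contour _ := hγ.contour
  inside _ j := by
    have := hγ.inside 0 hk j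
    rwa [pow_zero, one_mul] at this
  outside _ := hγ.outside
  nested _ _ _ := hγ.nested
  small _ _ z hz := (hγ.nested z hz).1

end

theorem theorem7p3 (q : ℝ) (ξ s : ℕ → ℝ) (hstoch : StochasticParams q ξ s)
    (hq : q * (⨆ j, (ξ j)⁻¹ * |s j|) < ⨅ j, (ξ j)⁻¹ * |s j|)
    (hs : (⨆ j, (ξ j)⁻¹ * |s j|) < ⨅ j, (ξ j)⁻¹ * |(s j)⁻¹|)
    (k : ℕ) (hk : 1 ≤ k) :
    (∃ γ : Fin k → ℝ → ℂ, IsQNested q ξ s γ) ∧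
    (∃ γ : ℝ → ℂ, IsLargeContour q ξ s k γ) ∧
    ∀ lam mu : NonnegSignature k,
      (∀ γ : Fin k → ℝ → ℂ, IsQNested q ξ s γ →
        ((1 - (q : ℂ)) ^ k)⁻¹ *
          nestedIntegral k γ (fun u =>
            (∏ α : Fin k, ∏ β ∈ Finset.Ioi α, (u α - u β) / (u α - (q : ℂ) * u β)) *
            symFc (q : ℂ) (fun j => (ξ j : ℂ)) (fun j => (s j : ℂ)) lam u *
            ∏ i : Fin k, (u i)⁻¹ *
              phi (q : ℂ) (fun j => (ξ j : ℂ)⁻¹) (fun j => (s j : ℂ)) (mu.1 i) (u i)⁻¹)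
          = if lam = mu then 1 else 0) ∧
      (∀ γ : ℝ → ℂ, IsLargeContour q ξ s k γ →
        conjFactor (q : ℂ) (fun j => (s j : ℂ)) lam / ((1 - (q : ℂ)) ^ k * (k.factorial : ℂ)) *
          nestedIntegral k (fun _ => γ) (fun u =>
            (∏ i : Fin k, (u i)⁻¹) *
            (∏ α : Fin k, ∏ β ∈ Finset.univ.erase α, (u α - u β) / (u α - (q : ℂ) * u β)) *
            symF (q : ℂ) (fun j => (ξ j : ℂ)) (fun j => (s j : ℂ)) lam u *
            symF (q : ℂ) (fun j => (ξ j : ℂ)⁻¹) (fun j => (s j : ℂ)) mu (fun i => (u i)⁻¹))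
          = if lam = mu then 1 else 0) := by
  obtain ⟨r, hr, h1, h2⟩ := hstoch.exists_radius hs
  -- A single circle serves as the large contour and as all of the nested ones.
  refine ⟨⟨_, hstoch.isQNested_circle hr h1 h2 k⟩, ⟨_, hstoch.isLargeContour_circle hr h1 h2 k⟩,
    fun lam mu => ⟨fun γ hγ => ?_, fun γ hγ => ?_⟩⟩
  · refine (hγ.nestedSystem hstoch).orthogonality ?_ (fun j => ?_) lam mu
    · rw [Complex.norm_real, Real.norm_of_nonneg hstoch.q_pos.le]
      exact hstoch.q_lt_one
    · rw [Complex.norm_real]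
      exact hstoch.abs_s_lt_one j
  · refine ((hγ.isQNested hk).nestedSystem hstoch).orthogonality_single hγ.contour hγ.nested ?_
      (fun j => ?_) lam mu
    · rw [Complex.norm_real, Real.norm_of_nonneg hstoch.q_pos.le]
      exact hstoch.q_lt_one
    · rw [Complex.norm_real]
      exact hstoch.abs_s_lt_one j
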